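/- **Setting.** Let $X,Y\subset\mathbb R^d$, $c(x,y)=\tfrac12\|x-y\|^2$, let $\mathcal H_X,\mathcal H_Y$ be reproducing kernel Hilbert spaces of real functions on $X$ and $Y$ with kernels $k_X,k_Y$ and canonical feature maps $\phi_X,\phi_Y$, and let $\phi:X\times Y\to\mathcal H_{XY}$ be a map into a real Hilbert space, $k_{XY}(z,z')=\langle\phi(z),\phi(z')\rangle$. Assume that (a) there are $u_\star\in\mathcal H_X$, $v_\star\in\mathcal H_Y$ and a positive trace-class operator $A_\star$ on $\mathcal H_{XY}$ with $c(x,y)-u_\star(x)-v_\star(y)=\langle\phi(x,y),A_\star\phi(x,y)\rangle$ on $X\times Y$; (b) there are $u_1\in\mathcal H_X$, $v_1\in\mathcal H_Y$ with $u_1(x)+v_1(y)=k_{XY}((x,y),(x,y))$ on $X\times Y$ (for example: $k_{XY}$ is normalized to $1$ on the diagonal and $\mathcal H_X$ contains the constants). For $\ell\ge1$ points $(\tilde x_j,\tilde y_j)\in X\times Y$ (repetitions allowed), $\hat w_\mu\in\mathcal H_X$, $\hat w_\nu\in\mathcal H_Y$ and $\lambda_1,\lambda_2>0$ consider the problem $$\max_{u\in\mathcal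 H_X,\,v\in\mathcal H_Y,\,A\succeq0}\ V(u,v,A)=\langle u,\hat w_\mu\rangle+\langle v,\hat w_\nu\rangle-\lambda_1\operatorname{tr}A-\lambda_2(\|u\|^2+\|v\|^2)\tag{P}$$ subject to $c(\tilde x_j,\tilde y_j)-u(\tilde x_j)-v(\tilde y_j)=\langle\phi(\tilde x_j,\tilde y_j),A\,\phi(\tilde x_j,\tilde y_j)\rangle$ for $j=1,\dots,\ell$ ($A$ of finite trace). Its dual is $$\min_{\gamma\in\mathbb R^\ell}\ F(\gamma)=\tfrac1{4\lambda_2}\gamma^\top Q\gamma-\tfrac1{2\lambda_2}\sum_j\gamma_jz_j+\tfrac{q^2}{4\lambda_2}\quad\text{s.t. } S(\gamma)=\sum_j\gamma_j\Phi_j\Phi_j^\top+\lambda_1I\succeq0,\tag{D}$$ with $Q_{ij}=k_X(\tilde x_i,\tilde x_j)+k_Y(\tilde y_i,\tilde y_j)$, $z_j=\hat w_\mu(\tilde x_j)+\hat w_\nu(\tilde y_j)-2\lambda_2c(\tilde x_j,\tilde y_j)$, $q^2=\|\hat w_\mu\|^2+\|\hat w_\nu\|^2$, and $\Phi_j$ the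 columns of any $\ell\times\ell$ matrix $R$ (e.g. the Cholesky factor) with $R^\top R=K=\big(k_{XY}((\tilde x_i,\tilde y_i),(\tilde x_j,\tilde y_j))\big)_{i,j}$. For $\delta>0$ let $J_\delta(\gamma)=F(\gamma)-\tfrac\delta\ell\log\det S(\gamma)$. **Dual interior-point method.** A run with $N$ iterations consists of $\gamma_0=0,\gamma_1,\dots,\gamma_N$ with $S(\gamma_k)\succ0$, nonincreasing barrier weights $\delta_0\ge\dots\ge\delta_N>0$ with $\delta_N\le\tau$, and nonincreasing tilts $1\ge s_0\ge\dots\ge s_N=0$ (the part with $s_k>0$ is the preliminary phase), such that each $\gamma_{k+1}$ is obtained from $\gamma_k$ by one damped Newton step $\gamma_{k+1}=\gamma_k+\dfrac{p}{1+\sqrt{\ell/\delta_k}\,\sqrt{-g^\top p}}$, $\ J_{\delta_k}''(\gamma_k)\,p=-g$, $\ g=J_{\delta_k}'(\gamma_k)-s_kJ_{\delta_0}'(0)$. **Cost model.** A program runs on a real random access machine (integer registers for indices; cells for exact real numbers; $+,-,\times,/,\sqrt{\ }$, comparisons). Each instruction costs $1$, including access to $\tau,\lambda_1,\lambda_2$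 and to the values of $c,k_X,k_Y,k_{XY}$ at the points; each query of a value $\hat w_\mu(\tilde x_j)$ or $\hat w_\nu(\tilde y_j)$ costs $E$ more, and each query of $q^2$ costs $C$ more. Memory is the number of integer registers and real cells written. **Theorem.** There is one program, independent of all the data, with the following property. In every setting as above and for every $r\in\mathbb N$ there is a constant $\kappa$ (depending only on the setting and on $r$) such that for all $\ell\ge1$, $0<\tau\le\tfrac12$, all points, all $\lambda_1,\lambda_2\in[(\tau/\ell)^r,(\ell/\tau)^r]$, all $\hat w_\mu,\hat w_\nu$ of norm at most $(\ell/\tau)^r$, and all $C,E\in\mathbb N$, the program halts after operations of total cost at most $$\kappa\Big(C+E\ell+\ell^{3.5}\log\frac{\ell}{\tau}\Big),$$ uses memory at most $\kappa\,\ell^2$, and outputs $\gamma,\beta\in\mathbb R^\ell$, $B\in\mathbb R^{\ell\times\ell}$ such that 1. the triple $\tilde u=\frac1{2\lambda_2}(\hat w_\mu-\sum_i\beta_i\phi_X(\tilde x_i))$, $\tilde v=\frac1{2\lambda_2}(\hat w_\nu-\sum_i\beta_i\phi_Y(\tilde y_i))$, $\tilde A=\sum_{i,j}B_{ij}\,\phi(\tilde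 x_i,\tilde y_i)\otimes\phi(\tilde x_j,\tilde y_j)$ is admissible for (P), and $V(u,v,A)-V(\tilde u,\tilde v,\tilde A)\le\tau$ for every admissible $(u,v,A)$; 2. for every $R$ with $R^\top R=K$, $\gamma$ is the last iterate of a run of the dual interior-point method with at most $\kappa\sqrt\ell\,\log(\ell/\tau)$ iterations, and $F(\gamma)-F(\gamma')\le\tau$ for every $\gamma'$ feasible for (D). -/

import Mathlib

open scoped InnerProductSpace Matrix

universe uX uY uH

noncomputable section

/-! ### A real random access machine with a step count, a memory count and priced queries -/

/-- A reference to a cell of a two-dimensional array of real numbers: `arr` is the name of the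
array, and the integer registers `row` and `col` hold the two indices. -/
structure Ref where
  arr : ℕ
  row : ℕ
  col : ℕ

/-- The questions a program may ask about its input. Arguments are integer registers that hold
the indices (indices of the `ℓ` points run from `0` to `ℓ - 1`). -/
inductive Query where
  | tau
  | lamOne
  | lamTwo
  | cost (i : ℕ)
  | kerX (i j : ℕ)
  | kerY (i j : ℕ)
  | kerXY (i j : ℕ)
  | meanX (i : ℕ)
  | meanY (i : ℕ)
  | normSq

inductive ArithOp where
  | add
  | sub
  | mul
  | div

inductive Test where
  | intLt (a b : ℕ)
  | realLt (a b : Ref)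

/-- Programs. -/
inductive Cmd where
  | skip
  | intConst (r n : ℕ)
  | intAdd (r a b : ℕ)
  | intSub (r a b : ℕ)
  | ofInt (dst : Ref) (r : ℕ)
  | arith (op : ArithOp) (dst a b : Ref)
  | sqrt (dst a : Ref)
  | query (dst : Ref) (q : Query)
  | seq (p q : Cmd)
  | ite (t : Test) (p q : Cmd)
  | loop (t : Test) (p : Cmd)

/-- A memory state: integer registers, and array cells that hold exact real numbers. -/
structure State where
  int : ℕ → ℕ
  real : ℕ × ℕ × ℕ → ℝ

/-- The values behind the queries. -/
structure Input where
  ell : ℕ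
  tau : ℝ
  lamOne : ℝ
  lamTwo : ℝ
  cost : ℕ → ℝ
  kerX : ℕ → ℕ → ℝ
  kerY : ℕ → ℕ → ℝ
  kerXY : ℕ → ℕ → ℝ
  meanX : ℕ → ℝ
  meanY : ℕ → ℝ
  normSq : ℝ

def Ref.addr (a : Ref) (σ : State) : ℕ × ℕ × ℕ := (a.arr, σ.int a.row, σ.int a.col)

def State.get (σ : State) (a : Ref) : ℝ := σ.real (a.addr σ)

def State.setReal (σ : State) (a : Ref) (x : ℝ) : State :=
  ⟨σ.int, Function.update σ.real (a.addr σ) x⟩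

def State.setInt (σ : State) (r n : ℕ) : State :=
  ⟨Function.update σ.int r n, σ.real⟩

def ArithOp.eval : ArithOp → ℝ → ℝ → ℝ
  | .add, x, y => x + y
  | .sub, x, y => x - y
  | .mul, x, y => x * y
  | .div, x, y => x / y

def Test.Holds (σ : State) : Test → Prop
  | .intLt a b => σ.int a < σ.int b
  | .realLt a b => σ.get a < σ.get b

def Query.answer (I : Input) (σ : State) : Query → ℝ
  | .tau => I.tau
  | .lamOne => I.lamOne
  | .lamTwo => I.lamTwo
  | .cost i => I.cost (σ.int i)
  | .kerX i j => I.kerX (σ.int i) (σ.int j)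
  | .kerY i j => I.kerY (σ.int i) (σ.int j)
  | .kerXY i j => I.kerXY (σ.int i) (σ.int j)
  | .meanX i => I.meanX (σ.int i)
  | .meanY i => I.meanY (σ.int i)
  | .normSq => I.normSq

/-- The price of a query on top of the unit price of every instruction: `E` for an evaluation of
one of the two mean embeddings, `C` for the sum of their squared norms, nothing otherwise. -/
def Query.price (C E : ℕ) : Query → ℕ
  | .meanX _ => E
  | .meanY _ => E
  | .normSq => C
  | _ => 0

/-- Memory locations: integer registers and real cells. -/
abbrev Loc := ℕ ⊕ (ℕ × ℕ × ℕ)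

/-- `Exec I C E p σ σ' t W`: on the input `I`, the program `p` started in the state `σ` halts in
the state `σ'` after operations of total cost `t`, having written exactly the locations in `W`. -/
inductive Exec (I : Input) (C E : ℕ) : Cmd → State → State → ℕ → Finset Loc → Prop
  | skip (σ : State) : Exec I C E .skip σ σ 0 ∅
  | intConst (σ : State) (r n : ℕ) :
      Exec I C E (.intConst r n) σ (σ.setInt r n) 1 {Sum.inl r}
  | intAdd (σ : State) (r a b : ℕ) :
      Exec I C E (.intAdd r a b) σ (σ.setInt r (σ.int a + σ.int b)) 1 {Sum.inl r}
  | intSub (σ : State) (r a b : ℕ) :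
      Exec I C E (.intSub r a b) σ (σ.setInt r (σ.int a - σ.int b)) 1 {Sum.inl r}
  | ofInt (σ : State) (dst : Ref) (r : ℕ) :
      Exec I C E (.ofInt dst r) σ (σ.setReal dst (σ.int r : ℝ)) 1 {Sum.inr (dst.addr σ)}
  | arith (σ : State) (op : ArithOp) (dst a b : Ref) :
      Exec I C E (.arith op dst a b) σ (σ.setReal dst (op.eval (σ.get a) (σ.get b))) 1
        {Sum.inr (dst.addr σ)}
  | sqrt (σ : State) (dst a : Ref) :
      Exec I C E (.sqrt dst a) σ (σ.setReal dst (Real.sqrt (σ.get a))) 1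
        {Sum.inr (dst.addr σ)}
  | query (σ : State) (dst : Ref) (q : Query) :
      Exec I C E (.query dst q) σ (σ.setReal dst (q.answer I σ)) (1 + q.price C E)
        {Sum.inr (dst.addr σ)}
  | seq {p q : Cmd} {σ₁ σ₂ σ₃ : State} {t₁ t₂ : ℕ} {W₁ W₂ : Finset Loc} :
      Exec I C E p σ₁ σ₂ t₁ W₁ → Exec I C E q σ₂ σ₃ t₂ W₂ →
      Exec I C E (.seq p q) σ₁ σ₃ (t₁ + t₂) (W₁ ∪ W₂)
  | iteTrue {b : Test} {p q : Cmd} {σ σ' : State} {t : ℕ} {W : Finset Loc} :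
      b.Holds σ → Exec I C E p σ σ' t W → Exec I C E (.ite b p q) σ σ' (1 + t) W
  | iteFalse {b : Test} {p q : Cmd} {σ σ' : State} {t : ℕ} {W : Finset Loc} :
      ¬ b.Holds σ → Exec I C E q σ σ' t W → Exec I C E (.ite b p q) σ σ' (1 + t) W
  | loopDone {b : Test} {p : Cmd} {σ : State} :
      ¬ b.Holds σ → Exec I C E (.loop b p) σ σ 1 ∅
  | loopStep {b : Test} {p : Cmd} {σ₁ σ₂ σ₃ : State} {t₁ t₂ : ℕ} {W₁ W₂ : Finset Loc} :
      b.Holds σ₁ → Exec I C E p σ₁ σ₂ t₁ W₁ → Exec I C E (.loop b p) σ₂ σ₃ t₂ W₂ →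
      Exec I C E (.loop b p) σ₁ σ₃ (1 + t₁ + t₂) (W₁ ∪ W₂)

/-- At the start the integer register `0` holds `ℓ`, and everything else is zero. -/
def State.start (ell : ℕ) : State := ⟨Function.update (fun _ => 0) 0 ell, fun _ => 0⟩

/-! ### The primal problem -/

/-- A chosen Hilbert (orthonormal) basis. -/
def stdHilbertBasis (H : Type*) [NormedAddCommGroup H] [InnerProductSpace ℝ H]
    [CompleteSpace H] : HilbertBasis (exists_hilbertBasis ℝ H).choose ℝ H :=
  (exists_hilbertBasis ℝ H).choose_spec.choose

/-- The trace, in `[0, ∞]`, of a positive bounded operator: the sum of its diagonal coefficients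
in an orthonormal basis (for positive operators the sum is the same in all of them). -/
def opTrace {H : Type*} [NormedAddCommGroup H] [InnerProductSpace ℝ H] [CompleteSpace H]
    (A : H →L[ℝ] H) : ENNReal :=
  ∑' i, ENNReal.ofReal ⟪stdHilbertBasis H i, A (stdHilbertBasis H i)⟫_ℝ

/-- The canonical feature map of a reproducing kernel Hilbert space of real functions. -/
def feature {Z : Type*} (H : Type*) [NormedAddCommGroup H] [InnerProductSpace ℝ H]
    [CompleteSpace H] [RKHS ℝ H Z ℝ] (z : Z) : H := RKHS.kerFun H z 1

/-- The quadratic cost. -/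
def quadCost {d : ℕ} (x y : EuclideanSpace ℝ (Fin d)) : ℝ := ‖x - y‖ ^ 2 / 2

/-- The data of the subsampled problem: `ℓ` points of `X × Y`, two (estimated) mean embeddings
and the two regularization parameters. -/
structure Problem {d : ℕ} (X Y : Set (EuclideanSpace ℝ (Fin d))) (HX : Type uX) (HY : Type uY)
    (ell : ℕ) where
  x : Fin ell → X
  y : Fin ell → Y
  wMu : HX
  wNu : HY
  lamOne : ℝ
  lamTwo : ℝ

/-- The data of the dual problem; `R` is a factor of the kernel matrix, `Rᵀ * R = K`. -/
structure DualData (ell : ℕ) where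
  Q : Matrix (Fin ell) (Fin ell) ℝ
  R : Matrix (Fin ell) (Fin ell) ℝ
  z : Fin ell → ℝ
  qSq : ℝ
  lamOne : ℝ
  lamTwo : ℝ

namespace Problem

variable {d : ℕ} {X Y : Set (EuclideanSpace ℝ (Fin d))} {HX : Type uX} {HY : Type uY}
  {HXY : Type uH} {ell : ℕ}
  [NormedAddCommGroup HX] [InnerProductSpace ℝ HX]
  [NormedAddCommGroup HY] [InnerProductSpace ℝ HY]
  [NormedAddCommGroup HXY] [InnerProductSpace ℝ HXY] [CompleteSpace HXY]
  [RKHS ℝ HX X ℝ] [RKHS ℝ HY Y ℝ]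

/-- Admissible triples: `A` is a positive operator with finite trace, and the equality constraints
hold at the `ℓ` points. -/
def Admissible (P : Problem X Y HX HY ell) (φ : X × Y → HXY) (u : HX) (v : HY)
    (A : HXY →L[ℝ] HXY) : Prop :=
  A.IsPositive ∧ opTrace A ≠ ⊤ ∧
    ∀ j, quadCost (P.x j : EuclideanSpace ℝ (Fin d)) (P.y j) - u (P.x j) - v (P.y j)
      = ⟪φ (P.x j, P.y j), A (φ (P.x j, P.y j))⟫_ℝ

/-- The objective of the primal (maximization) problem. -/
def value (P : Problem X Y HX HY ell) (u : HX) (v : HY) (A : HXY →L[ℝ] HXY) : ℝ :=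
  ⟪u, P.wMu⟫_ℝ + ⟪v, P.wNu⟫_ℝ - P.lamOne * (opTrace A).toReal
    - P.lamTwo * (‖u‖ ^ 2 + ‖v‖ ^ 2)

/-- `q² = ‖w_μ‖² + ‖w_ν‖²`. -/
def qSq (P : Problem X Y HX HY ell) : ℝ := ‖P.wMu‖ ^ 2 + ‖P.wNu‖ ^ 2

/-- The matrix `K` of the kernel `⟨φ, φ⟩` at the points. -/
def kerMatrix (P : Problem X Y HX HY ell) (φ : X × Y → HXY) : Matrix (Fin ell) (Fin ell) ℝ :=
  .of fun i j => ⟪φ (P.x i, P.y i), φ (P.x j, P.y j)⟫_ℝ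

variable [CompleteSpace HX] [CompleteSpace HY]

/-- The first component of the primal point with coefficients `β`. -/
def uOf (P : Problem X Y HX HY ell) (β : Fin ell → ℝ) : HX :=
  (1 / (2 * P.lamTwo)) • (P.wMu - ∑ i, β i • feature HX (P.x i))

/-- The second component of the primal point with coefficients `β`. -/
def vOf (P : Problem X Y HX HY ell) (β : Fin ell → ℝ) : HY :=
  (1 / (2 * P.lamTwo)) • (P.wNu - ∑ i, β i • feature HY (P.y i))

/-- The operator `∑ B i j φ_i ⊗ φ_j` with coefficients `B`. -/
def opOf (P : Problem X Y HX HY ell) (φ : X × Y → HXY) (B : Fin ell → Fin ell → ℝ) :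
    HXY →L[ℝ] HXY :=
  ∑ i, ∑ j, B i j • InnerProductSpace.rankOne ℝ (φ (P.x i, P.y i)) (φ (P.x j, P.y j))

/-- What a program sees of the problem (and of the precision `τ`). -/
def input (P : Problem X Y HX HY ell) (φ : X × Y → HXY) (τ : ℝ) : Input where
  ell := ell
  tau := τ
  lamOne := P.lamOne
  lamTwo := P.lamTwo
  cost i := if h : i < ell then
    quadCost (P.x ⟨i, h⟩ : EuclideanSpace ℝ (Fin d)) (P.y ⟨i, h⟩) else 0
  kerX i j := if h : i < ell ∧ j < ell then
    ⟪feature HX (P.x ⟨i, h.1⟩), feature HX (P.x ⟨j, h.2⟩)⟫_ℝ else 0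
  kerY i j := if h : i < ell ∧ j < ell then
    ⟪feature HY (P.y ⟨i, h.1⟩), feature HY (P.y ⟨j, h.2⟩)⟫_ℝ else 0
  kerXY i j := if h : i < ell ∧ j < ell then P.kerMatrix φ ⟨i, h.1⟩ ⟨j, h.2⟩ else 0
  meanX i := if h : i < ell then P.wMu (P.x ⟨i, h⟩) else 0
  meanY i := if h : i < ell then P.wNu (P.y ⟨i, h⟩) else 0
  normSq := P.qSq

/-- The dual problem, for a factor `R` of the kernel matrix. -/
def dual (P : Problem X Y HX HY ell) (R : Matrix (Fin ell) (Fin ell) ℝ) : DualData ell where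
  Q := .of fun i j => ⟪feature HX (P.x i), feature HX (P.x j)⟫_ℝ
    + ⟪feature HY (P.y i), feature HY (P.y j)⟫_ℝ
  R := R
  z := fun j => P.wMu (P.x j) + P.wNu (P.y j)
    - 2 * P.lamTwo * quadCost (P.x j : EuclideanSpace ℝ (Fin d)) (P.y j)
  qSq := P.qSq
  lamOne := P.lamOne
  lamTwo := P.lamTwo

end Problem

/-! ### The dual problem and the barrier method -/

namespace DualData

variable {ell : ℕ}

/-- The column `Φ_j` of `R`. -/
def Phi (D : DualData ell) (j : Fin ell) : Fin ell → ℝ := fun i => D.R i j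

/-- The dual objective (to be minimized). -/
def F (D : DualData ell) (γ : Fin ell → ℝ) : ℝ :=
  1 / (4 * D.lamTwo) * (γ ⬝ᵥ (D.Q *ᵥ γ)) - 1 / (2 * D.lamTwo) * ∑ j, γ j * D.z j
    + D.qSq / (4 * D.lamTwo)

/-- The matrix `∑ γ_j Φ_j Φ_jᵀ + λ₁ I` of the semidefinite constraint. -/
def slack (D : DualData ell) (γ : Fin ell → ℝ) : Matrix (Fin ell) (Fin ell) ℝ :=
  ∑ j, γ j • Matrix.vecMulVec (D.Phi j) (D.Phi j) + D.lamOne • 1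

/-- `Φ_iᵀ (slack γ)⁻¹ Φ_j`. -/
def gram (D : DualData ell) (γ : Fin ell → ℝ) (i j : Fin ell) : ℝ :=
  D.Phi i ⬝ᵥ ((D.slack γ)⁻¹ *ᵥ D.Phi j)

/-- The gradient of the barrier function `F γ - (δ / ℓ) * log det (slack γ)`. -/
def grad (D : DualData ell) (δ : ℝ) (γ : Fin ell → ℝ) : Fin ell → ℝ := fun i =>
  1 / (2 * D.lamTwo) * (D.Q *ᵥ γ) i - 1 / (2 * D.lamTwo) * D.z i - δ / ell * D.gram γ i i

/-- The Hessian of the barrier function `F γ - (δ / ℓ) * log det (slack γ)`. -/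
def hess (D : DualData ell) (δ : ℝ) (γ : Fin ell → ℝ) : Matrix (Fin ell) (Fin ell) ℝ :=
  .of fun i j => 1 / (2 * D.lamTwo) * D.Q i j + δ / ell * D.gram γ i j ^ 2

/-- `γ'` arises from `γ` by one damped Newton step for the function
`F - (δ / ℓ) log det slack - ⟨e, ·⟩`; `dir` is the Newton direction (a solution of the Newton
system), and `√(-(g ⬝ᵥ dir))` is the Newton decrement. -/
def DampedNewton (D : DualData ell) (δ : ℝ) (e γ γ' : Fin ell → ℝ) : Prop :=
  ∃ dir : Fin ell → ℝ, D.hess δ γ *ᵥ dir = -(D.grad δ γ - e) ∧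
    γ' = γ + (1 / (1 + √(ell / δ) * √(-((D.grad δ γ - e) ⬝ᵥ dir)))) • dir

/-- `N` iterations of the dual interior-point method, from `0` to `γ`, down to a barrier weight at
most `τ`: damped Newton steps in the interior of the dual feasible set, one for each value of the
decreasing barrier weight `δ k`. The preliminary phase of the barrier method is the part with
`s k > 0`: there the barrier function is tilted by `s k` times its gradient at the starting point
`0` (for `s = 1` its minimizer is `0` itself), and `s` decreases to `0`. -/
def BarrierRun (D : DualData ell) (τ : ℝ) (N : ℕ) (γ : Fin ell → ℝ) : Prop :=
  ∃ (δ s : ℕ → ℝ) (g : ℕ → Fin ell → ℝ),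
    Antitone δ ∧ (∀ k, 0 < δ k) ∧ δ N ≤ τ ∧
    Antitone s ∧ s 0 ≤ 1 ∧ (∀ k, 0 ≤ s k) ∧ s N = 0 ∧
    g 0 = 0 ∧ g N = γ ∧
    (∀ k ≤ N, (D.slack (g k)).PosDef) ∧
    ∀ k < N, D.DampedNewton (δ k) (s k • D.grad (δ 0) 0) (g k) (g (k + 1))

end DualData

end

/-!
The barrier function is rescaled to `t * F - log det slack` with `t = ℓ / δ`, which is
self-concordant; `gradT`, `hessT` and `locNorm` are its gradient, its Hessian and the norm of the
latter. The invariant `DualData.Near` says that the gradient, tilted by `s` times the gradient at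
the starting point, is at most `1 / 8` in the dual local norm. A damped Newton step squares this
quantity up to a constant (`Valid.newton`), so it leaves room for a change of the parameters in
each round: as long as `s > 0`, the tilt `s` is lowered by `1 / 8` over the dual local norm of the
direction of the tilt, and afterwards `t` grows by the factor `1 + 1 / (16 √ℓ)` (`Near.next`). No
calculus is needed: with `S⁻¹ = Cᵀ * C` for the slack matrix `S`, the change of the gradient in a
step is an explicit expression in the symmetric matrices `C * lin n * Cᵀ`, whose Frobenius norm is
the barrier part of the local norm.

The number of rounds of the main phase is clear, and the point is the preliminary phase. There
solvability of the equality-constrained problem on all of `X × Y` and the assumption on the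
diagonal of the kernel enter, through the structure `DualData.Slater`: the vector `z` of the dual
objective and the diagonal of the kernel matrix are, up to values of a trace-class form, evaluations
of elements of the two reproducing kernel Hilbert spaces, hence bounded by the seminorm of `Q`. At
every point near the path this bounds the dual local norm of the gradient by a constant times `√ℓ`,
and that of the direction of the tilt by a polynomial in `ℓ / τ` (`Slater.phase_one`). The first
bound makes the tilt decrease by a factor `1 - O(1 / √ℓ)` per round, the second one makes it vanish
after `O(√ℓ log (ℓ / τ))` rounds (`exists_stop_iterate`).

At the end the Newton direction `p` of the untilted function yields the primal point: the Newton
system at `γ` is the system of the `ℓ` equality constraints for the functions with coefficients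
`γ + p` and the operator with the coefficients `primalCoeff`. As `p` has local norm at most `1 / 8`,
this operator is positive, and the duality gap is at most `2 * ℓ / t` (`admissible_primal`).
Together with weak duality (`value_le_F`) both optimality claims follow.

The factor `R` of the kernel matrix `K` never has to be computed. With the matrix
`kerSlack = Rᵀ * slack * R`, which is a polynomial in `K` and `γ`, the matrix `DualData.gram` is
`K * G * K` for any symmetric generalized inverse `G` of `kerSlack` (`kerGram_eq`). A generalized
inverse of a positive semidefinite matrix is found in cubic time by Gram-Schmidt orthogonalization
of the unit vectors for its quadratic form (`ginv`), without any case distinction on ranks beyond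
the sign of one number per step. Hence the iterates do not depend on `R` (`iterate_eq`).

The program is written in a small language of array expressions with sums, which has a compiler into
the machine code with proved values, costs and memory (`Stmt.runs_compile`, `Stmt.exists_cost_le`).
-/


noncomputable section

/-! ### Executions with bounds on cost and memory -/

/-- The locations with register and array names below `m` and array indices below `ell`. -/
def memBox (m ell : ℕ) : Finset Loc :=
  (Finset.range m).disjSum (Finset.range m ×ˢ Finset.range ell ×ˢ Finset.range ell)

theorem card_memBox (m ell : ℕ) : (memBox m ell).card = m + m * (ell * ell) := by
  simp [memBox]

@[simp] theorem inl_mem_memBox {m ell r : ℕ} : (Sum.inl r : Loc) ∈ memBox m ell ↔ r < m := by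
  simp [memBox]

@[simp] theorem inr_mem_memBox {m ell a i j : ℕ} :
    (Sum.inr (a, i, j) : Loc) ∈ memBox m ell ↔ a < m ∧ i < ell ∧ j < ell := by
  simp [memBox]

/-- From the state `σ` the program `p` halts in a state with the property `Q`, at a cost of at
most `T`, and writes only to `memBox m I.ell`. -/
def Runs (I : Input) (C E m : ℕ) (p : Cmd) (σ : State) (T : ℕ) (Q : State → Prop) : Prop :=
  ∃ (σ' : State) (t : ℕ) (W : Finset Loc), Exec I C E p σ σ' t W ∧ t ≤ T ∧
    W ⊆ memBox m I.ell ∧ Q σ'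

section Runs

variable {I : Input} {C E m : ℕ}

theorem Runs.mono {p : Cmd} {σ : State} {T T' : ℕ} {Q Q' : State → Prop}
    (h : Runs I C E m p σ T Q) (hT : T ≤ T') (hQ : ∀ σ', Q σ' → Q' σ') :
    Runs I C E m p σ T' Q' := by
  obtain ⟨σ', t, W, h1, h2, h3, h4⟩ := h
  exact ⟨σ', t, W, h1, h2.trans hT, h3, hQ _ h4⟩

theorem Runs.seq {p q : Cmd} {σ : State} {T₁ T₂ : ℕ} {Q Q' : State → Prop}
    (hp : Runs I C E m p σ T₁ Q) (hq : ∀ σ', Q σ' → Runs I C E m q σ' T₂ Q') :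
    Runs I C E m (.seq p q) σ (T₁ + T₂) Q' := by
  obtain ⟨σ₁, t₁, W₁, h1, h2, h3, h4⟩ := hp
  obtain ⟨σ₂, t₂, W₂, k1, k2, k3, k4⟩ := hq _ h4
  exact ⟨σ₂, _, _, .seq h1 k1, by lia, Finset.union_subset h3 k3, k4⟩

theorem Runs.ite {b : Test} {p q : Cmd} {σ : State} {T₁ T₂ : ℕ} {Q : State → Prop}
    (hp : b.Holds σ → Runs I C E m p σ T₁ Q) (hq : ¬ b.Holds σ → Runs I C E m q σ T₂ Q) :
    Runs I C E m (.ite b p q) σ (1 + (T₁ + T₂)) Q := by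
  by_cases hb : b.Holds σ
  · obtain ⟨σ₁, t₁, W₁, h1, h2, h3, h4⟩ := hp hb
    exact ⟨σ₁, _, _, .iteTrue hb h1, by lia, h3, h4⟩
  · obtain ⟨σ₁, t₁, W₁, h1, h2, h3, h4⟩ := hq hb
    exact ⟨σ₁, _, _, .iteFalse hb h1, by lia, h3, h4⟩

theorem Runs.intConst {σ : State} {r n : ℕ} (hr : r < m) :
    Runs I C E m (.intConst r n) σ 1 (· = σ.setInt r n) :=
  ⟨_, _, _, .intConst σ r n, le_rfl, by simpa using hr, rfl⟩

theorem Runs.intAdd {σ : State} {r a b : ℕ} (hr : r < m) :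
    Runs I C E m (.intAdd r a b) σ 1 (· = σ.setInt r (σ.int a + σ.int b)) :=
  ⟨_, _, _, .intAdd σ r a b, le_rfl, by simpa using hr, rfl⟩

theorem Runs.ofInt {σ : State} {dst : Ref} {r : ℕ} (h1 : dst.arr < m)
    (h2 : σ.int dst.row < I.ell) (h3 : σ.int dst.col < I.ell) :
    Runs I C E m (.ofInt dst r) σ 1 (· = σ.setReal dst (σ.int r : ℝ)) :=
  ⟨_, _, _, .ofInt σ dst r, le_rfl, by simp [Ref.addr, h1, h2, h3], rfl⟩

theorem Runs.arith {σ : State} {op : ArithOp} {dst a b : Ref} (h1 : dst.arr < m)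
    (h2 : σ.int dst.row < I.ell) (h3 : σ.int dst.col < I.ell) :
    Runs I C E m (.arith op dst a b) σ 1 (· = σ.setReal dst (op.eval (σ.get a) (σ.get b))) :=
  ⟨_, _, _, .arith σ op dst a b, le_rfl, by simp [Ref.addr, h1, h2, h3], rfl⟩

theorem Runs.sqrt {σ : State} {dst a : Ref} (h1 : dst.arr < m)
    (h2 : σ.int dst.row < I.ell) (h3 : σ.int dst.col < I.ell) :
    Runs I C E m (.sqrt dst a) σ 1 (· = σ.setReal dst (Real.sqrt (σ.get a))) :=
  ⟨_, _, _, .sqrt σ dst a, le_rfl, by simp [Ref.addr, h1, h2, h3], rfl⟩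

theorem Runs.query {σ : State} {dst : Ref} {q : Query} (h1 : dst.arr < m)
    (h2 : σ.int dst.row < I.ell) (h3 : σ.int dst.col < I.ell) :
    Runs I C E m (.query dst q) σ (1 + q.price C E) (· = σ.setReal dst (q.answer I σ)) :=
  ⟨_, _, _, .query σ dst q, le_rfl, by simp [Ref.addr, h1, h2, h3], rfl⟩

/-- A loop that is left after exactly `n` rounds. -/
theorem Runs.loop {b : Test} {p : Cmd} {T : ℕ} (Inv : ℕ → State → Prop) (n : ℕ)
    (hstep : ∀ k < n, ∀ σ, Inv k σ → b.Holds σ ∧ Runs I C E m p σ T (Inv (k + 1)))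
    (hend : ∀ σ, Inv n σ → ¬ b.Holds σ) {σ : State} (h0 : Inv 0 σ) :
    Runs I C E m (.loop b p) σ (n * (T + 1) + 1) (Inv n) := by
  suffices H : ∀ j k, k + j = n → ∀ σ, Inv k σ →
      Runs I C E m (.loop b p) σ (j * (T + 1) + 1) (Inv n) from H n 0 (by lia) σ h0
  intro j
  induction j with
  | zero =>
    intro k hk σ hσ
    obtain rfl : k = n := by lia
    exact ⟨σ, 1, ∅, .loopDone (hend σ hσ), by lia, by simp, hσ⟩
  | succ j ih =>
    intro k hk σ hσ
    obtain ⟨hb, σ₁, t₁, W₁, h1, h2, h3, h4⟩ := hstep k (by lia) σ hσ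
    obtain ⟨σ₂, t₂, W₂, k1, k2, k3, k4⟩ := ih (k + 1) (by lia) σ₁ h4
    exact ⟨σ₂, _, _, .loopStep hb h1 k1, by rw [Nat.succ_mul]; lia, Finset.union_subset h3 k3, k4⟩

end Runs

/-! ### A language of array expressions and its compiler -/

/-- Array contents: `S a i j` is the entry of the array `a` at `(i, j)`. -/
abbrev Store := ℕ → ℕ → ℕ → ℝ

/-- The array contents of a memory state. -/
def State.store (σ : State) : Store := fun a i j => σ.real (a, i, j)

/-- Real expressions over the arrays and the integer registers. `sum e` is the sum of `e` over an
index that runs from `0` to `ℓ - 1`; bound indices have no names, the one bound at nesting depth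
`n` lives in the register `3 + n`. The register `0` holds `ℓ`, the register `1` holds `0`, and the
register `2` is scratch space. -/
inductive Ex where
  | ref (a r c : ℕ)
  | reg (r : ℕ)
  | nat (n : ℕ)
  | op (o : ArithOp) (e f : Ex)
  | sqrt (e : Ex)
  | query (q : Query)
  | ifLt (a b e f : Ex)
  | sum (e : Ex)

namespace Ex

/-- The value of an expression at nesting depth `n`, for register contents `ρ`. -/
def eval (I : Input) : Ex → ℕ → (ℕ → ℕ) → Store → ℝ
  | .ref a r c, _, ρ, S => S a (ρ r) (ρ c)
  | .reg r, _, ρ, _ => ρ r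
  | .nat k, _, _, _ => k
  | .op o e f, n, ρ, S => o.eval (e.eval I n ρ S) (f.eval I n ρ S)
  | .sqrt e, n, ρ, S => Real.sqrt (e.eval I n ρ S)
  | .query q, _, ρ, _ => q.answer I ⟨ρ, fun _ => 0⟩
  | .ifLt a b e f, n, ρ, S =>
      open Classical in
      if a.eval I n ρ S < b.eval I n ρ S then e.eval I n ρ S else f.eval I n ρ S
  | .sum e, n, ρ, S =>
      ∑ k ∈ Finset.range (ρ 0), e.eval I (n + 1) (Function.update ρ (3 + n) k) S

/-- A register that may be read at nesting depth `n`. -/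
def regOk (n r : ℕ) : Bool := decide (r < 3 + n) && decide (r ≠ 2)

end Ex

/-- The index registers of a query may be read at nesting depth `n`. -/
def Query.regsOk (n : ℕ) : Query → Bool
  | .cost i => Ex.regOk n i
  | .kerX i j => Ex.regOk n i && Ex.regOk n j
  | .kerY i j => Ex.regOk n i && Ex.regOk n j
  | .kerXY i j => Ex.regOk n i && Ex.regOk n j
  | .meanX i => Ex.regOk n i
  | .meanY i => Ex.regOk n i
  | _ => true

namespace Ex

/-- Well-scopedness at nesting depth `n`; the arrays from `32` on are kept for intermediate
results. -/
def ok : Ex → ℕ → Bool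
  | .ref a r c, n => decide (a < 32) && regOk n r && regOk n c
  | .reg r, n => regOk n r
  | .nat _, _ => true
  | .op _ e f, n => e.ok n && f.ok n
  | .sqrt e, n => e.ok n
  | .query q, n => q.regsOk n
  | .ifLt a b e f, n => a.ok n && b.ok n && e.ok n && f.ok n
  | .sum e, n => e.ok (n + 1)

/-- The expression does not read the array `x`. -/
def avoids (x : ℕ) : Ex → Bool
  | .ref a _ _ => decide (a ≠ x)
  | .reg _ => true
  | .nat _ => true
  | .op _ e f => e.avoids x && f.avoids x
  | .sqrt e => e.avoids x
  | .query _ => true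
  | .ifLt a b e f => a.avoids x && b.avoids x && e.avoids x && f.avoids x
  | .sum e => e.avoids x

/-- A bound for the number of registers and of auxiliary arrays that an evaluation takes up. -/
def size : Ex → ℕ
  | .ref _ _ _ => 1
  | .reg _ => 1
  | .nat _ => 1
  | .op _ e f => e.size + f.size + 1
  | .sqrt e => e.size + 1
  | .query _ => 1
  | .ifLt a b e f => a.size + b.size + e.size + f.size + 1
  | .sum e => e.size + 2

/-- The cell for an intermediate result at stack height `d`. -/
def tmp (d : ℕ) : Ref := ⟨32 + d, 1, 1⟩

end Ex

/-- Run `p` with the register `r` going from `0` to `ℓ - 1`. -/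
def forCmd (r : ℕ) (p : Cmd) : Cmd :=
  .seq (.intConst r 0) (.loop (.intLt r 0) (.seq p (.seq (.intConst 2 1) (.intAdd r r 2))))

namespace Ex

/-- A program that evaluates an expression at nesting depth `n` into the cell `tmp d`. -/
def compile : Ex → ℕ → ℕ → Cmd
  | .ref a r c, _, d =>
      .seq (.intConst 2 0) (.seq (.ofInt (tmp d) 2) (.arith .add (tmp d) (tmp d) ⟨a, r, c⟩))
  | .reg r, _, d => .ofInt (tmp d) r
  | .nat k, _, d => .seq (.intConst 2 k) (.ofInt (tmp d) 2)
  | .op o e f, n, d =>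
      .seq (e.compile n d) (.seq (f.compile n (d + 1)) (.arith o (tmp d) (tmp d) (tmp (d + 1))))
  | .sqrt e, n, d => .seq (e.compile n d) (.sqrt (tmp d) (tmp d))
  | .query q, _, d => .query (tmp d) q
  | .ifLt a b e f, n, d =>
      .seq (a.compile n d) (.seq (b.compile n (d + 1))
        (.ite (.realLt (tmp d) (tmp (d + 1))) (e.compile n d) (f.compile n d)))
  | .sum e, n, d =>
      .seq (.intConst 2 0) (.seq (.ofInt (tmp d) 2)
        (forCmd (3 + n) (.seq (e.compile (n + 1) (d + 1))
          (.arith .add (tmp d) (tmp d) (tmp (d + 1))))))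

/-- An upper bound for the cost of evaluating an expression. -/
def cost (ell C E : ℕ) : Ex → ℕ
  | .ref _ _ _ => 3
  | .reg _ => 1
  | .nat _ => 2
  | .op _ e f => e.cost ell C E + f.cost ell C E + 1
  | .sqrt e => e.cost ell C E + 1
  | .query q => 1 + q.price C E
  | .ifLt a b e f =>
      a.cost ell C E + b.cost ell C E + (e.cost ell C E + f.cost ell C E) + 1
  | .sum e => ell * (e.cost ell C E + 4) + 4

end Ex

/-- `σ'` and `σ` agree on the registers in scope at nesting depth `n` and on the arrays below
`32 + d`. -/
structure Keeps (n d : ℕ) (σ σ' : State) : Prop where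
  int : ∀ r, r < 3 + n → r ≠ 2 → σ'.int r = σ.int r
  real : ∀ a i j, a < 32 + d → σ'.real (a, i, j) = σ.real (a, i, j)

theorem Keeps.trans {n d : ℕ} {σ σ' σ'' : State} (h : Keeps n d σ σ') (h' : Keeps n d σ' σ'') :
    Keeps n d σ σ'' :=
  ⟨fun r hr h2 => (h'.int r hr h2).trans (h.int r hr h2),
    fun a i j ha => (h'.real a i j ha).trans (h.real a i j ha)⟩

theorem Keeps.mono {n n' d d' : ℕ} {σ σ' : State} (h : Keeps n d σ σ') (hn : n' ≤ n)
    (hd : d' ≤ d) : Keeps n' d' σ σ' :=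
  ⟨fun r hr h2 => h.int r (by lia) h2, fun a i j ha => h.real a i j (by lia)⟩

theorem Keeps.setInt {n d : ℕ} {σ : State} {r k : ℕ} (hr : r = 2 ∨ 3 + n ≤ r) :
    Keeps n d σ (σ.setInt r k) :=
  ⟨fun r' h1 h2 => by simp [State.setInt, Function.update_apply]; lia, fun _ _ _ _ => rfl⟩

theorem Keeps.setReal {n d : ℕ} {σ : State} {a : Ref} {x : ℝ} (ha : 32 + d ≤ a.arr) :
    Keeps n d σ (σ.setReal a x) :=
  ⟨fun _ _ _ => rfl, fun a' i j h => by
    simp only [State.setReal, Ref.addr, Function.update_apply, Prod.mk.injEq]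
    rw [if_neg (by lia)]⟩

/-- The reserved registers `0` and `1` hold `ℓ` and `0`. -/
def State.Ready (ell : ℕ) (σ : State) : Prop := σ.int 0 = ell ∧ σ.int 1 = 0

theorem Keeps.ready {n d ell : ℕ} {σ σ' : State} (h : Keeps n d σ σ') (hσ : σ.Ready ell) :
    σ'.Ready ell :=
  ⟨by rw [h.int 0 (by lia) (by lia), hσ.1], by rw [h.int 1 (by lia) (by lia), hσ.2]⟩

theorem Query.answer_congr (I : Input) {q : Query} {n : ℕ} (hq : q.regsOk n = true)
    {σ σ' : State} (h : ∀ r, r < 3 + n → r ≠ 2 → σ.int r = σ'.int r) :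
    q.answer I σ = q.answer I σ' := by
  cases q <;> simp only [Query.regsOk, Ex.regOk, Bool.and_eq_true, decide_eq_true_eq] at hq <;>
    simp only [Query.answer]
  · rw [h _ hq.1 hq.2]
  · rw [h _ hq.1.1 hq.1.2, h _ hq.2.1 hq.2.2]
  · rw [h _ hq.1.1 hq.1.2, h _ hq.2.1 hq.2.2]
  · rw [h _ hq.1.1 hq.1.2, h _ hq.2.1 hq.2.2]
  · rw [h _ hq.1 hq.2]
  · rw [h _ hq.1 hq.2]

/-- The value of an expression depends only on the registers in scope and on the arrays that it
reads. -/
theorem Ex.eval_congr (I : Input) {P : ℕ → Prop} (e : Ex) : ∀ {n : ℕ} {ρ ρ' : ℕ → ℕ} {S S' : Store},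
    e.ok n = true → (∀ x, ¬ P x → x < 32 → e.avoids x = true) →
    (∀ r, r < 3 + n → r ≠ 2 → ρ r = ρ' r) → (∀ a, P a → a < 32 → S a = S' a) →
    e.eval I n ρ S = e.eval I n ρ' S' := by
  induction e with
  | ref a r c =>
    intro n ρ ρ' S S' ho ha hρ hS
    simp only [Ex.ok, Ex.regOk, Bool.and_eq_true, decide_eq_true_eq] at ho
    have hP : P a := by
      by_contra hP
      have := ha a hP ho.1.1
      simp [Ex.avoids] at this
    simp only [Ex.eval]
    rw [hS a hP ho.1.1, hρ _ ho.1.2.1 ho.1.2.2, hρ _ ho.2.1 ho.2.2]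
  | reg r =>
    intro n ρ ρ' S S' ho ha hρ hS
    simp only [Ex.ok, Ex.regOk, Bool.and_eq_true, decide_eq_true_eq] at ho
    simp only [Ex.eval]
    rw [hρ _ ho.1 ho.2]
  | nat k => intros; rfl
  | op o e f he hf =>
    intro n ρ ρ' S S' ho ha hρ hS
    simp only [Ex.ok, Ex.avoids, Bool.and_eq_true] at ho ha
    simp only [Ex.eval]
    rw [he ho.1 (fun x h1 h2 => (ha x h1 h2).1) hρ hS, hf ho.2 (fun x h1 h2 => (ha x h1 h2).2) hρ hS]
  | sqrt e he =>
    intro n ρ ρ' S S' ho ha hρ hS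
    simp only [Ex.eval]
    rw [he ho ha hρ hS]
  | query q =>
    intro n ρ ρ' S S' ho ha hρ hS
    exact Query.answer_congr I (n := n) ho hρ
  | ifLt a b e f ia ib ie jf =>
    intro n ρ ρ' S S' ho ha hρ hS
    simp only [Ex.ok, Ex.avoids, Bool.and_eq_true] at ho ha
    simp only [Ex.eval]
    rw [ia ho.1.1.1 (fun x h1 h2 => (ha x h1 h2).1.1.1) hρ hS,
      ib ho.1.1.2 (fun x h1 h2 => (ha x h1 h2).1.1.2) hρ hS,
      ie ho.1.2 (fun x h1 h2 => (ha x h1 h2).1.2) hρ hS,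
      jf ho.2 (fun x h1 h2 => (ha x h1 h2).2) hρ hS]
  | sum e he =>
    intro n ρ ρ' S S' ho ha hρ hS
    simp only [Ex.eval]
    rw [hρ 0 (by lia) (by lia)]
    refine Finset.sum_congr rfl fun k _ => he ho ha (fun r h1 h2 => ?_) hS
    simp only [Function.update_apply]
    split_ifs
    · rfl
    · exact hρ r (by lia) h2

theorem Ex.eval_keeps (I : Input) {e : Ex} {n d : ℕ} {σ σ' : State} (ho : e.ok n = true)
    (h : Keeps n d σ σ') : e.eval I n σ'.int σ'.store = e.eval I n σ.int σ.store :=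
  Ex.eval_congr I (P := fun _ => True) e ho (by simp) h.int fun a _ ha => by
    ext i j; exact h.real a i j (by lia)

section Compile

variable {I : Input} {C E m : ℕ}

/-- A `for` loop whose body meets the invariant: `Inv k` holds when `k` rounds are complete. -/
theorem Runs.forCmd {r n T : ℕ} (hr : r = 3 + n) (hm : r < m) {p : Cmd} {σ : State}
    (Inv : ℕ → State → Prop)
    (hI : ∀ k σ σ', Inv k σ → (∀ d, Keeps n d σ σ') → Inv k σ')
    (hready : ∀ k σ, Inv k σ → σ.Ready I.ell)
    (h0 : Inv 0 σ)
    (hstep : ∀ k < I.ell, ∀ σ, Inv k σ → σ.int r = k →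
      Runs I C E m p σ T (fun σ' => Inv (k + 1) σ' ∧ σ'.int r = k)) :
    Runs I C E m (forCmd r p) σ (I.ell * (T + 3) + 2) (Inv I.ell) := by
  subst hr
  refine (Runs.seq (Runs.intConst hm) (fun σ' h => ?_) (T₂ := I.ell * (T + 2 + 1) + 1)).mono
    (by lia) (fun _ h => h)
  subst h
  refine (Runs.loop (fun k σ => Inv k σ ∧ σ.int (3 + n) = k) I.ell (T := T + 2)
    (fun k hk σ hσ => ⟨?_, ?_⟩) (fun σ h => ?_) ⟨hI _ _ _ h0 fun _ => .setInt (.inr le_rfl), ?_⟩).mono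
    le_rfl fun _ h => h.1
  · simp only [Test.Holds, hσ.2, (hready _ _ hσ.1).1, hk]
  · refine Runs.seq (hstep k hk σ hσ.1 hσ.2) (fun σ₁ h₁ => ?_)
    refine Runs.seq (T₁ := 1) (T₂ := 1) (Runs.intConst (by lia)) (fun σ₂ h₂ => ?_)
    refine (Runs.intAdd hm).mono le_rfl fun σ₃ h₃ => ?_
    subst h₂ h₃
    refine ⟨hI _ _ _ (hI _ _ _ h₁.1 fun _ => .setInt (.inl rfl)) fun _ => .setInt (.inr le_rfl), ?_⟩
    simp only [State.setInt, Function.update_apply, h₁.2, if_true]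
    rw [if_neg (by lia)]
  · simp only [Test.Holds, h.2, (hready _ _ h.1).1, lt_irrefl, not_false_eq_true]
  · simp [State.setInt]

theorem State.get_tmp {ell : ℕ} {σ : State} (hσ : σ.Ready ell) (d : ℕ) :
    σ.get (Ex.tmp d) = σ.real (32 + d, 0, 0) := by
  simp [State.get, Ref.addr, Ex.tmp, hσ.2]

theorem State.setReal_tmp_real {ell : ℕ} {σ : State} (hσ : σ.Ready ell) (d : ℕ) (x : ℝ) :
    (σ.setReal (Ex.tmp d) x).real (32 + d, 0, 0) = x := by
  simp [State.setReal, Ref.addr, Ex.tmp, hσ.2]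

theorem State.Ready.tmp_lt {σ : State} (hσ : σ.Ready I.ell) (hell : 1 ≤ I.ell) (d : ℕ) :
    σ.int (Ex.tmp d).row < I.ell ∧ σ.int (Ex.tmp d).col < I.ell := by
  simp only [Ex.tmp, hσ.2, and_self]; lia

theorem Runs.ofInt_tmp {σ : State} (hell : 1 ≤ I.ell) (hσ : σ.Ready I.ell) {d : ℕ}
    (hd : 32 + d < m) (n r : ℕ) :
    Runs I C E m (.ofInt (Ex.tmp d) r) σ 1 (fun σ' => Keeps n d σ σ' ∧
      σ'.real (32 + d, 0, 0) = σ.int r) :=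
  (Runs.ofInt hd (hσ.tmp_lt hell d).1 (hσ.tmp_lt hell d).2).mono le_rfl fun σ' h => by
    subst h
    exact ⟨.setReal le_rfl, State.setReal_tmp_real hσ _ _⟩

theorem Runs.const_tmp {σ : State} (hell : 1 ≤ I.ell) (hσ : σ.Ready I.ell) {d : ℕ}
    (hd : 32 + d < m) (n k : ℕ) :
    Runs I C E m (.seq (.intConst 2 k) (.ofInt (Ex.tmp d) 2)) σ 2 (fun σ' => Keeps n d σ σ' ∧
      σ'.real (32 + d, 0, 0) = k) := by
  refine Runs.seq (T₁ := 1) (T₂ := 1) (Runs.intConst (by lia)) fun σ₁ h₁ => ?_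
  subst h₁
  have hk : Keeps n d σ (σ.setInt 2 k) := .setInt (.inl rfl)
  refine (Runs.ofInt_tmp hell (hk.ready hσ) hd n 2).mono le_rfl fun σ₂ h₂ => ⟨hk.trans h₂.1, ?_⟩
  rw [h₂.2]
  simp [State.setInt]

theorem Runs.arith_tmp {σ : State} (hell : 1 ≤ I.ell) (hσ : σ.Ready I.ell) {d : ℕ}
    (hd : 32 + d < m) (n : ℕ) (o : ArithOp) (a b : Ref) :
    Runs I C E m (.arith o (Ex.tmp d) a b) σ 1 (fun σ' => Keeps n d σ σ' ∧
      σ'.real (32 + d, 0, 0) = o.eval (σ.get a) (σ.get b)) :=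
  (Runs.arith hd (hσ.tmp_lt hell d).1 (hσ.tmp_lt hell d).2).mono le_rfl fun σ' h => by
    subst h
    exact ⟨.setReal le_rfl, State.setReal_tmp_real hσ _ _⟩

theorem Ex.runs_compile (hell : 1 ≤ I.ell) (e : Ex) : ∀ {n d : ℕ} {σ : State}, e.ok n = true →
    σ.Ready I.ell → 32 + n + d + e.size ≤ m →
    Runs I C E m (e.compile n d) σ (e.cost I.ell C E) (fun σ' => Keeps n d σ σ' ∧
      σ'.real (32 + d, 0, 0) = e.eval I n σ.int σ.store) := by
  induction e with
  | ref a r c =>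
    intro n d σ ho hσ hm
    simp only [Ex.size] at hm
    simp only [Ex.ok, Ex.regOk, Bool.and_eq_true, decide_eq_true_eq] at ho
    refine Runs.seq (T₁ := 1) (T₂ := 2) (Runs.intConst (by lia)) fun σ₁ h₁ => ?_
    subst h₁
    have hk : Keeps n d σ (σ.setInt 2 0) := .setInt (.inl rfl)
    refine Runs.seq (T₁ := 1) (T₂ := 1) (Runs.ofInt_tmp hell (hk.ready hσ) (by lia) n 2)
      fun σ₂ h₂ => ?_
    have hk' := hk.trans h₂.1
    refine (Runs.arith_tmp hell (hk'.ready hσ) (by lia) n _ _ _).mono le_rfl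
      fun σ₃ h₃ => ⟨hk'.trans h₃.1, ?_⟩
    rw [h₃.2, State.get_tmp (hk'.ready hσ), h₂.2]
    simp only [ArithOp.eval, State.get, Ref.addr, Ex.eval, State.store]
    rw [hk'.int r ho.1.2.1 ho.1.2.2, hk'.int c ho.2.1 ho.2.2, hk'.real _ _ _ (by lia)]
    simp [State.setInt]
  | reg r =>
    intro n d σ ho hσ hm
    exact Runs.ofInt_tmp hell hσ (by simp only [Ex.size] at hm; lia) n r
  | nat k =>
    intro n d σ ho hσ hm
    exact Runs.const_tmp hell hσ (by simp only [Ex.size] at hm; lia) n k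
  | op o e f he hf =>
    intro n d σ ho hσ hm
    simp only [Ex.size] at hm
    simp only [Ex.ok, Bool.and_eq_true] at ho
    refine (Runs.seq (he ho.1 hσ (by lia)) fun σ₁ h₁ => ?_).mono (T := e.cost I.ell C E +
      (f.cost I.ell C E + 1)) (by simp only [Ex.cost]; lia) fun _ h => h
    have r₁ := h₁.1.ready hσ
    refine Runs.seq (hf ho.2 r₁ (by lia)) fun σ₂ h₂ => ?_
    have k₂ := h₂.1.mono le_rfl (d' := d) (by lia)
    have r₂ := k₂.ready r₁
    refine (Runs.arith_tmp hell r₂ (by lia) n _ _ _).mono le_rfl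
      fun σ₃ h₃ => ⟨(h₁.1.trans k₂).trans h₃.1, ?_⟩
    rw [h₃.2, State.get_tmp r₂, State.get_tmp r₂, h₂.2, h₂.1.real _ _ _ (by lia), h₁.2,
      Ex.eval_keeps I ho.2 h₁.1]
    rfl
  | sqrt e he =>
    intro n d σ ho hσ hm
    simp only [Ex.size] at hm
    refine Runs.seq (he ho hσ (by lia)) (T₂ := 1) fun σ₁ h₁ => ?_
    have r₁ := h₁.1.ready hσ
    refine (Runs.sqrt (by simp only [Ex.tmp]; lia) (r₁.tmp_lt hell d).1
      (r₁.tmp_lt hell d).2).mono le_rfl fun σ₂ h₂ => ?_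
    subst h₂
    refine ⟨h₁.1.trans (.setReal le_rfl), ?_⟩
    rw [State.setReal_tmp_real r₁, State.get_tmp r₁, h₁.2]
    rfl
  | query q =>
    intro n d σ ho hσ hm
    simp only [Ex.size] at hm
    refine (Runs.query (by simp only [Ex.tmp]; lia) (hσ.tmp_lt hell d).1
      (hσ.tmp_lt hell d).2).mono le_rfl fun σ₂ h₂ => ?_
    subst h₂
    refine ⟨.setReal le_rfl, ?_⟩
    rw [State.setReal_tmp_real hσ]
    exact Query.answer_congr I (n := n) ho fun _ _ _ => rfl
  | ifLt a b e f ia ib ie jf =>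
    intro n d σ ho hσ hm
    simp only [Ex.size] at hm
    simp only [Ex.ok, Bool.and_eq_true] at ho
    refine (Runs.seq (ia ho.1.1.1 hσ (by lia)) fun σ₁ h₁ => ?_).mono (T := a.cost I.ell C E +
      (b.cost I.ell C E + (1 + (e.cost I.ell C E + f.cost I.ell C E))))
      (by simp only [Ex.cost]; lia) fun _ h => h
    have r₁ := h₁.1.ready hσ
    refine Runs.seq (ib ho.1.1.2 r₁ (by lia)) fun σ₂ h₂ => ?_
    have k₂ := h₂.1.mono le_rfl (d' := d) (by lia)
    have r₂ := k₂.ready r₁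
    have k₃ := h₁.1.trans k₂
    have hT : (Test.realLt (Ex.tmp d) (Ex.tmp (d + 1))).Holds σ₂ ↔
        a.eval I n σ.int σ.store < b.eval I n σ.int σ.store := by
      simp only [Test.Holds]
      rw [State.get_tmp r₂, State.get_tmp r₂, h₂.2, h₂.1.real _ _ _ (by lia), h₁.2,
        Ex.eval_keeps I ho.1.1.2 h₁.1]
    refine Runs.ite (fun hb => ?_) (fun hb => ?_)
    · refine (ie ho.1.2 r₂ (by lia)).mono le_rfl fun σ₃ h₃ => ⟨k₃.trans h₃.1, ?_⟩
      rw [h₃.2, Ex.eval_keeps I ho.1.2 k₃]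
      simp only [Ex.eval]
      rw [if_pos (hT.1 hb)]
    · refine (jf ho.2 r₂ (by lia)).mono le_rfl fun σ₃ h₃ => ⟨k₃.trans h₃.1, ?_⟩
      rw [h₃.2, Ex.eval_keeps I ho.2 k₃]
      simp only [Ex.eval]
      rw [if_neg fun h => hb (hT.2 h)]
  | sum e he =>
    intro n d σ ho hσ hm
    simp only [Ex.size] at hm
    refine Runs.seq (T₁ := 1) (T₂ := I.ell * (e.cost I.ell C E + 1 + 3) + 2 + 1)
      (Runs.intConst (by lia)) (fun σ₁ h₁ => ?_) |>.mono (by simp only [Ex.cost]; lia)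
      fun _ h => h
    subst h₁
    have hk : Keeps n d σ (σ.setInt 2 0) := .setInt (.inl rfl)
    refine Runs.seq (T₁ := 1) (T₂ := I.ell * (e.cost I.ell C E + 1 + 3) + 2)
      (Runs.ofInt_tmp hell (hk.ready hσ) (by lia) n 2) (fun σ₂ h₂ => ?_) |>.mono (by lia)
      fun _ h => h
    have hk' := hk.trans h₂.1
    refine (Runs.forCmd (n := n) rfl (by lia) (fun k σ' => Keeps n d σ σ' ∧
      σ'.real (32 + d, 0, 0) = ∑ k ∈ Finset.range k,
        e.eval I (n + 1) (Function.update σ.int (3 + n) k) σ.store)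
      (fun k σ' σ'' h hk => ⟨h.1.trans (hk d), ?_⟩) (fun k σ' h => h.1.ready hσ)
      ⟨hk', ?_⟩ (fun k hlt σ₃ h₃ hreg => ?_)).mono le_rfl fun σ' h => ⟨h.1, ?_⟩
    · rw [(hk (d + 1)).real _ _ _ (by lia), h.2]
    · rw [h₂.2]; simp [State.setInt]
    · have r₃ := h₃.1.ready hσ
      refine Runs.seq (he (n := n + 1) (d := d + 1) ho r₃ (by lia)) fun σ₄ h₄ => ?_
      have k₄ := h₄.1.mono (n' := n) (d' := d) (by lia) (by lia)
      have r₄ := k₄.ready r₃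
      refine (Runs.arith_tmp hell r₄ (by lia) (n + 1) _ _ _).mono le_rfl
        fun σ₅ h₅ => ⟨⟨(h₃.1.trans k₄).trans (h₅.1.mono (by lia) le_rfl), ?_⟩, ?_⟩
      · rw [h₅.2, State.get_tmp r₄, State.get_tmp r₄, h₄.1.real _ _ _ (by lia), h₄.2, h₃.2,
          Finset.sum_range_succ]
        simp only [ArithOp.eval]
        congr 1
        refine Ex.eval_congr I (P := fun _ => True) e ho (by simp) (fun r h1 h2 => ?_)
          fun a _ ha => ?_
        · simp only [Function.update_apply]
          split_ifs with hr
          · rw [hr, hreg]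
          · exact h₃.1.int r (by lia) h2
        · ext i j
          exact h₃.1.real a i j (by lia)
      · rw [h₅.1.int _ (by lia) (by lia), h₄.1.int _ (by lia) (by lia), hreg]
    · rw [h.2, Ex.eval, hσ.1]

end Compile

/-! ### Array programs -/

/-- Programs that fill the entry `(0, 0)` of an array, its column `0`, or all of it (for indices
below `ℓ`), in sequence or repeated `ℓ` times. The indices of the entry and the count of the
repetitions are bound as in `Ex.sum`. -/
inductive Stmt where
  | fill0 (a : ℕ) (e : Ex)
  | fill1 (a : ℕ) (e : Ex)
  | fill2 (a : ℕ) (e : Ex)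
  | seq (s t : Stmt)
  | rep (s : Stmt)

namespace Stmt

/-- The effect of an array program at nesting depth `n`. -/
def den (I : Input) : Stmt → ℕ → (ℕ → ℕ) → Store → Store
  | .fill0 a e, n, ρ, S => Function.update S a fun i j =>
      if i = 0 ∧ j = 0 then e.eval I n ρ S else S a i j
  | .fill1 a e, n, ρ, S => Function.update S a fun i j =>
      if i < ρ 0 ∧ j = 0 then e.eval I (n + 1) (Function.update ρ (3 + n) i) S else S a i j
  | .fill2 a e, n, ρ, S => Function.update S a fun i j =>
      if i < ρ 0 ∧ j < ρ 0 then
        e.eval I (n + 2) (Function.update (Function.update ρ (3 + n) i) (4 + n) j) S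
      else S a i j
  | .seq s t, n, ρ, S => t.den I n ρ (s.den I n ρ S)
  | .rep s, n, ρ, S =>
      Nat.rec S (fun k S' => s.den I (n + 1) (Function.update ρ (3 + n) k) S') (ρ 0)

/-- Well-scopedness at nesting depth `n`. An expression must not read the array that it fills, so
that filling the array entry by entry has the effect of a simultaneous assignment. -/
def ok : Stmt → ℕ → Bool
  | .fill0 a e, n => decide (a < 32) && e.ok n && e.avoids a
  | .fill1 a e, n => decide (a < 32) && e.ok (n + 1) && e.avoids a
  | .fill2 a e, n => decide (a < 32) && e.ok (n + 2) && e.avoids a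
  | .seq s t, n => s.ok n && t.ok n
  | .rep s, n => s.ok (n + 1)

/-- The array `x` is not written. -/
def keeps (x : ℕ) : Stmt → Bool
  | .fill0 a _ => decide (a ≠ x)
  | .fill1 a _ => decide (a ≠ x)
  | .fill2 a _ => decide (a ≠ x)
  | .seq s t => s.keeps x && t.keeps x
  | .rep s => s.keeps x

/-- A bound for the number of registers and of auxiliary arrays that a run takes up. -/
def size : Stmt → ℕ
  | .fill0 _ e => e.size + 2
  | .fill1 _ e => e.size + 3
  | .fill2 _ e => e.size + 4
  | .seq s t => s.size + t.size + 1
  | .rep s => s.size + 2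

/-- Copy the result of an evaluation to a cell. -/
def move (a : Ref) : Cmd :=
  .seq (.seq (.intConst 2 0) (.ofInt (Ex.tmp 1) 2)) (.arith .add a (Ex.tmp 0) (Ex.tmp 1))

/-- The machine program of an array program at nesting depth `n`. -/
def compile : Stmt → ℕ → Cmd
  | .fill0 a e, n => .seq (e.compile n 0) (move ⟨a, 1, 1⟩)
  | .fill1 a e, n => forCmd (3 + n) (.seq (e.compile (n + 1) 0) (move ⟨a, 3 + n, 1⟩))
  | .fill2 a e, n => forCmd (3 + n) (forCmd (4 + n)
      (.seq (e.compile (n + 2) 0) (move ⟨a, 3 + n, 4 + n⟩)))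
  | .seq s t, n => .seq (s.compile n) (t.compile n)
  | .rep s, n => forCmd (3 + n) (s.compile (n + 1))

/-- An upper bound for the cost of running an array program. -/
def cost (ell C E : ℕ) : Stmt → ℕ
  | .fill0 _ e => e.cost ell C E + 3
  | .fill1 _ e => ell * (e.cost ell C E + 3 + 3) + 2
  | .fill2 _ e => ell * ((ell * (e.cost ell C E + 3 + 3) + 2) + 3) + 2
  | .seq s t => s.cost ell C E + t.cost ell C E
  | .rep s => ell * (s.cost ell C E + 3) + 2

end Stmt

theorem Stmt.den_of_keeps (I : Input) {x : ℕ} (s : Stmt) : ∀ {n : ℕ} {ρ : ℕ → ℕ} {S : Store},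
    s.keeps x = true → s.den I n ρ S x = S x := by
  induction s with
  | fill0 a e | fill1 a e | fill2 a e =>
    intro n ρ S h
    simp only [Stmt.keeps, decide_eq_true_eq] at h
    simp [Stmt.den, h.symm]
  | seq s t hs ht =>
    intro n ρ S h
    simp only [Stmt.keeps, Bool.and_eq_true] at h
    simp only [Stmt.den]
    rw [ht h.2, hs h.1]
  | rep s hs =>
    intro n ρ S h
    simp only [Stmt.den]
    induction ρ 0 with
    | zero => rfl
    | succ k ih => simp only; rw [hs h, ih]

theorem Stmt.den_congr (I : Input) (s : Stmt) : ∀ {n : ℕ} {ρ ρ' : ℕ → ℕ} {S S' : Store},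
    s.ok n = true → (∀ r, r < 3 + n → r ≠ 2 → ρ r = ρ' r) → (∀ a < 32, S a = S' a) →
    ∀ a < 32, s.den I n ρ S a = s.den I n ρ' S' a := by
  have key : ∀ {e : Ex} {n : ℕ} {ρ ρ' : ℕ → ℕ} {S S' : Store}, e.ok n = true →
      (∀ r, r < 3 + n → r ≠ 2 → ρ r = ρ' r) → (∀ a < 32, S a = S' a) →
      e.eval I n ρ S = e.eval I n ρ' S' := fun ho hρ hS =>
    Ex.eval_congr I (P := fun _ => True) _ ho (by simp) hρ fun a _ ha => hS a ha
  have upd : ∀ {n : ℕ} {ρ ρ' : ℕ → ℕ} (k : ℕ), (∀ r, r < 3 + n → r ≠ 2 → ρ r = ρ' r) →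
      ∀ r, r < 3 + (n + 1) → r ≠ 2 →
        Function.update ρ (3 + n) k r = Function.update ρ' (3 + n) k r := by
    intro n ρ ρ' k h r h1 h2
    simp only [Function.update_apply]
    split_ifs
    · rfl
    · exact h r (by lia) h2
  induction s with
  | fill0 x e =>
    intro n ρ ρ' S S' ho hρ hS a ha
    simp only [Stmt.ok, Bool.and_eq_true, decide_eq_true_eq] at ho
    simp only [Stmt.den, Function.update_apply]
    rw [key ho.1.2 hρ hS, hS x ho.1.1, hS a ha]
  | fill1 x e =>
    intro n ρ ρ' S S' ho hρ hS a ha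
    simp only [Stmt.ok, Bool.and_eq_true, decide_eq_true_eq] at ho
    simp only [Stmt.den, Function.update_apply]
    rw [hS x ho.1.1, hS a ha, hρ 0 (by lia) (by lia)]
    simp only [key ho.1.2 (upd _ hρ) hS]
  | fill2 x e =>
    intro n ρ ρ' S S' ho hρ hS a ha
    simp only [Stmt.ok, Bool.and_eq_true, decide_eq_true_eq] at ho
    have h4 : 4 + n = 3 + (n + 1) := by lia
    simp only [Stmt.den, Function.update_apply, h4]
    rw [hS x ho.1.1, hS a ha, hρ 0 (by lia) (by lia)]
    simp only [key ho.1.2 (upd _ (upd _ hρ)) hS]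
  | seq s t hs ht =>
    intro n ρ ρ' S S' ho hρ hS a ha
    simp only [Stmt.ok, Bool.and_eq_true] at ho
    exact ht ho.2 hρ (hs ho.1 hρ hS) a ha
  | rep s hs =>
    intro n ρ ρ' S S' ho hρ hS a ha
    simp only [Stmt.den]
    rw [hρ 0 (by lia) (by lia)]
    clear upd key
    revert a
    induction ρ' 0 with
    | zero => exact hS
    | succ k ih =>
      intro a ha
      refine hs ho (fun r h1 h2 => ?_) ih a ha
      simp only [Function.update_apply]
      split_ifs
      · rfl
      · exact hρ r (by lia) h2

section Compile

variable {I : Input} {C E m : ℕ}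

/-- `σ'` and `σ` agree on the registers in scope at nesting depth `n`, and the arrays below `32`
have the contents `S` in `σ'`. -/
structure Leads (n : ℕ) (σ : State) (S : Store) (σ' : State) : Prop where
  int : ∀ r, r < 3 + n → r ≠ 2 → σ'.int r = σ.int r
  store : ∀ a < 32, σ'.store a = S a

theorem Leads.ready {n ell : ℕ} {σ σ' : State} {S : Store} (h : Leads n σ S σ')
    (hσ : σ.Ready ell) : σ'.Ready ell :=
  ⟨by rw [h.int 0 (by lia) (by lia), hσ.1], by rw [h.int 1 (by lia) (by lia), hσ.2]⟩

theorem Leads.keeps {n : ℕ} {σ σ' σ'' : State} {S : Store} (h : Leads n σ S σ')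
    (h' : Keeps n 0 σ' σ'') : Leads n σ S σ'' :=
  ⟨fun r h1 h2 => (h'.int r h1 h2).trans (h.int r h1 h2), fun a ha =>
    (funext₂ fun i j => h'.real a i j (by lia)).trans (h.store a ha)⟩

theorem Leads.refl (n : ℕ) (σ : State) : Leads n σ σ.store σ := ⟨fun _ _ _ => rfl, fun _ _ => rfl⟩

/-- Evaluate an expression and store the value in a cell of an array that the expression does not
read. -/
theorem Stmt.runs_assign (hell : 1 ≤ I.ell) {e : Ex} {n a r c : ℕ} {σ : State} (ho : e.ok n = true)
    (hσ : σ.Ready I.ell) (hm : 33 + n + e.size ≤ m) (ha : a < 32) (hr : Ex.regOk n r = true)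
    (hc : Ex.regOk n c = true) (hr' : σ.int r < I.ell) (hc' : σ.int c < I.ell) :
    Runs I C E m (.seq (e.compile n 0) (move ⟨a, r, c⟩)) σ (e.cost I.ell C E + 3)
      (Leads n σ fun a' i j => if a' = a ∧ i = σ.int r ∧ j = σ.int c
        then e.eval I n σ.int σ.store else σ.store a' i j) := by
  have hsz : 1 ≤ e.size := by cases e <;> simp [Ex.size]
  simp only [Ex.regOk, Bool.and_eq_true, decide_eq_true_eq] at hr hc
  refine Runs.seq (Ex.runs_compile hell e ho hσ (by lia)) fun σ₁ h₁ => ?_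
  have r₁ := h₁.1.ready hσ
  refine Runs.seq (T₁ := 2) (T₂ := 1) (Runs.const_tmp hell r₁ (by lia) n 0) fun σ₂ h₂ => ?_
  have k₂ := h₁.1.trans (h₂.1.mono le_rfl (d' := 0) (by lia))
  have r₂ := k₂.ready hσ
  have er := k₂.int r hr.1 hr.2
  have ec := k₂.int c hc.1 hc.2
  refine (Runs.arith (by simp only; lia) (by simp only [er]; exact hr')
    (by simp only [ec]; exact hc')).mono le_rfl fun σ₃ h₃ => ?_
  subst h₃
  refine ⟨k₂.int, fun a' ha' => funext₂ fun i j => ?_⟩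
  simp only [State.store, State.setReal, Function.update_apply, Ref.addr, Prod.mk.injEq, er, ec,
    ArithOp.eval]
  rw [State.get_tmp r₂, State.get_tmp r₂, h₂.2, h₂.1.real _ _ _ (by lia), h₁.2,
    k₂.real _ _ _ (by lia)]
  simp

theorem Stmt.runs_compile (hell : 1 ≤ I.ell) (s : Stmt) : ∀ {n : ℕ} {σ : State}, s.ok n = true →
    σ.Ready I.ell → 32 + n + s.size ≤ m →
    Runs I C E m (s.compile n) σ (s.cost I.ell C E) (Leads n σ (s.den I n σ.int σ.store)) := by
  induction s with
  | fill0 a e =>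
    intro n σ ho hσ hm
    simp only [Stmt.ok, Bool.and_eq_true, decide_eq_true_eq] at ho
    simp only [Stmt.size] at hm
    refine (Stmt.runs_assign hell ho.1.2 hσ (by lia) ho.1.1 (by simp [Ex.regOk]; lia)
      (by simp [Ex.regOk]; lia) (by simp only [hσ.2]; lia) (by simp only [hσ.2]; lia)).mono le_rfl
      fun σ' h => ⟨h.int, fun a' ha' => ?_⟩
    rw [h.store a' ha']
    ext i j
    simp only [Stmt.den, Function.update_apply, hσ.2]
    split_ifs <;> simp_all
  | fill1 a e =>
    intro n σ ho hσ hm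
    simp only [Stmt.ok, Bool.and_eq_true, decide_eq_true_eq] at ho
    simp only [Stmt.size] at hm
    refine (Runs.forCmd (n := n) rfl (by lia) (fun k => Leads n σ (Function.update σ.store a
      fun i j => if i < k ∧ j = 0 then e.eval I (n + 1) (Function.update σ.int (3 + n) i) σ.store
        else σ.store a i j)) (fun k σ' σ'' h hk => h.keeps (hk 0)) (fun k σ' h => h.ready hσ)
      ?_ (fun k hlt σ₃ h₃ hreg => ?_)).mono le_rfl fun σ' h => ?_
    · simpa using Leads.refl n σ
    · have r₃ := h₃.ready hσ
      refine (Stmt.runs_assign hell ho.1.2 r₃ (by lia) ho.1.1 (by simp [Ex.regOk]; lia)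
        (by simp [Ex.regOk]; lia) (by simpa [hreg]) (by simp only [r₃.2]; lia)).mono le_rfl
        fun σ' h => ⟨⟨fun r h1 h2 => (h.int r (by lia) h2).trans (h₃.int r h1 h2),
          fun a' ha' => ?_⟩, (h.int _ (by lia) (by lia)).trans hreg⟩
      have hv : e.eval I (n + 1) σ₃.int σ₃.store =
          e.eval I (n + 1) (Function.update σ.int (3 + n) k) σ.store := by
        refine Ex.eval_congr I (P := fun x => x ≠ a) e ho.1.2
          (fun x hx _ => by rw [not_not.1 hx]; exact ho.2) (fun r h1 h2 => ?_) fun x hx hx' => ?_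
        · simp only [Function.update_apply]
          split_ifs with hr
          · rw [hr, hreg]
          · exact h₃.int r (by lia) h2
        · rw [h₃.store x hx']
          simp [hx]
      rw [h.store a' ha', hv, h₃.store a' ha']
      ext i j
      simp only [Function.update_apply, hreg, r₃.2]
      by_cases ha : a' = a
      · simp only [ha, if_true, true_and]
        by_cases hi : i = k
        · simp only [hi, true_and, Nat.lt_succ_self]
          split_ifs <;> first | rfl | lia
        · simp only [hi, false_and, if_false]
          split_ifs <;> first | rfl | lia
      · simp [ha]
    · rw [Stmt.den, hσ.1]; exact h
  | fill2 a e =>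
    intro n σ ho hσ hm
    simp only [Stmt.ok, Bool.and_eq_true, decide_eq_true_eq] at ho
    simp only [Stmt.size] at hm
    have e4 : 4 + n = 3 + (n + 1) := by lia
    refine (Runs.forCmd (n := n) rfl (by lia) (fun k => Leads n σ (Function.update σ.store a
      fun i j => if i < k ∧ j < I.ell then e.eval I (n + 2) (Function.update (Function.update σ.int
        (3 + n) i) (4 + n) j) σ.store
        else σ.store a i j)) (fun k σ' σ'' h hk => h.keeps (hk 0)) (fun k σ' h => h.ready hσ)
      ?_ (fun k hlt σ₃ h₃ hreg => ?_)).mono le_rfl fun σ' h => ?_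
    · simpa using Leads.refl n σ
    · have r₃ := h₃.ready hσ
      refine (Runs.forCmd (n := n + 1) e4 (by lia) (fun l σ' => Leads n σ (Function.update σ.store a
        fun i j => if (i < k ∧ j < I.ell) ∨ (i = k ∧ j < l) then e.eval I (n + 2)
          (Function.update (Function.update σ.int (3 + n) i) (4 + n) j) σ.store
          else σ.store a i j) σ' ∧ σ'.int (3 + n) = k)
        (fun l σ' σ'' h hk => ⟨h.1.keeps ((hk 0).mono (by lia) le_rfl),
          ((hk 0).int _ (by lia) (by lia)).trans h.2⟩) (fun k σ' h => h.1.ready hσ)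
        ⟨by simpa using h₃, hreg⟩ (fun l hlt' σ₄ h₄ hreg' => ?_)).mono le_rfl
        fun σ' h => ⟨⟨h.1.int, fun a' ha' => ?_⟩, h.2⟩
      · have r₄ := h₄.1.ready hσ
        refine (Stmt.runs_assign hell ho.1.2 r₄ (by lia) ho.1.1 (by simp [Ex.regOk]; lia)
          (by simp [Ex.regOk]; lia) (by simpa [h₄.2]) (by simpa [hreg'])).mono le_rfl
          fun σ' h => ⟨⟨⟨fun r h1 h2 => (h.int r (by lia) h2).trans (h₄.1.int r h1 h2),
            fun a' ha' => ?_⟩, (h.int _ (by lia) (by lia)).trans h₄.2⟩,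
            (h.int _ (by lia) (by lia)).trans hreg'⟩
        have hv : e.eval I (n + 2) σ₄.int σ₄.store =
            e.eval I (n + 2) (Function.update (Function.update σ.int (3 + n) k) (4 + n) l)
              σ.store := by
          refine Ex.eval_congr I (P := fun x => x ≠ a) e ho.1.2
            (fun x hx _ => by rw [not_not.1 hx]; exact ho.2) (fun r h1 h2 => ?_)
            fun x hx hx' => ?_
          · simp only [Function.update_apply]
            split_ifs with hr hr'
            · rw [hr, hreg']
            · rw [hr', h₄.2]
            · exact h₄.1.int r (by lia) h2
          · rw [h₄.1.store x hx']
            simp [hx]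
        rw [h.store a' ha', hv, h₄.1.store a' ha']
        ext i j
        simp only [Function.update_apply, hreg', h₄.2]
        by_cases ha : a' = a
        · simp only [ha, if_true, true_and]
          by_cases hi : i = k
          · by_cases hj : j = l
            · simp [hi, hj]
            · simp only [hi, hj, and_false, if_false]
              split_ifs <;> first | rfl | lia
          · simp only [hi, false_and, if_false, or_false]
        · simp [ha]
      · rw [h.1.store a' ha']
        ext i j
        simp only [Function.update_apply]
        split_ifs <;> first | rfl | lia
    · rw [Stmt.den, hσ.1]; exact h
  | seq s t hs ht =>
    intro n σ ho hσ hm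
    simp only [Stmt.ok, Bool.and_eq_true] at ho
    simp only [Stmt.size] at hm
    refine Runs.seq (hs ho.1 hσ (by lia)) fun σ₁ h₁ => ?_
    refine (ht ho.2 (h₁.ready hσ) (by lia)).mono le_rfl fun σ₂ h₂ =>
      ⟨fun r k1 k2 => (h₂.int r k1 k2).trans (h₁.int r k1 k2), fun a ha => ?_⟩
    rw [h₂.store a ha]
    exact Stmt.den_congr I t ho.2 h₁.int h₁.store a ha
  | rep s hs =>
    intro n σ ho hσ hm
    simp only [Stmt.size] at hm
    simp only [Stmt.den]
    rw [hσ.1]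
    refine (Runs.forCmd (m := m) (n := n) rfl (by lia) (fun k => Leads n σ (Nat.rec σ.store (fun k S' =>
      s.den I (n + 1) (Function.update σ.int (3 + n) k) S') k))
      (fun k σ' σ'' h hk => h.keeps (hk 0)) (fun k σ' h => h.ready hσ)
      (Leads.refl n σ) (fun k hlt σ₃ h₃ hreg => ?_))
    refine (hs (n := n + 1) ho (h₃.ready hσ) (by lia)).mono le_rfl fun σ' h =>
      ⟨⟨fun r h1 h2 => (h.int r (by lia) h2).trans (h₃.int r h1 h2), fun a ha => ?_⟩,
        (h.int _ (by lia) (by lia)).trans hreg⟩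
    rw [h.store a ha]
    refine Stmt.den_congr I s ho (fun r h1 h2 => ?_) h₃.store a ha
    simp only [Function.update_apply]
    split_ifs with hr
    · rw [hr, hreg]
    · exact h₃.int r (by lia) h2

end Compile

/-! ### Costs -/

namespace Ex

/-- The maximal number of nested sums. -/
def depth : Ex → ℕ
  | .op _ e f => max e.depth f.depth
  | .sqrt e => e.depth
  | .ifLt a b e f => max (max a.depth b.depth) (max e.depth f.depth)
  | .sum e => e.depth + 1
  | _ => 0

/-- There is no query with a price. -/
def free : Ex → Bool
  | .op _ e f => e.free && f.free
  | .sqrt e => e.free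
  | .ifLt a b e f => a.free && b.free && e.free && f.free
  | .sum e => e.free
  | .query (.meanX _) => false
  | .query (.meanY _) => false
  | .query .normSq => false
  | _ => true

theorem exists_cost_le (e : Ex) (he : e.free = true) :
    ∃ w, ∀ ell C E : ℕ, 1 ≤ ell → e.cost ell C E ≤ w * ell ^ e.depth := by
  have pow_le : ∀ {ell a b : ℕ}, 1 ≤ ell → a ≤ b → ell ^ a ≤ ell ^ b :=
    fun h hab => Nat.pow_le_pow_right h hab
  induction e with
  | ref a r c => exact ⟨3, by simp [cost, depth]⟩
  | reg r => exact ⟨1, by simp [cost, depth]⟩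
  | nat k => exact ⟨2, by simp [cost, depth]⟩
  | query q => exact ⟨1, by cases q <;> simp_all [cost, depth, Query.price, free]⟩
  | op o e f ih jh =>
    simp only [free, Bool.and_eq_true] at he
    obtain ⟨v, hv⟩ := ih he.1
    obtain ⟨w, hw⟩ := jh he.2
    refine ⟨v + w + 1, fun ell C E h => ?_⟩
    simp only [cost, depth, add_mul, one_mul]
    exact add_le_add (add_le_add
      ((hv _ _ _ h).trans (Nat.mul_le_mul_left _ (pow_le h (by simp))))
      ((hw _ _ _ h).trans (Nat.mul_le_mul_left _ (pow_le h (by simp))))) (Nat.one_le_pow _ _ h)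
  | sqrt e ih =>
    obtain ⟨v, hv⟩ := ih he
    refine ⟨v + 1, fun ell C E h => ?_⟩
    simp only [cost, depth, add_mul, one_mul]
    exact add_le_add (hv _ _ _ h) (Nat.one_le_pow _ _ h)
  | ifLt a b e f ia ib ie jf =>
    simp only [free, Bool.and_eq_true] at he
    obtain ⟨v₁, h₁⟩ := ia he.1.1.1
    obtain ⟨v₂, h₂⟩ := ib he.1.1.2
    obtain ⟨v₃, h₃⟩ := ie he.1.2
    obtain ⟨v₄, h₄⟩ := jf he.2
    refine ⟨v₁ + v₂ + (v₃ + v₄) + 1, fun ell C E h => ?_⟩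
    simp only [cost, depth, add_mul, one_mul]
    exact add_le_add (add_le_add (add_le_add
      ((h₁ _ _ _ h).trans (Nat.mul_le_mul_left _ (pow_le h (by simp))))
      ((h₂ _ _ _ h).trans (Nat.mul_le_mul_left _ (pow_le h (by simp))))) (add_le_add
      ((h₃ _ _ _ h).trans (Nat.mul_le_mul_left _ (pow_le h (by simp))))
      ((h₄ _ _ _ h).trans (Nat.mul_le_mul_left _ (pow_le h (by simp))))))
      (Nat.one_le_pow _ _ h)
  | sum e ih =>
    obtain ⟨v, hv⟩ := ih he
    refine ⟨v + 8, fun ell C E h => ?_⟩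
    have h1 := hv ell C E h
    have h2 : 1 ≤ ell ^ e.depth := Nat.one_le_pow _ _ h
    simp only [cost, depth, pow_succ]
    nlinarith [Nat.mul_le_mul_left ell h1, Nat.mul_le_mul_left ell h2]

end Ex

namespace Stmt

/-- The maximal number of nested loops. -/
def depth : Stmt → ℕ
  | .fill0 _ e => e.depth
  | .fill1 _ e => e.depth + 1
  | .fill2 _ e => e.depth + 2
  | .seq s t => max s.depth t.depth
  | .rep s => s.depth + 1

/-- There is no query with a price. -/
def free : Stmt → Bool
  | .fill0 _ e => e.free
  | .fill1 _ e => e.free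
  | .fill2 _ e => e.free
  | .seq s t => s.free && t.free
  | .rep s => s.free

theorem exists_cost_le (s : Stmt) (hs : s.free = true) :
    ∃ w, ∀ ell C E : ℕ, 1 ≤ ell → s.cost ell C E ≤ w * ell ^ s.depth := by
  have loop_le : ∀ {ell x c v k : ℕ}, 1 ≤ ell → x ≤ v * ell ^ k →
      ell * (x + c) + 2 ≤ (v + c + 2) * ell ^ (k + 1) := by
    intro ell x c v k h hx
    have h2 : 1 ≤ ell ^ k := Nat.one_le_pow _ _ h
    rw [pow_succ]
    nlinarith [Nat.mul_le_mul_left ell hx, Nat.mul_le_mul_left ell h2,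
      Nat.mul_le_mul_left c (Nat.mul_le_mul_left ell h2)]
  induction s with
  | fill0 a e =>
    obtain ⟨v, hv⟩ := e.exists_cost_le hs
    refine ⟨v + 3, fun ell C E h => ?_⟩
    simp only [cost, depth, add_mul]
    exact add_le_add (hv _ _ _ h) (Nat.le_mul_of_pos_right _ (Nat.one_le_pow _ _ h))
  | fill1 a e =>
    obtain ⟨v, hv⟩ := e.exists_cost_le hs
    exact ⟨v + 6 + 2, fun ell C E h => loop_le (c := 6) h (hv _ _ _ h)⟩
  | fill2 a e =>
    obtain ⟨v, hv⟩ := e.exists_cost_le hs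
    exact ⟨v + 6 + 2 + 3 + 2, fun ell C E h =>
      loop_le (c := 3) h (loop_le (c := 6) h (hv _ _ _ h))⟩
  | seq s t ih jh =>
    simp only [free, Bool.and_eq_true] at hs
    obtain ⟨v, hv⟩ := ih hs.1
    obtain ⟨w, hw⟩ := jh hs.2
    refine ⟨v + w, fun ell C E h => ?_⟩
    simp only [cost, depth, add_mul]
    exact add_le_add
      ((hv _ _ _ h).trans (Nat.mul_le_mul_left _ (Nat.pow_le_pow_right h (by simp))))
      ((hw _ _ _ h).trans (Nat.mul_le_mul_left _ (Nat.pow_le_pow_right h (by simp))))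
  | rep s ih =>
    obtain ⟨v, hv⟩ := ih hs
    exact ⟨v + 3 + 2, fun ell C E h => loop_le (c := 3) h (hv _ _ _ h)⟩

end Stmt

/-! ### Symmetric generalized inverses -/

section Matrices

theorem Matrix.PosSemidef.transpose_eq {ι : Type*} {A : Matrix ι ι ℝ} (hA : A.PosSemidef) : Aᵀ = A := by
  simpa using hA.isHermitian.eq

variable {ι : Type*} [Fintype ι]

theorem Matrix.PosSemidef.quad_nonneg {A : Matrix ι ι ℝ} (hA : A.PosSemidef) (x : ι → ℝ) :
    0 ≤ x ⬝ᵥ (A *ᵥ x) := by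
  simpa using hA.dotProduct_mulVec_nonneg x

theorem Matrix.posSemidef_of_quad {A : Matrix ι ι ℝ} (h1 : Aᵀ = A)
    (h2 : ∀ x : ι → ℝ, 0 ≤ x ⬝ᵥ (A *ᵥ x)) : A.PosSemidef :=
  .of_dotProduct_mulVec_nonneg (by simpa [Matrix.IsHermitian] using h1) (by simpa using h2)

/-- A symmetric matrix can be moved to the other side of a dot product. -/
theorem Matrix.dotProduct_mulVec_symm {A : Matrix ι ι ℝ} (hA : Aᵀ = A) (x y : ι → ℝ) :
    x ⬝ᵥ (A *ᵥ y) = (A *ᵥ x) ⬝ᵥ y := by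
  rw [Matrix.dotProduct_mulVec, ← Matrix.mulVec_transpose, hA]

/-- The Cauchy–Schwarz inequality for a positive semidefinite matrix. -/
theorem Matrix.PosSemidef.abs_dotProduct_mulVec_le {A : Matrix ι ι ℝ} (hA : A.PosSemidef)
    (x y : ι → ℝ) : |x ⬝ᵥ (A *ᵥ y)| ≤ √(x ⬝ᵥ (A *ᵥ x)) * √(y ⬝ᵥ (A *ᵥ y)) := by
  rw [← Real.sqrt_mul (hA.quad_nonneg x)]
  refine Real.abs_le_sqrt ?_
  have h : ∀ t : ℝ, 0 ≤ (y ⬝ᵥ (A *ᵥ y)) * (t * t) + (2 * (x ⬝ᵥ (A *ᵥ y))) * t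
      + x ⬝ᵥ (A *ᵥ x) := by
    intro t
    have := hA.quad_nonneg (x + t • y)
    have e : y ⬝ᵥ (A *ᵥ x) = x ⬝ᵥ (A *ᵥ y) := by
      rw [Matrix.dotProduct_mulVec_symm hA.transpose_eq, dotProduct_comm]
    simp only [Matrix.mulVec_add, Matrix.mulVec_smul, dotProduct_add, add_dotProduct,
      smul_dotProduct, dotProduct_smul, smul_eq_mul, e] at this
    linarith
  have := discrim_le_zero h
  simp only [discrim] at this
  linarith

/-- `G` is a symmetric reflexive generalized inverse of `H`. -/
structure IsGinv (H G : Matrix ι ι ℝ) : Prop where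
  symm : Gᵀ = G
  left : G * H * G = G
  right : H * G * H = H

/-- A system whose right-hand side is orthogonal to the kernel is solved by a generalized
inverse. -/
theorem IsGinv.mulVec_solution {H G : Matrix ι ι ℝ} (h : IsGinv H G) (hH : Hᵀ = H) {g : ι → ℝ}
    (hg : ∀ n, H *ᵥ n = 0 → g ⬝ᵥ n = 0) : H *ᵥ (G *ᵥ g) = g := by
  have key : ∀ m, m ⬝ᵥ (g - H *ᵥ (G *ᵥ g)) = 0 := by
    intro m
    have h1 : H *ᵥ (m - G *ᵥ (H *ᵥ m)) = 0 := by
      simp [Matrix.mulVec_sub, Matrix.mulVec_mulVec, ← Matrix.mul_assoc, h.right]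
    have h2 := hg _ h1
    rw [dotProduct_sub, Matrix.dotProduct_mulVec_symm hH, Matrix.dotProduct_mulVec_symm h.symm,
      ← sub_dotProduct, dotProduct_comm]
    exact h2
  have := key (g - H *ᵥ (G *ᵥ g))
  rw [dotProduct_self_eq_zero, sub_eq_zero] at this
  exact this.symm

variable [DecidableEq ι]

/-- One step of the Gram–Schmidt process for the standard basis and the bilinear form of `H`: the
component of the `k`-th basis vector that is `H`-orthogonal to the earlier ones. -/
def ginvDir (H G : Matrix ι ι ℝ) (k : ι) : ι → ℝ :=
  Pi.single k 1 - G *ᵥ (H *ᵥ Pi.single k 1)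

/-- Add to `G` the rank-one matrix of the `k`-th vector of the Gram–Schmidt process, if this vector
is not in the kernel of `H`. -/
def ginvStep (H G : Matrix ι ι ℝ) (k : ι) : Matrix ι ι ℝ :=
  G + (if 0 < (H *ᵥ ginvDir H G k) k then 1 / (H *ᵥ ginvDir H G k) k else 0) •
    Matrix.vecMulVec (ginvDir H G k) (ginvDir H G k)

theorem ginvStep_spec {H G : Matrix ι ι ℝ} (hH : H.PosSemidef) (hG : Gᵀ = G)
    (hGHG : G * H * G = G) (k : ι) :
    (ginvStep H G k)ᵀ = ginvStep H G k ∧ ginvStep H G k * H * ginvStep H G k = ginvStep H G k ∧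
    (∀ x, H *ᵥ (G *ᵥ (H *ᵥ x)) = H *ᵥ x →
      H *ᵥ (ginvStep H G k *ᵥ (H *ᵥ x)) = H *ᵥ x) ∧
    H *ᵥ (ginvStep H G k *ᵥ (H *ᵥ Pi.single k 1)) = H *ᵥ Pi.single k 1 := by
  have hHt := hH.transpose_eq
  set e : ι → ℝ := Pi.single k 1 with he
  set q := ginvDir H G k with hq
  set d := (H *ᵥ q) k with hd
  have hq' : q = e - G *ᵥ (H *ᵥ e) := rfl
  have hGHq : G *ᵥ (H *ᵥ q) = 0 := by
    simp only [hq', Matrix.mulVec_sub, Matrix.mulVec_mulVec, hGHG, ← Matrix.mul_assoc, sub_self]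
  have hHq : ∀ x, H *ᵥ (G *ᵥ (H *ᵥ x)) = H *ᵥ x → q ⬝ᵥ (H *ᵥ x) = 0 := by
    intro x hx
    rw [← hx, Matrix.dotProduct_mulVec_symm hHt, Matrix.dotProduct_mulVec_symm hG, hGHq,
      zero_dotProduct]
  have hqe : q ⬝ᵥ (H *ᵥ e) = d := by
    rw [Matrix.dotProduct_mulVec_symm hHt, he, dotProduct_single, mul_one]
  have hqq : q ⬝ᵥ (H *ᵥ q) = d := by
    conv_lhs => rw [hq']
    rw [Matrix.mulVec_sub, dotProduct_sub, sub_dotProduct, sub_dotProduct,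
      ← Matrix.dotProduct_mulVec_symm hG, ← Matrix.dotProduct_mulVec_symm hG]
    have h1 : e ⬝ᵥ (H *ᵥ e) - e ⬝ᵥ (H *ᵥ (G *ᵥ (H *ᵥ e))) = d := by
      rw [← dotProduct_sub, ← Matrix.mulVec_sub, ← hq', he, single_dotProduct, one_mul]
    have h2 : (H *ᵥ e) ⬝ᵥ (G *ᵥ (H *ᵥ e)) - (H *ᵥ e) ⬝ᵥ (G *ᵥ (H *ᵥ (G *ᵥ (H *ᵥ e)))) = 0 := by
      rw [← dotProduct_sub, ← Matrix.mulVec_sub, ← Matrix.mulVec_sub, ← hq', hGHq, dotProduct_zero]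
    linarith
  by_cases hpos : 0 < d
  · have hstep : ginvStep H G k = G + (1 / d) • Matrix.vecMulVec q q := by
      simp only [ginvStep, ← hq, ← hd, if_pos hpos]
    have hmv : ∀ v, ginvStep H G k *ᵥ v = G *ᵥ v + (q ⬝ᵥ v / d) • q := by
      intro v
      rw [hstep, Matrix.add_mulVec, Matrix.smul_mulVec, Matrix.vecMulVec_mulVec]
      ext i
      simp
      ring
    refine ⟨?_, ?_, fun x hx => ?_, ?_⟩
    · rw [hstep, Matrix.transpose_add, Matrix.transpose_smul, Matrix.transpose_vecMulVec, hG]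
    · refine Matrix.ext_of_mulVec_single fun i => ?_
      rw [← Matrix.mulVec_mulVec, ← Matrix.mulVec_mulVec]
      generalize (Pi.single i 1 : ι → ℝ) = v
      have h3 : q ⬝ᵥ (H *ᵥ (G *ᵥ v)) = 0 := by
        rw [Matrix.dotProduct_mulVec_symm hHt, Matrix.dotProduct_mulVec_symm hG, hGHq,
          zero_dotProduct]
      rw [hmv v, hmv, Matrix.mulVec_add, Matrix.mulVec_add, Matrix.mulVec_smul, Matrix.mulVec_smul,
        hGHq, dotProduct_add, h3, dotProduct_smul, hqq, smul_eq_mul]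
      simp only [Matrix.mulVec_mulVec, ← Matrix.mul_assoc, hGHG]
      rw [smul_zero, add_zero, zero_add, mul_div_assoc, div_self hpos.ne', mul_one]
    · rw [hmv, hHq x hx, zero_div, zero_smul, add_zero, hx]
    · rw [hmv, hqe, div_self hpos.ne', one_smul, hq', add_sub_cancel]
  · have hstep : ginvStep H G k = G := by
      simp only [ginvStep, ← hq, ← hd, if_neg hpos, zero_smul, add_zero]
    rw [hstep]
    refine ⟨hG, hGHG, fun x hx => hx, ?_⟩
    have h0 : q ⬝ᵥ (H *ᵥ q) = 0 := le_antisymm (hqq ▸ not_lt.1 hpos) (hH.quad_nonneg q)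
    have : H *ᵥ q = 0 := (hH.dotProduct_mulVec_zero_iff q).1 (by simpa using h0)
    rw [hq', Matrix.mulVec_sub, sub_eq_zero] at this
    exact this.symm

end Matrices

/-- The generalized inverse after `k` steps of the Gram–Schmidt process. -/
def ginvAux {ell : ℕ} (H : Matrix (Fin ell) (Fin ell) ℝ) : ℕ → Matrix (Fin ell) (Fin ell) ℝ
  | 0 => 0
  | k + 1 => if h : k < ell then ginvStep H (ginvAux H k) ⟨k, h⟩ else ginvAux H k

/-- The generalized inverse of a positive semidefinite matrix `H` that the Gram–Schmidt process
yields: the sum of `q qᵀ / (qᵀ H q)` over the `H`-orthogonal vectors `q`. -/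
def ginv {ell : ℕ} (H : Matrix (Fin ell) (Fin ell) ℝ) : Matrix (Fin ell) (Fin ell) ℝ :=
  ginvAux H ell

theorem isGinv_ginv {ell : ℕ} {H : Matrix (Fin ell) (Fin ell) ℝ} (hH : H.PosSemidef) :
    IsGinv H (ginv H) := by
  have key : ∀ k ≤ ell, (ginvAux H k)ᵀ = ginvAux H k ∧
      ginvAux H k * H * ginvAux H k = ginvAux H k ∧
      ∀ i : Fin ell, (i : ℕ) < k →
        H *ᵥ (ginvAux H k *ᵥ (H *ᵥ Pi.single i 1)) = H *ᵥ Pi.single i 1 := by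
    intro k
    induction k with
    | zero => simp [ginvAux]
    | succ k ih =>
      intro hk
      obtain ⟨h1, h2, h3⟩ := ih (by lia)
      have hk' : k < ell := by lia
      obtain ⟨s1, s2, s3, s4⟩ := ginvStep_spec hH h1 h2 ⟨k, hk'⟩
      simp only [ginvAux, dif_pos hk']
      refine ⟨s1, s2, fun i hi => ?_⟩
      by_cases hik : (i : ℕ) = k
      · obtain rfl : i = ⟨k, hk'⟩ := Fin.ext hik
        exact s4
      · exact s3 _ (h3 i (by lia))
  obtain ⟨h1, h2, h3⟩ := key ell le_rfl
  refine ⟨h1, h2, Matrix.ext_of_mulVec_single fun i => ?_⟩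
  rw [← Matrix.mulVec_mulVec, ← Matrix.mulVec_mulVec]
  exact h3 i i.2

/-! ### The Frobenius norm -/

section Frobenius

open scoped Matrix.Norms.Frobenius

variable {ι : Type*} [Fintype ι] [DecidableEq ι]

theorem Matrix.frobenius_sq (A : Matrix ι ι ℝ) : ‖A‖ ^ 2 = ∑ i, ∑ j, A i j ^ 2 := by
  rw [Matrix.frobenius_norm_def, ← Real.sqrt_eq_rpow, Real.sq_sqrt (by positivity)]
  simp

theorem Matrix.frobenius_sq_eq_trace (A : Matrix ι ι ℝ) : ‖A‖ ^ 2 = (Aᵀ * A).trace := by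
  rw [Matrix.frobenius_sq, Finset.sum_comm]
  simp [Matrix.trace, Matrix.mul_apply, sq]

theorem Matrix.abs_trace_mul_le (A B : Matrix ι ι ℝ) : |(A * B).trace| ≤ ‖A‖ * ‖B‖ := by
  refine abs_le_of_sq_le_sq ?_ (by positivity)
  rw [mul_pow, ← Matrix.frobenius_norm_transpose B, Matrix.frobenius_sq, Matrix.frobenius_sq]
  simp only [Matrix.trace, Matrix.diag_apply, Matrix.mul_apply, ← Fintype.sum_prod_type',
    Matrix.transpose_apply]
  exact Finset.sum_mul_sq_le_sq_mul_sq _ (fun p : ι × ι => A p.1 p.2) fun p => B p.2 p.1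

theorem Matrix.frobenius_norm_one : ‖(1 : Matrix ι ι ℝ)‖ = √(Fintype.card ι) := by
  rw [← Real.sqrt_sq (norm_nonneg (1 : Matrix ι ι ℝ)), Matrix.frobenius_sq_eq_trace]
  simp

theorem Matrix.abs_trace_le (A : Matrix ι ι ℝ) : |A.trace| ≤ √(Fintype.card ι) * ‖A‖ := by
  simpa [Matrix.frobenius_norm_one] using Matrix.abs_trace_mul_le 1 A

theorem Matrix.abs_quad_le (A : Matrix ι ι ℝ) (x : ι → ℝ) :
    |x ⬝ᵥ (A *ᵥ x)| ≤ ‖A‖ * (x ⬝ᵥ x) := by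
  have h := Matrix.abs_trace_mul_le A (Matrix.vecMulVec x x)
  have h1 : (A * Matrix.vecMulVec x x).trace = x ⬝ᵥ (A *ᵥ x) := by
    rw [Matrix.mul_vecMulVec, Matrix.trace_vecMulVec, dotProduct_comm]
  have h2 : ‖Matrix.vecMulVec x x‖ = x ⬝ᵥ x := by
    rw [← Real.sqrt_sq (norm_nonneg (Matrix.vecMulVec x x)), Matrix.frobenius_sq_eq_trace,
      Matrix.transpose_vecMulVec, Matrix.vecMulVec_mul_vecMulVec, Matrix.vecMulVec_smul,
      Matrix.trace_smul, Matrix.trace_vecMulVec, smul_eq_mul, Real.sqrt_mul_self]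
    exact Finset.sum_nonneg fun i _ => mul_self_nonneg _
  rwa [h1, h2] at h

/-- The resolvent estimate `‖E (1 + E)⁻¹‖ ≤ ‖E‖ / (1 - ‖E‖)`. -/
theorem Matrix.frobenius_mul_inv_le {E Z : Matrix ι ι ℝ} {ρ : ℝ} (hE : ‖E‖ ≤ ρ) (hρ : ρ < 1)
    (hZ : (1 + E) * Z = 1) (hZ' : Z * (1 + E) = 1) : ‖E * Z‖ ≤ ρ / (1 - ρ) := by
  have h1 : E * Z = E - E * (E * Z) := by
    have h2 : E * Z = Z * E := by
      have : Z + E * Z = Z + Z * E := by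
        rw [add_mul, one_mul] at hZ
        rw [mul_add, mul_one] at hZ'
        rw [hZ, hZ']
      exact add_left_cancel this
    rw [add_mul, one_mul] at hZ
    have h3 : Z = 1 - E * Z := eq_sub_of_add_eq hZ
    conv_lhs => rw [h3]
    rw [mul_sub, mul_one]
  have h2 : ‖E * Z‖ ≤ ‖E‖ + ‖E‖ * ‖E * Z‖ := by
    conv_lhs => rw [h1]
    exact (norm_sub_le _ _).trans (by gcongr; exact Matrix.frobenius_norm_mul _ _)
  rw [le_div_iff₀ (by linarith)]
  nlinarith [norm_nonneg (E * Z)]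

/-- Conjugation by the inverse square root of `1 + E` shrinks the Frobenius norm of a symmetric
matrix by a factor of at most `1 + ‖E‖`. -/
theorem Matrix.frobenius_le_of_sqrt {E X Y : Matrix ι ι ℝ} (hX : Xᵀ = X) (hY : Yᵀ = Y)
    (hYE : Y * Y = 1 + E) : ‖Y * X * Y‖ ≤ (1 + ‖E‖) * ‖X‖ := by
  refine abs_le_of_sq_le_sq' ?_ (by positivity) |>.2
  have h1 : ‖Y * X * Y‖ ^ 2 = (X * (1 + E) * X * (1 + E)).trace := by
    rw [Matrix.frobenius_sq_eq_trace, ← hYE]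
    simp only [Matrix.transpose_mul, hX, hY]
    simp only [Matrix.mul_assoc]
    rw [Matrix.trace_mul_comm]
    simp only [Matrix.mul_assoc]
  have h2 : X * (1 + E) * X * (1 + E) = X * X + X * X * E + X * E * X + X * E * (X * E) := by
    noncomm_ring
  have h3 : (X * E * X).trace = (X * X * E).trace := by
    rw [Matrix.trace_mul_comm, ← Matrix.mul_assoc]
  have h4 : (X * X).trace = ‖X‖ ^ 2 := by rw [Matrix.frobenius_sq_eq_trace, hX]
  have h5 : (X * X * E).trace ≤ ‖X‖ * (‖X‖ * ‖E‖) := by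
    rw [Matrix.mul_assoc]
    exact (le_abs_self _).trans ((Matrix.abs_trace_mul_le _ _).trans
      (by gcongr; exact Matrix.frobenius_norm_mul _ _))
  have h6 : (X * E * (X * E)).trace ≤ (‖X‖ * ‖E‖) * (‖X‖ * ‖E‖) :=
    (le_abs_self _).trans ((Matrix.abs_trace_mul_le _ _).trans
      (by gcongr <;> exact Matrix.frobenius_norm_mul _ _))
  rw [h1, h2, Matrix.trace_add, Matrix.trace_add, Matrix.trace_add, h3, h4]
  nlinarith

end Frobenius

open scoped MatrixOrder in
theorem Matrix.PosSemidef.exists_sqrt {ι : Type*} [Fintype ι] [DecidableEq ι] {A : Matrix ι ι ℝ}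
    (hA : A.PosSemidef) : ∃ Y : Matrix ι ι ℝ, Yᵀ = Y ∧ Y * Y = A :=
  ⟨CFC.sqrt A, (Matrix.nonneg_iff_posSemidef.1 (CFC.sqrt_nonneg A)).transpose_eq,
    CFC.sqrt_mul_sqrt_self A (Matrix.nonneg_iff_posSemidef.2 hA)⟩

/-! ### The barrier and its local norm -/

namespace DualData

variable {ell : ℕ} (D : DualData ell)

/-- The linear part of the semidefinite constraint. -/
def lin (n : Fin ell → ℝ) : Matrix (Fin ell) (Fin ell) ℝ :=
  ∑ j, n j • Matrix.vecMulVec (D.Phi j) (D.Phi j)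

theorem slack_eq (γ : Fin ell → ℝ) : D.slack γ = D.lin γ + D.lamOne • 1 := rfl

theorem lin_eq (n : Fin ell → ℝ) : D.lin n = D.R * Matrix.diagonal n * D.Rᵀ := by
  ext i j
  simp [lin, Matrix.sum_apply, Matrix.mul_apply, Matrix.vecMulVec_apply, Phi,
    Matrix.diagonal_apply]
  exact Finset.sum_congr rfl fun _ _ => by ring

theorem lin_add (n m : Fin ell → ℝ) : D.lin (n + m) = D.lin n + D.lin m := by
  simp [lin, add_smul, Finset.sum_add_distrib]

theorem lin_smul (a : ℝ) (n : Fin ell → ℝ) : D.lin (a • n) = a • D.lin n := by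
  simp [lin, mul_smul, Finset.smul_sum]

theorem lin_transpose (n : Fin ell → ℝ) : (D.lin n)ᵀ = D.lin n := by
  rw [lin_eq]; simp [Matrix.mul_assoc]

theorem slack_transpose (γ : Fin ell → ℝ) : (D.slack γ)ᵀ = D.slack γ := by
  rw [slack_eq, Matrix.transpose_add, lin_transpose, Matrix.transpose_smul, Matrix.transpose_one]

theorem trace_lin_mul (n : Fin ell → ℝ) (X : Matrix (Fin ell) (Fin ell) ℝ) :
    (D.lin n * X).trace = ∑ j, n j * (D.Rᵀ * X * D.R) j j := by
  rw [lin_eq, Matrix.mul_assoc, Matrix.mul_assoc, Matrix.trace_mul_comm, Matrix.mul_assoc,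
    Matrix.trace]
  simp

theorem gram_eq (γ : Fin ell → ℝ) (i j : Fin ell) :
    D.gram γ i j = (D.Rᵀ * (D.slack γ)⁻¹ * D.R) i j := by
  rw [Matrix.mul_assoc, Matrix.mul_apply, gram, dotProduct]
  simp [Phi, Matrix.mul_apply, Matrix.mulVec, dotProduct]

theorem gram_symm (γ : Fin ell → ℝ) (i j : Fin ell) : D.gram γ i j = D.gram γ j i := by
  have h : (D.Rᵀ * (D.slack γ)⁻¹ * D.R)ᵀ = D.Rᵀ * (D.slack γ)⁻¹ * D.R := by
    simp only [Matrix.transpose_mul, Matrix.transpose_nonsing_inv, Matrix.transpose_transpose,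
      slack_transpose, Matrix.mul_assoc]
  rw [gram_eq, gram_eq]
  exact congrFun₂ h j i

/-- The norm of the direction `n` in the Hessian of `-log det slack` at `γ`. -/
def barNorm (γ n : Fin ell → ℝ) : ℝ := √(∑ i, ∑ j, n i * D.gram γ i j ^ 2 * n j)

theorem barNorm_nonneg (γ n : Fin ell → ℝ) : 0 ≤ D.barNorm γ n := Real.sqrt_nonneg _

section Frobenius

open scoped Matrix.Norms.Frobenius

variable {D}

theorem sum_gram_sq {γ : Fin ell → ℝ} {V : Matrix (Fin ell) (Fin ell) ℝ}
    (hV : (D.slack γ)⁻¹ = Vᵀ * V) (n : Fin ell → ℝ) :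
    ∑ i, ∑ j, n i * D.gram γ i j ^ 2 * n j = ‖V * D.lin n * Vᵀ‖ ^ 2 := by
  have h1 : (V * D.lin n * Vᵀ)ᵀ * (V * D.lin n * Vᵀ) =
      V * (D.lin n * ((Vᵀ * V) * (D.lin n * Vᵀ))) := by
    simp only [Matrix.transpose_mul, lin_transpose, Matrix.transpose_transpose, Matrix.mul_assoc]
  rw [Matrix.frobenius_sq_eq_trace, h1, Matrix.trace_mul_comm, ← hV, Matrix.mul_assoc,
    trace_lin_mul]
  refine Finset.sum_congr rfl fun i _ => ?_
  have h2 : D.Rᵀ * ((D.slack γ)⁻¹ * (D.lin n * Vᵀ) * V) * D.R =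
      (D.Rᵀ * (D.slack γ)⁻¹ * D.R) * Matrix.diagonal n * (D.Rᵀ * (D.slack γ)⁻¹ * D.R) := by
    rw [lin_eq, hV]
    simp only [Matrix.mul_assoc]
  rw [h2, Matrix.mul_apply, Finset.mul_sum]
  refine Finset.sum_congr rfl fun j _ => ?_
  rw [Matrix.mul_diagonal, ← gram_eq, ← gram_eq, D.gram_symm γ j i]
  ring

theorem barNorm_eq {γ : Fin ell → ℝ} {V : Matrix (Fin ell) (Fin ell) ℝ}
    (hV : (D.slack γ)⁻¹ = Vᵀ * V) (n : Fin ell → ℝ) :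
    D.barNorm γ n = ‖V * D.lin n * Vᵀ‖ := by
  rw [barNorm, sum_gram_sq hV, Real.sqrt_sq (norm_nonneg _)]

/-- `B` is a symmetric square root of the slack matrix, and `C` its inverse. -/
structure Frame (D : DualData ell) (γ : Fin ell → ℝ) (B C : Matrix (Fin ell) (Fin ell) ℝ) :
    Prop where
  symm : Bᵀ = B
  symm' : Cᵀ = C
  mul : B * C = 1
  mul' : C * B = 1
  slack : D.slack γ = B * B

theorem exists_frame {γ : Fin ell → ℝ} (h : (D.slack γ).PosDef) : ∃ B C, D.Frame γ B C := by
  obtain ⟨Y, hY, hYS⟩ := h.posSemidef.exists_sqrt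
  have hu : IsUnit Y.det := by
    have := (Matrix.isUnit_iff_isUnit_det _).1 h.isUnit
    rw [← hYS, Matrix.det_mul] at this
    exact isUnit_of_mul_isUnit_left this
  exact ⟨Y, Y⁻¹, hY, by rw [Matrix.transpose_nonsing_inv, hY], Matrix.mul_nonsing_inv _ hu,
    Matrix.nonsing_inv_mul _ hu, hYS.symm⟩

theorem Frame.inv {γ : Fin ell → ℝ} {B C : Matrix (Fin ell) (Fin ell) ℝ} (h : D.Frame γ B C) :
    (D.slack γ)⁻¹ = C * C := by
  refine Matrix.inv_eq_right_inv ?_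
  rw [h.slack, Matrix.mul_assoc, ← Matrix.mul_assoc B C C, h.mul, Matrix.one_mul, h.mul]

theorem Frame.inv' {γ : Fin ell → ℝ} {B C : Matrix (Fin ell) (Fin ell) ℝ} (h : D.Frame γ B C) :
    (D.slack γ)⁻¹ = Cᵀ * C := by rw [h.symm', h.inv]

theorem Frame.barNorm {γ : Fin ell → ℝ} {B C : Matrix (Fin ell) (Fin ell) ℝ} (h : D.Frame γ B C)
    (n : Fin ell → ℝ) : D.barNorm γ n = ‖C * D.lin n * C‖ := by
  rw [barNorm_eq h.inv', h.symm']

theorem Frame.lin_eq {γ : Fin ell → ℝ} {B C : Matrix (Fin ell) (Fin ell) ℝ} (h : D.Frame γ B C)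
    (n : Fin ell → ℝ) : D.lin n = B * (C * D.lin n * C) * B := by
  rw [Matrix.mul_assoc C, ← Matrix.mul_assoc B, h.mul, Matrix.one_mul, Matrix.mul_assoc, h.mul',
    Matrix.mul_one]

variable {γ : Fin ell → ℝ}

/-- The quadratic form of the Hessian of the barrier is the square of `barNorm`. -/
theorem sq_barNorm (h : (D.slack γ).PosDef) (n : Fin ell → ℝ) :
    D.barNorm γ n ^ 2 = ∑ i, ∑ j, n i * D.gram γ i j ^ 2 * n j := by
  obtain ⟨B, C, hf⟩ := exists_frame h
  rw [sum_gram_sq hf.inv', barNorm_eq hf.inv']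

theorem abs_lin_quad_le (h : (D.slack γ).PosDef) (n y : Fin ell → ℝ) :
    |y ⬝ᵥ (D.lin n *ᵥ y)| ≤ D.barNorm γ n * (y ⬝ᵥ (D.slack γ *ᵥ y)) := by
  obtain ⟨B, C, hf⟩ := exists_frame h
  have h1 : y ⬝ᵥ (D.lin n *ᵥ y) = (B *ᵥ y) ⬝ᵥ ((C * D.lin n * C) *ᵥ (B *ᵥ y)) := by
    rw [hf.lin_eq n, ← Matrix.mulVec_mulVec, ← Matrix.mulVec_mulVec,
      Matrix.dotProduct_mulVec_symm hf.symm, ← hf.lin_eq n]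
  have h2 : y ⬝ᵥ (D.slack γ *ᵥ y) = (B *ᵥ y) ⬝ᵥ (B *ᵥ y) := by
    rw [hf.slack, ← Matrix.mulVec_mulVec, Matrix.dotProduct_mulVec_symm hf.symm]
  rw [h1, h2, hf.barNorm]
  exact Matrix.abs_quad_le _ _

theorem sum_mul_gram_self (n : Fin ell → ℝ) :
    ∑ j, n j * D.gram γ j j = (D.lin n * (D.slack γ)⁻¹).trace := by
  rw [trace_lin_mul]
  exact Finset.sum_congr rfl fun j _ => by rw [gram_eq]

/-- The gradient of `-log det slack` has dual norm at most `√ℓ`. -/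
theorem abs_sum_mul_gram_self_le (h : (D.slack γ).PosDef) (n : Fin ell → ℝ) :
    |∑ j, n j * D.gram γ j j| ≤ √ell * D.barNorm γ n := by
  obtain ⟨B, C, hf⟩ := exists_frame h
  rw [sum_mul_gram_self, hf.inv, ← Matrix.mul_assoc, Matrix.trace_mul_comm, ← Matrix.mul_assoc,
    hf.barNorm]
  simpa using Matrix.abs_trace_le (C * D.lin n * C)

theorem trace_inv_nonneg (h : (D.slack γ).PosDef) : 0 ≤ (D.slack γ)⁻¹.trace :=
  h.posSemidef.inv.trace_nonneg

theorem sum_mul_gram_self_eq (h : (D.slack γ).PosDef) :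
    ∑ j, γ j * D.gram γ j j = ell - D.lamOne * (D.slack γ)⁻¹.trace := by
  have : D.lin γ = D.slack γ - D.lamOne • 1 := by rw [slack_eq, add_sub_cancel_right]
  rw [sum_mul_gram_self, this, sub_mul,
    Matrix.mul_nonsing_inv _ ((Matrix.isUnit_iff_isUnit_det _).1 h.isUnit)]
  simp

theorem barNorm_self_le (h : (D.slack γ).PosDef) (hl : 0 ≤ D.lamOne) :
    D.barNorm γ γ ≤ √ell + D.lamOne * (D.slack γ)⁻¹.trace := by
  obtain ⟨B, C, hf⟩ := exists_frame h
  have h1 : D.lin γ = D.slack γ - D.lamOne • 1 := by rw [slack_eq, add_sub_cancel_right]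
  have h2 : C * D.lin γ * C = 1 - D.lamOne • (C * C) := by
    rw [h1, hf.slack, mul_sub, sub_mul, ← Matrix.mul_assoc, hf.mul', Matrix.one_mul, hf.mul]
    simp
  have h3 : ‖C * C‖ ≤ (C * C).trace := by
    have h4 : ‖C‖ ^ 2 = (C * C).trace := by rw [Matrix.frobenius_sq_eq_trace, hf.symm']
    rw [← h4, sq]
    exact Matrix.frobenius_norm_mul _ _
  rw [hf.barNorm, h2, hf.inv]
  refine (norm_sub_le _ _).trans (add_le_add ?_ ?_)
  · rw [Matrix.frobenius_norm_one]; simp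
  · rw [norm_smul, Real.norm_of_nonneg hl]
    gcongr

theorem slack_add (γ d : Fin ell → ℝ) : D.slack (γ + d) = D.slack γ + D.lin d := by
  rw [slack_eq, slack_eq, lin_add]; abel

/-- The domain of the barrier contains the unit balls of the local norms, its Hessian changes there
by bounded factors, and its gradient is approximated by its linearization to second order. -/
theorem barNorm_step (h : (D.slack γ).PosDef) {d : Fin ell → ℝ} {ρ : ℝ}
    (hd : D.barNorm γ d ≤ ρ) (hρ : ρ < 1) :
    (D.slack (γ + d)).PosDef ∧
    (∀ n, D.barNorm γ n ≤ (1 + ρ) * D.barNorm (γ + d) n) ∧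
    ∀ n, |∑ i, n i * (D.gram γ i i - D.gram (γ + d) i i - ∑ j, D.gram γ i j ^ 2 * d j)|
      ≤ ρ ^ 2 / (1 - ρ) * D.barNorm γ n := by
  obtain ⟨B, C, hf⟩ := exists_frame h
  set E := C * D.lin d * C with hE
  have hEt : Eᵀ = E := by
    simp only [hE, Matrix.transpose_mul, hf.symm', lin_transpose, Matrix.mul_assoc]
  have hEn : ‖E‖ ≤ ρ := by rwa [hf.barNorm] at hd
  have hρ0 : 0 ≤ ρ := (norm_nonneg _).trans hEn
  have hS : D.slack (γ + d) = B * (1 + E) * B := by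
    rw [slack_add, mul_add, add_mul, Matrix.mul_one, ← hf.slack, ← hf.lin_eq]
  have h1E : (1 + E).PosDef := by
    refine .of_dotProduct_mulVec_pos (by simp [Matrix.IsHermitian, hEt]) fun x hx => ?_
    have h1 := (abs_le.1 (Matrix.abs_quad_le E x)).1
    have h2 : 0 < x ⬝ᵥ x := by
      refine lt_of_le_of_ne (Finset.sum_nonneg fun i _ => mul_self_nonneg _) fun h => hx ?_
      exact dotProduct_self_eq_zero.1 h.symm
    simp only [star_trivial, Matrix.add_mulVec, Matrix.one_mulVec, dotProduct_add]
    nlinarith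
  have hZu := (Matrix.isUnit_iff_isUnit_det _).1 h1E.isUnit
  obtain ⟨Y, hY, hYE⟩ := h1E.posSemidef.exists_sqrt
  have hYu : IsUnit Y.det := by
    rw [← hYE, Matrix.det_mul] at hZu
    exact isUnit_of_mul_isUnit_left hZu
  set Z := (1 + E)⁻¹ with hZ
  have hZ1 : (1 + E) * Z = 1 := Matrix.mul_nonsing_inv _ hZu
  have hZ2 : Z * (1 + E) = 1 := Matrix.nonsing_inv_mul _ hZu
  have hSinv : (D.slack (γ + d))⁻¹ = C * Z * C := by
    refine Matrix.inv_eq_right_inv ?_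
    rw [hS]
    calc B * (1 + E) * B * (C * Z * C) = B * ((1 + E) * (B * C) * Z) * C := by
          simp only [Matrix.mul_assoc]
      _ = 1 := by rw [hf.mul, Matrix.mul_one, hZ1, Matrix.mul_one, hf.mul]
  have hZY : Z = Y⁻¹ * Y⁻¹ := by rw [hZ, ← hYE, Matrix.mul_inv_rev]
  have hYi : (Y⁻¹)ᵀ = Y⁻¹ := by rw [Matrix.transpose_nonsing_inv, hY]
  refine ⟨?_, fun n => ?_, fun n => ?_⟩
  · have := h1E.conjTranspose_mul_mul_same (B := B) ?_
    · rwa [Matrix.conjTranspose_eq_transpose_of_trivial, hf.symm, ← hS] at this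
    · intro x y hxy
      simpa [Matrix.mulVec_mulVec, hf.mul'] using congrArg (C *ᵥ ·) hxy
  · have hV : (D.slack (γ + d))⁻¹ = (Y⁻¹ * C)ᵀ * (Y⁻¹ * C) := by
      rw [hSinv, hZY, Matrix.transpose_mul, hf.symm', hYi]
      simp only [Matrix.mul_assoc]
    rw [hf.barNorm, barNorm_eq hV]
    have hX : (Y⁻¹ * C * D.lin n * (Y⁻¹ * C)ᵀ)ᵀ = Y⁻¹ * C * D.lin n * (Y⁻¹ * C)ᵀ := by
      simp only [Matrix.transpose_mul, Matrix.transpose_transpose, lin_transpose,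
        Matrix.mul_assoc]
    have hYX : Y * (Y⁻¹ * C * D.lin n * (Y⁻¹ * C)ᵀ) * Y = C * D.lin n * C := by
      rw [Matrix.transpose_mul, hf.symm', hYi]
      calc Y * (Y⁻¹ * C * D.lin n * (C * Y⁻¹)) * Y
          = (Y * Y⁻¹) * (C * D.lin n * C) * (Y⁻¹ * Y) := by simp only [Matrix.mul_assoc]
        _ = C * D.lin n * C := by
          rw [Matrix.mul_nonsing_inv _ hYu, Matrix.nonsing_inv_mul _ hYu, Matrix.one_mul,
            Matrix.mul_one]
    rw [← hYX]
    exact (Matrix.frobenius_le_of_sqrt hX hY hYE).trans (by gcongr)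
  · have h1 : ∑ i, n i * (D.gram γ i i - D.gram (γ + d) i i - ∑ j, D.gram γ i j ^ 2 * d j) =
        -((C * D.lin n * C) * (E * (E * Z))).trace := by
      have e1 : ∀ i, D.gram γ i i - D.gram (γ + d) i i - ∑ j, D.gram γ i j ^ 2 * d j =
          (D.Rᵀ * (C * (1 - Z - E) * C) * D.R) i i := by
        intro i
        have : D.Rᵀ * (C * (1 - Z - E) * C) * D.R = D.Rᵀ * (D.slack γ)⁻¹ * D.R -
            D.Rᵀ * (D.slack (γ + d))⁻¹ * D.R - (D.Rᵀ * (D.slack γ)⁻¹ * D.R) *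
              Matrix.diagonal d * (D.Rᵀ * (D.slack γ)⁻¹ * D.R) := by
          rw [hSinv, hf.inv, hE, D.lin_eq d]
          noncomm_ring
        rw [this, Matrix.sub_apply, Matrix.sub_apply, ← gram_eq, ← gram_eq, Matrix.mul_apply]
        congr 1
        refine Finset.sum_congr rfl fun j _ => ?_
        rw [Matrix.mul_diagonal, ← gram_eq, ← gram_eq, D.gram_symm γ j i]
        ring
      have e2 : 1 - Z - E = -(E * (E * Z)) := by
        have e3 : Z = 1 - E * Z := eq_sub_of_add_eq (by rw [← hZ1, add_mul, Matrix.one_mul])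
        have e4 : E * Z = E - E * (E * Z) := by
          conv_lhs => rw [e3]
          rw [mul_sub, mul_one]
        conv_lhs => rw [e3, e4]
        abel
      simp only [e1]
      have e5 : ∀ X W : Matrix (Fin ell) (Fin ell) ℝ,
          (X * (C * W * C)).trace = (C * X * C * W).trace := by
        intro X W
        rw [show X * (C * W * C) = X * (C * W) * C by simp only [Matrix.mul_assoc],
          Matrix.trace_mul_comm]
        simp only [Matrix.mul_assoc]
      rw [← trace_lin_mul, e2, e5, mul_neg, Matrix.trace_neg]
    rw [h1, abs_neg, hf.barNorm]
    refine (Matrix.abs_trace_mul_le _ _).trans ?_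
    rw [mul_comm]
    have h2 := Matrix.frobenius_mul_inv_le hEn hρ hZ1 hZ2
    have h3 : ‖E * (E * Z)‖ ≤ ρ ^ 2 / (1 - ρ) :=
      (Matrix.frobenius_norm_mul _ _).trans <| by
        rw [sq, mul_div_assoc]
        gcongr
    gcongr

end Frobenius

end DualData

/-! ### Newton's method for the barrier function -/

namespace DualData

variable {ell : ℕ} (D : DualData ell)

/-- The parameters of the dual problem are in their ranges. -/
structure Valid : Prop where
  Q : D.Q.PosSemidef
  lamOne : 0 < D.lamOne
  lamTwo : 0 < D.lamTwo

/-- The gradient of `t * F - log det slack`. -/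
def gradT (t : ℝ) (γ : Fin ell → ℝ) : Fin ell → ℝ := fun i =>
  t * (1 / (2 * D.lamTwo) * (D.Q *ᵥ γ) i - 1 / (2 * D.lamTwo) * D.z i) - D.gram γ i i

/-- The Hessian of `t * F - log det slack`. -/
def hessT (t : ℝ) (γ : Fin ell → ℝ) : Matrix (Fin ell) (Fin ell) ℝ :=
  .of fun i j => t * (1 / (2 * D.lamTwo) * D.Q i j) + D.gram γ i j ^ 2

/-- The norm of the direction `n` in the Hessian of `t * F - log det slack` at `γ`. -/
def locNorm (t : ℝ) (γ n : Fin ell → ℝ) : ℝ := √(n ⬝ᵥ (D.hessT t γ *ᵥ n))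

/-- The linear form of `g` is bounded by `c` in the dual of the local norm at `γ`. -/
def DualBound (t : ℝ) (γ g : Fin ell → ℝ) (c : ℝ) : Prop :=
  ∀ n, |g ⬝ᵥ n| ≤ c * D.locNorm t γ n

theorem grad_eq (hell : 1 ≤ ell) {t : ℝ} (ht : 0 < t) (γ : Fin ell → ℝ) :
    D.grad (ell / t) γ = (1 / t) • D.gradT t γ := by
  have : (ell : ℝ) ≠ 0 := by positivity
  ext i
  simp only [grad, gradT, Pi.smul_apply, smul_eq_mul]
  field_simp

theorem hess_eq (hell : 1 ≤ ell) {t : ℝ} (ht : 0 < t) (γ : Fin ell → ℝ) :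
    D.hess (ell / t) γ = (1 / t) • D.hessT t γ := by
  have : (ell : ℝ) ≠ 0 := by positivity
  ext i j
  simp only [hess, hessT, Matrix.smul_apply, smul_eq_mul, Matrix.of_apply]
  field_simp

theorem hessT_mulVec (t : ℝ) (γ n : Fin ell → ℝ) (i : Fin ell) :
    (D.hessT t γ *ᵥ n) i =
      t / (2 * D.lamTwo) * (D.Q *ᵥ n) i + ∑ j, D.gram γ i j ^ 2 * n j := by
  simp only [hessT, Matrix.mulVec, dotProduct, Matrix.of_apply, add_mul, Finset.sum_add_distrib,
    Finset.mul_sum]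
  congr 1
  exact Finset.sum_congr rfl fun j _ => by ring

theorem locNorm_nonneg (t : ℝ) (γ n : Fin ell → ℝ) : 0 ≤ D.locNorm t γ n := Real.sqrt_nonneg _

variable {D}

theorem Valid.hessT_transpose (hD : D.Valid) (t : ℝ) (γ : Fin ell → ℝ) :
    (D.hessT t γ)ᵀ = D.hessT t γ := by
  ext i j
  have : D.Q j i = D.Q i j := congrFun₂ hD.Q.transpose_eq i j
  simp only [hessT, Matrix.transpose_apply, Matrix.of_apply, this, D.gram_symm γ j i]

section Point

variable {γ : Fin ell → ℝ} {t : ℝ}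

theorem dotProduct_hessT (hγ : (D.slack γ).PosDef) (n : Fin ell → ℝ) :
    n ⬝ᵥ (D.hessT t γ *ᵥ n) =
      t / (2 * D.lamTwo) * (n ⬝ᵥ (D.Q *ᵥ n)) + D.barNorm γ n ^ 2 := by
  rw [sq_barNorm hγ]
  simp only [dotProduct, hessT_mulVec, mul_add, Finset.sum_add_distrib, Finset.mul_sum]
  congr 1
  · exact Finset.sum_congr rfl fun j _ => by ring
  · exact Finset.sum_congr rfl fun i _ => Finset.sum_congr rfl fun j _ => by ring

theorem Valid.coeff_nonneg (hD : D.Valid) (ht : 0 ≤ t) : 0 ≤ t / (2 * D.lamTwo) := by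
  have := hD.lamTwo
  positivity

theorem Valid.posSemidef_hessT (hD : D.Valid) (ht : 0 ≤ t) (hγ : (D.slack γ).PosDef) :
    (D.hessT t γ).PosSemidef :=
  Matrix.posSemidef_of_quad (hD.hessT_transpose t γ) fun x => by
    rw [dotProduct_hessT hγ]
    exact add_nonneg (mul_nonneg (hD.coeff_nonneg ht) (hD.Q.quad_nonneg x)) (sq_nonneg _)

theorem Valid.sq_locNorm (hD : D.Valid) (ht : 0 ≤ t) (hγ : (D.slack γ).PosDef)
    (n : Fin ell → ℝ) : D.locNorm t γ n ^ 2 =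
      t / (2 * D.lamTwo) * (n ⬝ᵥ (D.Q *ᵥ n)) + D.barNorm γ n ^ 2 := by
  rw [locNorm, Real.sq_sqrt ((hD.posSemidef_hessT ht hγ).quad_nonneg n), dotProduct_hessT hγ]

theorem Valid.barNorm_le (hD : D.Valid) (ht : 0 ≤ t) (hγ : (D.slack γ).PosDef)
    (n : Fin ell → ℝ) : D.barNorm γ n ≤ D.locNorm t γ n := by
  refine abs_le_of_sq_le_sq' ?_ (D.locNorm_nonneg t γ n) |>.2
  rw [hD.sq_locNorm ht hγ]
  have := mul_nonneg (hD.coeff_nonneg ht) (hD.Q.quad_nonneg n)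
  linarith

theorem DualBound.orthogonal {g : Fin ell → ℝ} {c : ℝ} (h : D.DualBound t γ g c)
    {n : Fin ell → ℝ} (hn : D.hessT t γ *ᵥ n = 0) : g ⬝ᵥ n = 0 := by
  have := h n
  rw [locNorm, hn, dotProduct_zero, Real.sqrt_zero, mul_zero] at this
  exact abs_nonpos_iff.1 this

theorem DualBound.mono {g : Fin ell → ℝ} {c c' : ℝ} (h : D.DualBound t γ g c) (hc : c ≤ c') :
    D.DualBound t γ g c' := fun n =>
  (h n).trans (mul_le_mul_of_nonneg_right hc (D.locNorm_nonneg t γ n))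

theorem DualBound.add {g g' : Fin ell → ℝ} {c c' : ℝ} (h : D.DualBound t γ g c)
    (h' : D.DualBound t γ g' c') : D.DualBound t γ (g + g') (c + c') := fun n => by
  rw [add_dotProduct, add_mul]
  exact (abs_add_le _ _).trans (add_le_add (h n) (h' n))

theorem DualBound.smul {g : Fin ell → ℝ} {c : ℝ} (h : D.DualBound t γ g c) (a : ℝ) :
    D.DualBound t γ (a • g) (|a| * c) := fun n => by
  rw [smul_dotProduct, smul_eq_mul, abs_mul, mul_assoc]
  exact mul_le_mul_of_nonneg_left (h n) (abs_nonneg a)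

/-- The dual local norm of `H x` is the local norm of `x`, where `H` is the Hessian. -/
theorem Valid.dualBound_mulVec (hD : D.Valid) (ht : 0 ≤ t) (hγ : (D.slack γ).PosDef)
    (x : Fin ell → ℝ) : D.DualBound t γ (D.hessT t γ *ᵥ x) (D.locNorm t γ x) := fun n => by
  rw [← Matrix.dotProduct_mulVec_symm (hD.hessT_transpose t γ)]
  exact (hD.posSemidef_hessT ht hγ).abs_dotProduct_mulVec_le x n

/-- A bound for the dual local norm of `H x` bounds the local norm of `x`. -/
theorem DualBound.locNorm_le {x : Fin ell → ℝ} {c : ℝ}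
    (h : D.DualBound t γ (D.hessT t γ *ᵥ x) c) (hc : 0 ≤ c) : D.locNorm t γ x ≤ c := by
  rcases le_or_gt (x ⬝ᵥ (D.hessT t γ *ᵥ x)) 0 with h0 | h0
  · rwa [locNorm, Real.sqrt_eq_zero_of_nonpos h0]
  · have h1 := h x
    have h2 : 0 < D.locNorm t γ x := Real.sqrt_pos.2 h0
    have h3 : D.locNorm t γ x * D.locNorm t γ x = x ⬝ᵥ (D.hessT t γ *ᵥ x) :=
      Real.mul_self_sqrt h0.le
    rw [dotProduct_comm, abs_of_pos h0, ← h3] at h1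
    exact le_of_mul_le_mul_right h1 h2

/-- The dual local norm, computed with a generalized inverse of the Hessian. -/
theorem Valid.dualBound_ginv (hD : D.Valid) (ht : 0 ≤ t) (hγ : (D.slack γ).PosDef)
    {G : Matrix (Fin ell) (Fin ell) ℝ} (hG : IsGinv (D.hessT t γ) G) {g : Fin ell → ℝ} {c : ℝ}
    (h : D.DualBound t γ g c) (hc : 0 ≤ c) :
    D.hessT t γ *ᵥ (G *ᵥ g) = g ∧ D.DualBound t γ g √(g ⬝ᵥ (G *ᵥ g)) ∧
      √(g ⬝ᵥ (G *ᵥ g)) ≤ c := by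
  have h1 := hG.mulVec_solution (hD.hessT_transpose t γ) fun n hn => h.orthogonal hn
  have h2 : D.locNorm t γ (G *ᵥ g) = √(g ⬝ᵥ (G *ᵥ g)) := by
    rw [locNorm, h1, dotProduct_comm]
  refine ⟨h1, ?_, ?_⟩
  · have := hD.dualBound_mulVec ht hγ (G *ᵥ g)
    rwa [h1, h2] at this
  · rw [← h2]
    exact DualBound.locNorm_le (by rwa [h1]) hc

theorem neg_dotProduct_newton {g p : Fin ell → ℝ} (hp : D.hessT t γ *ᵥ p = -g) :
    √(-(g ⬝ᵥ p)) = D.locNorm t γ p := by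
  rw [locNorm, hp, dotProduct_neg, dotProduct_comm]

/-- The damped Newton step stays in the domain, and the Newton decrement shrinks quadratically. -/
theorem Valid.newton (hD : D.Valid) (ht : 0 ≤ t) (hγ : (D.slack γ).PosDef)
    {e p : Fin ell → ℝ} (hp : D.hessT t γ *ᵥ p = -(D.gradT t γ - e)) :
    (D.slack (γ + (1 / (1 + D.locNorm t γ p)) • p)).PosDef ∧
    D.DualBound t (γ + (1 / (1 + D.locNorm t γ p)) • p)
      (D.gradT t (γ + (1 / (1 + D.locNorm t γ p)) • p) - e) (2 * D.locNorm t γ p ^ 2) := by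
  set dec := D.locNorm t γ p with hdec
  have hdec0 : 0 ≤ dec := D.locNorm_nonneg t γ p
  set a := 1 / (1 + dec) with ha
  have ha0 : 0 < a := by positivity
  have hadec : a * (1 + dec) = 1 := by rw [ha]; field_simp
  have hρ : D.barNorm γ (a • p) ≤ a * dec := by
    have h1 : D.barNorm γ (a • p) = a * D.barNorm γ p := by
      have : ∑ i, ∑ j, (a • p) i * D.gram γ i j ^ 2 * (a • p) j =
          a ^ 2 * ∑ i, ∑ j, p i * D.gram γ i j ^ 2 * p j := by
        simp only [Finset.mul_sum, Pi.smul_apply, smul_eq_mul]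
        exact Finset.sum_congr rfl fun i _ => Finset.sum_congr rfl fun j _ => by ring
      rw [barNorm, this, Real.sqrt_mul (sq_nonneg a), Real.sqrt_sq ha0.le, barNorm]
    rw [h1]
    exact mul_le_mul_of_nonneg_left (hD.barNorm_le ht hγ p) ha0.le
  have hρ1 : a * dec < 1 := by linarith
  obtain ⟨k1, k2, k3⟩ := barNorm_step hγ hρ hρ1
  refine ⟨k1, fun n => ?_⟩
  have hlin : D.gradT t (γ + a • p) - e = -(dec * a) • (D.hessT t γ *ᵥ p) + fun i =>
      D.gram γ i i - D.gram (γ + a • p) i i - ∑ j, D.gram γ i j ^ 2 * (a • p) j := by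
    have h1 : D.gradT t γ - e = -(D.hessT t γ *ᵥ p) := by rw [hp, neg_neg]
    have h2 : D.gradT t (γ + a • p) - e = (D.gradT t γ - e) + a • (D.hessT t γ *ᵥ p) + fun i =>
        D.gram γ i i - D.gram (γ + a • p) i i - ∑ j, D.gram γ i j ^ 2 * (a • p) j := by
      ext i
      have h3 : ∑ j, D.gram γ i j ^ 2 * (a * p j) = a * ∑ j, D.gram γ i j ^ 2 * p j := by
        rw [Finset.mul_sum]
        exact Finset.sum_congr rfl fun j _ => by ring
      simp only [Pi.add_apply, Pi.sub_apply, Pi.smul_apply, smul_eq_mul, hessT_mulVec, gradT,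
        Matrix.mulVec_add, Matrix.mulVec_smul]
      rw [h3]
      have h4 : D.lamTwo ≠ 0 := hD.lamTwo.ne'
      field_simp
      ring
    rw [h2, h1]
    have : -(D.hessT t γ *ᵥ p) + a • (D.hessT t γ *ᵥ p) = -(dec * a) • (D.hessT t γ *ᵥ p) := by
      rw [← neg_one_smul ℝ, ← add_smul]
      congr 1
      linarith
    rw [this]
  have hloc : D.locNorm t γ n ≤ (1 + a * dec) * D.locNorm t (γ + a • p) n := by
    refine abs_le_of_sq_le_sq' ?_ (mul_nonneg (by positivity) (D.locNorm_nonneg _ _ _)) |>.2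
    rw [mul_pow, hD.sq_locNorm ht hγ, hD.sq_locNorm ht k1, mul_add]
    have h1 := mul_nonneg (hD.coeff_nonneg ht) (hD.Q.quad_nonneg n)
    have h2 : D.barNorm γ n ^ 2 ≤ (1 + a * dec) ^ 2 * D.barNorm (γ + a • p) n ^ 2 := by
      rw [← mul_pow]
      exact pow_le_pow_left₀ (D.barNorm_nonneg γ n) (k2 n) 2
    have h3 : 1 ≤ (1 + a * dec) ^ 2 := by
      have : 0 ≤ a * dec := by positivity
      nlinarith
    nlinarith
  have h1 : |(-(dec * a) • (D.hessT t γ *ᵥ p)) ⬝ᵥ n| ≤ dec * a * dec * D.locNorm t γ n := by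
    have := (hD.dualBound_mulVec ht hγ p).smul (-(dec * a)) n
    have e1 : |-(dec * a)| = dec * a := by rw [abs_neg, abs_of_nonneg (by positivity)]
    rwa [e1] at this
  have h2 := k3 n
  have h3 : (a * dec) ^ 2 / (1 - a * dec) = a * dec * dec := by
    rw [show 1 - a * dec = a by linarith]
    field_simp
  rw [h3] at h2
  have h4 := hD.barNorm_le ht hγ n
  rw [hlin, add_dotProduct]
  have h5 : |(fun i => D.gram γ i i - D.gram (γ + a • p) i i -
      ∑ j, D.gram γ i j ^ 2 * (a • p) j) ⬝ᵥ n| ≤ a * dec * dec * D.locNorm t γ n := by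
    refine le_trans (le_of_eq ?_) (h2.trans (mul_le_mul_of_nonneg_left h4 (by positivity)))
    rw [dotProduct_comm]
    rfl
  calc _ ≤ dec * a * dec * D.locNorm t γ n + a * dec * dec * D.locNorm t γ n :=
        (abs_add_le _ _).trans (add_le_add h1 h5)
    _ = 2 * dec ^ 2 * (a * D.locNorm t γ n) := by ring
    _ ≤ 2 * dec ^ 2 * D.locNorm t (γ + a • p) n := by
        refine mul_le_mul_of_nonneg_left ?_ (by positivity)
        have h6 : a * (1 + a * dec) ≤ 1 := by nlinarith
        calc a * D.locNorm t γ n ≤ a * ((1 + a * dec) * D.locNorm t (γ + a • p) n) :=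
              mul_le_mul_of_nonneg_left hloc ha0.le
          _ = (a * (1 + a * dec)) * D.locNorm t (γ + a • p) n := by ring
          _ ≤ 1 * D.locNorm t (γ + a • p) n :=
              mul_le_mul_of_nonneg_right h6 (D.locNorm_nonneg _ _ _)
          _ = _ := one_mul _

/-- The gradient of `-log det slack` has dual local norm at most `√ℓ`. -/
theorem Valid.dualBound_gram (hD : D.Valid) (ht : 0 ≤ t) (hγ : (D.slack γ).PosDef) :
    D.DualBound t γ (fun i => D.gram γ i i) √ell := fun n => by
  have h := (abs_sum_mul_gram_self_le hγ n).trans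
    (mul_le_mul_of_nonneg_left (hD.barNorm_le ht hγ n) (Real.sqrt_nonneg _))
  rw [dotProduct_comm]
  exact h

/-- An increase of the weight `t` by the factor `1 + ε`. -/
theorem Valid.dualBound_increase (hD : D.Valid) (ht : 0 ≤ t) (hγ : (D.slack γ).PosDef)
    {η ε : ℝ} (hη0 : 0 ≤ η) (hε : 0 ≤ ε) (h : D.DualBound t γ (D.gradT t γ) η) :
    D.DualBound (t * (1 + ε)) γ (D.gradT (t * (1 + ε)) γ) ((1 + ε) * η + ε * √ell) := by
  have hη : D.DualBound t γ (D.gradT (t * (1 + ε)) γ) ((1 + ε) * η + ε * √ell) := by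
    have e1 : D.gradT (t * (1 + ε)) γ = (1 + ε) • D.gradT t γ + ε • fun i => D.gram γ i i := by
      ext i
      simp only [gradT, Pi.add_apply, Pi.smul_apply, smul_eq_mul]
      ring
    rw [e1]
    have h1 := h.smul (1 + ε)
    have h2 := (hD.dualBound_gram ht hγ).smul ε
    rw [abs_of_nonneg (by linarith)] at h1
    rw [abs_of_nonneg hε] at h2
    exact h1.add h2
  intro n
  have hle : D.locNorm t γ n ≤ D.locNorm (t * (1 + ε)) γ n := by
    refine Real.sqrt_le_sqrt ?_
    rw [dotProduct_hessT hγ, dotProduct_hessT hγ]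
    have h1 := mul_nonneg (hD.coeff_nonneg ht) (hD.Q.quad_nonneg n)
    rw [mul_div_right_comm]
    nlinarith
  exact (hη n).trans (mul_le_mul_of_nonneg_left hle (by positivity))

end Point

end DualData

/-! ### Bounds along the path of the preliminary phase -/

namespace DualData

variable {ell : ℕ}

/-- What the solvability of the primal problem says about the data of the dual one: the costs are
`a + α`, where `a` and the diagonal of the kernel matrix are bounded linear forms for the seminorm
of `Q`, and `α` is a linear form that is nonnegative, up to a multiple of `tr`, on the dual
feasible set. -/
structure Slater (D : DualData ell) (om a α : Fin ell → ℝ) (q U U₁ tr : ℝ) : Prop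
    extends D.Valid where
  z : ∀ j, D.z j = om j - 2 * D.lamTwo * (a j + α j)
  q_nonneg : 0 ≤ q
  U_nonneg : 0 ≤ U
  U₁_nonneg : 0 ≤ U₁
  tr_nonneg : 0 ≤ tr
  om_le : ∀ n, |om ⬝ᵥ n| ≤ q * √(n ⬝ᵥ (D.Q *ᵥ n))
  a_le : ∀ n, |a ⬝ᵥ n| ≤ U * √(n ⬝ᵥ (D.Q *ᵥ n))
  K_le : ∀ n, |(fun j => (D.Rᵀ * D.R) j j) ⬝ᵥ n| ≤ U₁ * √(n ⬝ᵥ (D.Q *ᵥ n))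
  trace_le : ∀ (c : Fin ell → ℝ) (μ : ℝ), 0 ≤ μ → (D.lin c + μ • 1).PosSemidef →
    0 ≤ α ⬝ᵥ c + μ * tr

variable {D : DualData ell}

theorem trace_lin (n : Fin ell → ℝ) :
    (D.lin n).trace = (fun j => (D.Rᵀ * D.R) j j) ⬝ᵥ n := by
  have := D.trace_lin_mul n 1
  rw [Matrix.mul_one, Matrix.mul_one] at this
  rw [this, dotProduct_comm]
  rfl

open scoped Matrix.Norms.Frobenius in
theorem posSemidef_trace_sub {ι : Type*} [Fintype ι] [DecidableEq ι] {S : Matrix ι ι ℝ}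
    (hS : S.PosSemidef) : (S.trace • (1 : Matrix ι ι ℝ) - S).PosSemidef := by
  obtain ⟨Y, hY, hYS⟩ := hS.exists_sqrt
  have h1 : ‖S‖ ≤ S.trace := by
    have h4 : ‖Y‖ ^ 2 = S.trace := by rw [Matrix.frobenius_sq_eq_trace, hY, hYS]
    rw [← h4, sq, ← hYS]
    exact Matrix.frobenius_norm_mul _ _
  refine Matrix.posSemidef_of_quad (by simp [hS.transpose_eq]) fun x => ?_
  have h2 := (abs_le.1 (Matrix.abs_quad_le S x)).2
  have h3 : 0 ≤ x ⬝ᵥ x := Finset.sum_nonneg fun i _ => mul_self_nonneg _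
  simp only [Matrix.sub_mulVec, Matrix.smul_mulVec, Matrix.one_mulVec, dotProduct_sub,
    dotProduct_smul, smul_eq_mul]
  nlinarith

theorem slack_zero_inv (h : D.lamOne ≠ 0) : (D.slack 0)⁻¹ = (1 / D.lamOne) • 1 := by
  refine Matrix.inv_eq_right_inv ?_
  have : D.lin 0 = 0 := by simp [lin]
  rw [slack_eq, this, zero_add, smul_mul_smul_comm, Matrix.one_mul, mul_one_div_cancel h, one_smul]

theorem gram_zero (h : D.lamOne ≠ 0) (i j : Fin ell) :
    D.gram 0 i j = (D.Rᵀ * D.R) i j / D.lamOne := by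
  rw [gram_eq, slack_zero_inv h]
  simp [div_eq_inv_mul]

theorem posDef_slack_zero (h : 0 < D.lamOne) : (D.slack 0).PosDef := by
  have : D.lin 0 = 0 := by simp [lin]
  rw [slack_eq, this, zero_add]
  exact Matrix.PosDef.one.smul h

theorem posSemidef_lin_add_smul (c : Fin ell → ℝ) (μ : ℝ)
    (h : ∀ x, 0 ≤ x ⬝ᵥ (D.lin c *ᵥ x) + μ * (x ⬝ᵥ x)) : (D.lin c + μ • 1).PosSemidef :=
  Matrix.posSemidef_of_quad (by simp [lin_transpose]) fun x => by
    simpa [Matrix.add_mulVec, Matrix.smul_mulVec] using h x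

section Bounds

variable {om a α : Fin ell → ℝ} {q U U₁ tr t : ℝ} {γ : Fin ell → ℝ}

/-- On directions `n` of barrier norm `1` the matrix `lin n` lies between `-slack γ` and `slack γ`,
so that the positivity of `α` on the feasible set bounds `α` itself. -/
theorem Slater.alpha_le (h : D.Slater om a α q U U₁ tr) (hγ : (D.slack γ).PosDef)
    (n : Fin ell → ℝ) : |α ⬝ᵥ n| ≤ D.barNorm γ n * (α ⬝ᵥ γ + D.lamOne * tr) := by
  set f := D.barNorm γ n with hf
  have key : ∀ m : Fin ell → ℝ, (∀ x, |x ⬝ᵥ (D.lin m *ᵥ x)| ≤ f * (x ⬝ᵥ (D.slack γ *ᵥ x))) →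
      0 ≤ α ⬝ᵥ m + f * (α ⬝ᵥ γ + D.lamOne * tr) := by
    intro m hm
    have h1 : (D.lin (m + f • γ) + (f * D.lamOne) • 1).PosSemidef := by
      refine D.posSemidef_lin_add_smul _ _ fun x => ?_
      have h2 := (abs_le.1 (hm x)).1
      rw [slack_eq] at h2
      simp only [lin_add, lin_smul, Matrix.add_mulVec, Matrix.smul_mulVec, dotProduct_add,
        dotProduct_smul, smul_eq_mul, Matrix.one_mulVec] at h2 ⊢
      linarith
    have h2 := h.trace_le _ _ (mul_nonneg (D.barNorm_nonneg γ n) h.lamOne.le) h1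
    rw [dotProduct_add, dotProduct_smul, smul_eq_mul] at h2
    linarith
  have h1 := key n fun x => abs_lin_quad_le hγ n x
  have h2 := key (-n) fun x => by
    have : D.lin (-n) = -D.lin n := by rw [← neg_one_smul ℝ n, lin_smul, neg_one_smul]
    rw [this, Matrix.neg_mulVec, dotProduct_neg, abs_neg]
    exact abs_lin_quad_le hγ n x
  rw [dotProduct_neg] at h2
  exact abs_le.2 ⟨by linarith, by linarith⟩

theorem Slater.alpha_self_le (h : D.Slater om a α q U U₁ tr) (hγ : (D.slack γ).PosDef) :
    α ⬝ᵥ γ + D.lamOne * tr ≤ tr * ((D.slack γ).trace + D.lamOne) := by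
  have h1 := posSemidef_trace_sub hγ.posSemidef
  have h2 : (D.slack γ).trace • (1 : Matrix (Fin ell) (Fin ell) ℝ) - D.slack γ + D.lamOne • 1 =
      D.lin (-γ) + (D.slack γ).trace • 1 := by
    have : D.lin (-γ) = D.lamOne • 1 - D.slack γ := by
      rw [← neg_one_smul ℝ γ, lin_smul, neg_one_smul, slack_eq]; abel
    rw [this]
    abel
  have h3 := h.trace_le _ _ hγ.posSemidef.trace_nonneg
    (h2 ▸ h1.add (Matrix.PosSemidef.one.smul h.lamOne.le))
  rw [dotProduct_neg] at h3
  linarith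

/-- The initial weight `t` is small. -/
structure SmallWeight (D : DualData ell) (q t : ℝ) : Prop where
  pos : 0 < t
  lamOne : t * (D.lamOne * ell) ≤ 1
  lamTwo : t * D.lamTwo ≤ 1
  q : t * q ^ 2 ≤ D.lamTwo

variable {x : ℝ}

/-- For a small weight, linear forms bounded by the seminorm of `Q` are, after multiplication by the
weight, bounded by the part of the local norm that stems from `Q`; here `x` is a value of the
seminorm. -/
theorem SmallWeight.scaled (h : D.Slater om a α q U U₁ tr) (hs : D.SmallWeight q t) (hx : 0 ≤ x) :
    t / (2 * D.lamTwo) * (q * x) ≤ √(t / (2 * D.lamTwo)) * x ∧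
    t * x ≤ 2 * (√(t / (2 * D.lamTwo)) * x) := by
  have h2 := h.lamTwo
  have ht := hs.pos
  set r := √(t / (2 * D.lamTwo)) with hr
  have hr0 : 0 < r := Real.sqrt_pos.2 (by positivity)
  have hrr : r ^ 2 = t / (2 * D.lamTwo) := Real.sq_sqrt (by positivity)
  have hq0 := h.q_nonneg
  constructor
  · have h1 : r * q ≤ 1 := by
      refine abs_le_of_sq_le_sq' ?_ zero_le_one |>.2
      rw [mul_pow, hrr, one_pow, div_mul_eq_mul_div, div_le_one (by positivity)]
      linarith [hs.q]
    calc t / (2 * D.lamTwo) * (q * x) = (r * q) * (r * x) := by rw [← hrr]; ring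
      _ ≤ 1 * (r * x) := by gcongr
      _ = r * x := one_mul _
  · have h1 : t ≤ 2 * r := by
      refine abs_le_of_sq_le_sq' ?_ (by positivity) |>.2
      have e : t = r ^ 2 * (2 * D.lamTwo) := by rw [hrr]; field_simp
      have h3 : t * (t * D.lamTwo) ≤ t * 1 := mul_le_mul_of_nonneg_left hs.lamTwo ht.le
      have h4 : t * t ≤ t / D.lamTwo := by
        rw [le_div_iff₀ h2]; linarith
      have h5 : (2 * r) ^ 2 = 2 * (t / D.lamTwo) := by
        rw [mul_pow, hrr]; field_simp
      have h6 : 0 ≤ t / D.lamTwo := by positivity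
      rw [h5]
      nlinarith
    calc t * x ≤ 2 * r * x := by gcongr
      _ = _ := by ring

theorem Slater.gradT_zero (h : D.Slater om a α q U U₁ tr) (i : Fin ell) :
    D.gradT t 0 i = t * (a i + α i - 1 / (2 * D.lamTwo) * om i)
      - (D.Rᵀ * D.R) i i / D.lamOne := by
  have h2 := h.lamTwo.ne'
  rw [gradT, gram_zero h.lamOne.ne', h.z]
  simp only [Matrix.mulVec_zero, Pi.zero_apply]
  field_simp
  ring

theorem Slater.gradT_apply (h : D.Slater om a α q U U₁ tr) (i : Fin ell) :
    D.gradT t γ i = t / (2 * D.lamTwo) * (D.Q *ᵥ γ) i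
      + t * (a i + α i - 1 / (2 * D.lamTwo) * om i) - D.gram γ i i := by
  have h2 := h.lamTwo.ne'
  rw [gradT, h.z]
  field_simp
  ring

theorem SmallWeight.om_le (h : D.Slater om a α q U U₁ tr) (hs : D.SmallWeight q t)
    (n : Fin ell → ℝ) : t / (2 * D.lamTwo) * |om ⬝ᵥ n| ≤
      √(t / (2 * D.lamTwo)) * √(n ⬝ᵥ (D.Q *ᵥ n)) :=
  (mul_le_mul_of_nonneg_left (h.om_le n) (h.coeff_nonneg hs.pos.le)).trans
    (hs.scaled h (Real.sqrt_nonneg _)).1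

theorem SmallWeight.a_le (h : D.Slater om a α q U U₁ tr) (hs : D.SmallWeight q t)
    (n : Fin ell → ℝ) : t * |a ⬝ᵥ n| ≤
      2 * U * (√(t / (2 * D.lamTwo)) * √(n ⬝ᵥ (D.Q *ᵥ n))) := by
  have := mul_le_mul_of_nonneg_left (h.a_le n) hs.pos.le
  have := mul_le_mul_of_nonneg_left (hs.scaled h (Real.sqrt_nonneg (n ⬝ᵥ (D.Q *ᵥ n)))).2
    h.U_nonneg
  linarith

theorem SmallWeight.K_le (h : D.Slater om a α q U U₁ tr) (hs : D.SmallWeight q t)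
    (n : Fin ell → ℝ) : t * |(fun j => (D.Rᵀ * D.R) j j) ⬝ᵥ n| ≤
      2 * U₁ * (√(t / (2 * D.lamTwo)) * √(n ⬝ᵥ (D.Q *ᵥ n))) := by
  have := mul_le_mul_of_nonneg_left (h.K_le n) hs.pos.le
  have := mul_le_mul_of_nonneg_left (hs.scaled h (Real.sqrt_nonneg (n ⬝ᵥ (D.Q *ᵥ n)))).2
    h.U₁_nonneg
  linarith

theorem Slater.gradT_zero_dotProduct (h : D.Slater om a α q U U₁ tr) (n : Fin ell → ℝ) :
    D.gradT t 0 ⬝ᵥ n = (t * (a ⬝ᵥ n) + t * (α ⬝ᵥ n) - t / (2 * D.lamTwo) * (om ⬝ᵥ n))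
      - (1 / D.lamOne) * ((fun j => (D.Rᵀ * D.R) j j) ⬝ᵥ n) := by
  simp only [dotProduct, Finset.mul_sum, ← Finset.sum_add_distrib, ← Finset.sum_sub_distrib,
    h.gradT_zero]
  exact Finset.sum_congr rfl fun i _ => by ring

theorem Slater.gradT_dotProduct (h : D.Slater om a α q U U₁ tr) (n : Fin ell → ℝ) :
    D.gradT t γ ⬝ᵥ n = t / (2 * D.lamTwo) * ((D.Q *ᵥ γ) ⬝ᵥ n)
      + (t * (a ⬝ᵥ n) + t * (α ⬝ᵥ n) - t / (2 * D.lamTwo) * (om ⬝ᵥ n))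
      - ∑ i, n i * D.gram γ i i := by
  simp only [dotProduct, Finset.mul_sum, ← Finset.sum_add_distrib, ← Finset.sum_sub_distrib,
    h.gradT_apply]
  exact Finset.sum_congr rfl fun i _ => by ring

theorem trace_slack (γ : Fin ell → ℝ) : (D.slack γ).trace =
    (fun j => (D.Rᵀ * D.R) j j) ⬝ᵥ γ + D.lamOne * ell := by
  rw [slack_eq, Matrix.trace_add, trace_lin]; simp

theorem Valid.sq_locNorm' (h : D.Valid) (ht : 0 ≤ t) (hγ : (D.slack γ).PosDef)
    (n : Fin ell → ℝ) : D.locNorm t γ n ^ 2 =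
      (√(t / (2 * D.lamTwo)) * √(n ⬝ᵥ (D.Q *ᵥ n))) ^ 2 + D.barNorm γ n ^ 2 := by
  rw [h.sq_locNorm ht hγ, mul_pow, Real.sq_sqrt (h.coeff_nonneg ht),
    Real.sq_sqrt (h.Q.quad_nonneg n)]

theorem Valid.qNorm_le (h : D.Valid) (ht : 0 ≤ t) (hγ : (D.slack γ).PosDef)
    (n : Fin ell → ℝ) : √(t / (2 * D.lamTwo)) * √(n ⬝ᵥ (D.Q *ᵥ n)) ≤ D.locNorm t γ n :=
  (abs_le_of_sq_le_sq' (by rw [h.sq_locNorm' ht hγ]; linarith [sq_nonneg (D.barNorm γ n)])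
    (D.locNorm_nonneg t γ n)).2

theorem le_of_sq_le_linear {b u v ρ : ℝ} (hb : 0 ≤ b) (hu : 0 ≤ u) (hv : 1 ≤ v) (hρ : 1 ≤ ρ)
    (h : b ^ 2 ≤ u * b + v * (ρ * ρ)) : b ≤ (u + v) * ρ := by
  by_contra! hlt
  have e1 : ρ ≤ b := by nlinarith [mul_nonneg hu (zero_le_one.trans hρ)]
  have e2 : b * ((u + v) * ρ) < b * b := mul_lt_mul_of_pos_left hlt (by linarith)
  have e3 : u * b ≤ u * b * ρ := le_mul_of_one_le_right (by positivity) hρ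
  have e4 : v * (ρ * ρ) ≤ v * (b * ρ) := by gcongr
  nlinarith

/-- Near the path of the preliminary phase, the test of the gradient with the point `γ` itself
bounds the seminorm of `Q` at `γ`. -/
theorem Slater.seminorm_le (hell : 1 ≤ ell) (h : D.Slater om a α q U U₁ tr)
    (hs : D.SmallWeight q t) (hγ : (D.slack γ).PosDef) {s : ℝ} (hs0 : 0 ≤ s) (hs1 : s ≤ 1)
    (hb : D.DualBound t γ (D.gradT t γ - s • D.gradT t 0) (1 / 8)) :
    √(t / (2 * D.lamTwo)) * √(γ ⬝ᵥ (D.Q *ᵥ γ)) ≤ (6 + 2 * U + tr) * √ell := by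
  have hU := h.U_nonneg
  have htr := h.tr_nonneg
  have ht := hs.pos
  have hl1 := h.lamOne
  have hl2 := h.lamTwo
  have hell1 : (1 : ℝ) ≤ ell := by exact_mod_cast hell
  have hrt : (1 : ℝ) ≤ √ell := Real.one_le_sqrt.2 hell1
  have hrt2 : √(ell : ℝ) * √ell = ell := Real.mul_self_sqrt (by positivity)
  have hb2 : (√(t / (2 * D.lamTwo)) * √(γ ⬝ᵥ (D.Q *ᵥ γ))) ^ 2
      = t / (2 * D.lamTwo) * ((D.Q *ᵥ γ) ⬝ᵥ γ) := by
    rw [mul_pow, Real.sq_sqrt (h.coeff_nonneg ht.le), Real.sq_sqrt (h.Q.quad_nonneg γ),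
      dotProduct_comm]
  have ha := hs.a_le h γ
  have hom := hs.om_le h γ
  have hloc := h.sq_locNorm' ht.le hγ γ
  set b := √(t / (2 * D.lamTwo)) * √(γ ⬝ᵥ (D.Q *ᵥ γ)) with hbdef
  have hb0 : 0 ≤ b := by positivity
  have e1 : 0 ≤ (fun j => (D.Rᵀ * D.R) j j) ⬝ᵥ γ + D.lamOne * ell :=
    trace_slack (D := D) γ ▸ hγ.posSemidef.trace_nonneg
  have e2 : 0 ≤ α ⬝ᵥ γ + D.lamOne * tr := h.trace_le γ D.lamOne hl1.le (D.slack_eq γ ▸ hγ.posSemidef)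
  have hsum := sum_mul_gram_self_eq hγ
  have e5 := barNorm_self_le hγ hl1.le
  have hw0 : 0 ≤ D.lamOne * (D.slack γ)⁻¹.trace := mul_nonneg hl1.le (trace_inv_nonneg hγ)
  set w := D.lamOne * (D.slack γ)⁻¹.trace with hw
  have e3 := (abs_le.1 (hb γ)).2
  have e4 : D.locNorm t γ γ ≤ b + (√ell + w) := by
    refine (abs_le_of_sq_le_sq' ?_ (by positivity)).2
    have e6 := D.barNorm_nonneg γ γ
    have e7 : D.barNorm γ γ ^ 2 ≤ (√ell + w) ^ 2 := pow_le_pow_left₀ e6 e5 2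
    have e8 : 0 ≤ b * (√ell + w) := by positivity
    rw [hloc]
    linarith [add_sq b (√ell + w)]
  rw [sub_dotProduct, smul_dotProduct, h.gradT_dotProduct, h.gradT_zero_dotProduct, hsum, ← hb2,
    smul_eq_mul] at e3
  have f1 : -(2 * U * b) ≤ t * (a ⬝ᵥ γ) := by
    have := mul_le_mul_of_nonneg_left (neg_abs_le (a ⬝ᵥ γ)) ht.le
    linarith
  have f2 : t / (2 * D.lamTwo) * (om ⬝ᵥ γ) ≤ b :=
    (mul_le_mul_of_nonneg_left (le_abs_self _) (h.coeff_nonneg ht.le)).trans hom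
  have f3 : -tr ≤ t * (α ⬝ᵥ γ) := by
    have g1 : t * D.lamOne ≤ 1 := by
      refine le_trans ?_ hs.lamOne
      rw [← mul_assoc]
      exact le_mul_of_one_le_right (by positivity) hell1
    have g2 := mul_nonneg ht.le e2
    have g3 := mul_le_mul_of_nonneg_right g1 htr
    linarith
  have e6 : -(ell : ℝ) ≤ (1 / D.lamOne) * ((fun j => (D.Rᵀ * D.R) j j) ⬝ᵥ γ) := by
    rw [one_div, ← div_eq_inv_mul, le_div_iff₀ hl1]
    linarith
  have hs1' : 0 ≤ 1 - s := by linarith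
  have hUb : 0 ≤ U * b := by positivity
  set X := t * (a ⬝ᵥ γ) + t * (α ⬝ᵥ γ) - t / (2 * D.lamTwo) * (om ⬝ᵥ γ) with hX
  set Y := (1 / D.lamOne) * ((fun j => (D.Rᵀ * D.R) j j) ⬝ᵥ γ) with hY
  have e7 : -(2 * U * b + tr + b) ≤ X := by linarith
  have e8 : -(2 * U * b + tr + b) ≤ (1 - s) * X := by
    have g1 := mul_le_mul_of_nonneg_left e7 hs1'
    have g2 : 0 ≤ s * (2 * U * b + tr + b) := by positivity
    linarith
  have e9 : -(ell : ℝ) ≤ s * Y := by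
    have g1 := mul_le_mul_of_nonneg_left e6 hs0
    have g2 : s * ell ≤ 1 * ell := by gcongr
    linarith
  have g1 : √(ell : ℝ) ≤ ell := by nlinarith
  have g2 : tr ≤ tr * ell := le_mul_of_one_le_right htr hell1
  have e10 : b ^ 2 ≤ (2 + 2 * U) * b + (4 + tr) * (√ell * √ell) := by
    rw [hrt2]
    linarith
  refine (le_of_sq_le_linear hb0 (by positivity) (by linarith) hrt e10).trans (le_of_eq ?_)
  ring

/-- Near the path of the preliminary phase, the dual local norms of the gradient and of the tilt
are bounded. -/
theorem Slater.phase_one (hell : 1 ≤ ell) (h : D.Slater om a α q U U₁ tr)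
    (hs : D.SmallWeight q t) (hγ : (D.slack γ).PosDef) {s : ℝ} (hs0 : 0 ≤ s) (hs1 : s ≤ 1)
    (hb : D.DualBound t γ (D.gradT t γ - s • D.gradT t 0) (1 / 8)) {k m : ℝ}
    (hk : k = 6 + 2 * U + tr) (hm : m = tr * (2 + 2 * U₁ * k)) :
    D.DualBound t γ (D.gradT t γ) ((k + 2 + 2 * U + m) * √ell) ∧
    D.DualBound t γ (D.gradT t 0)
      ((1 + 2 * U + m) * √ell + U₁ / (D.lamOne * √(t / (2 * D.lamTwo)))) := by
  have hU := h.U_nonneg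
  have hU₁ := h.U₁_nonneg
  have htr := h.tr_nonneg
  have ht := hs.pos
  have hl1 := h.lamOne
  have hl2 := h.lamTwo
  have hbk := h.seminorm_le hell hs hγ hs0 hs1 hb
  rw [← hk] at hbk
  have hk0 : 0 < k := by rw [hk]; positivity
  have hm0 : 0 ≤ m := by rw [hm]; positivity
  have ha := hs.a_le h
  have hom := hs.om_le h
  have hKle := hs.K_le h
  have hbn := h.qNorm_le ht.le hγ
  have hfn := h.barNorm_le ht.le hγ
  have hrr : √(t / (2 * D.lamTwo)) ^ 2 = t / (2 * D.lamTwo) := Real.sq_sqrt (by positivity)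
  have hr0 : 0 < √(t / (2 * D.lamTwo)) := Real.sqrt_pos.2 (by positivity)
  set r := √(t / (2 * D.lamTwo)) with hr
  have hrt : (1 : ℝ) ≤ √ell := Real.one_le_sqrt.2 (by exact_mod_cast hell)
  -- the pairing with the positive part of the primal constraint
  have hα : ∀ n, t * |α ⬝ᵥ n| ≤ m * √ell * D.barNorm γ n := by
    intro n
    have e1 := h.alpha_le hγ n
    have e2 := h.alpha_self_le hγ
    have e3 : t * ((D.slack γ).trace + D.lamOne) ≤ (2 + 2 * U₁ * k) * √ell := by
      rw [trace_slack, mul_add, mul_add]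
      have f1 := (mul_le_mul_of_nonneg_left (le_abs_self ((fun j => (D.Rᵀ * D.R) j j) ⬝ᵥ γ))
        ht.le).trans (hKle γ)
      have f2 := mul_le_mul_of_nonneg_left hbk (by positivity : 0 ≤ 2 * U₁)
      have f3 := hs.lamOne
      have f4 : t * D.lamOne ≤ 1 := by
        refine le_trans ?_ f3
        rw [← mul_assoc]
        exact le_mul_of_one_le_right (by positivity) (by exact_mod_cast hell)
      linarith
    have e4 : t * (α ⬝ᵥ γ + D.lamOne * tr) ≤ m * √ell := by
      calc t * (α ⬝ᵥ γ + D.lamOne * tr) ≤ t * (tr * ((D.slack γ).trace + D.lamOne)) := by gcongr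
        _ = tr * (t * ((D.slack γ).trace + D.lamOne)) := by ring
        _ ≤ tr * ((2 + 2 * U₁ * k) * √ell) := by gcongr
        _ = m * √ell := by rw [hm]; ring
    calc t * |α ⬝ᵥ n| ≤ t * (D.barNorm γ n * (α ⬝ᵥ γ + D.lamOne * tr)) := by gcongr
      _ = D.barNorm γ n * (t * (α ⬝ᵥ γ + D.lamOne * tr)) := by ring
      _ ≤ D.barNorm γ n * (m * √ell) :=
          mul_le_mul_of_nonneg_left e4 (D.barNorm_nonneg γ n)
      _ = _ := by ring
  have hcommon : ∀ n, |t * (a ⬝ᵥ n) + t * (α ⬝ᵥ n) - t / (2 * D.lamTwo) * (om ⬝ᵥ n)| ≤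
      (1 + 2 * U + m) * √ell * D.locNorm t γ n := by
    intro n
    have g1 := ha n
    have g2 := hα n
    have g3 := hom n
    have g6 := D.locNorm_nonneg t γ n
    have f1 : |t * (a ⬝ᵥ n) + t * (α ⬝ᵥ n) - t / (2 * D.lamTwo) * (om ⬝ᵥ n)| ≤
        t * |a ⬝ᵥ n| + t * |α ⬝ᵥ n| + t / (2 * D.lamTwo) * |om ⬝ᵥ n| := by
      refine (abs_sub _ _).trans (add_le_add ((abs_add_le _ _).trans (le_of_eq ?_)) (le_of_eq ?_))
      · rw [abs_mul, abs_mul, abs_of_pos ht]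
      · rw [abs_mul, abs_of_pos (by positivity)]
    have f2 : (1 + 2 * U) * (r * √(n ⬝ᵥ (D.Q *ᵥ n))) ≤ (1 + 2 * U) * (√ell * D.locNorm t γ n) :=
      mul_le_mul_of_nonneg_left ((hbn n).trans (le_mul_of_one_le_left g6 hrt)) (by positivity)
    have f3 : m * √ell * D.barNorm γ n ≤ m * √ell * D.locNorm t γ n :=
      mul_le_mul_of_nonneg_left (hfn n) (by positivity)
    linarith
  refine ⟨fun n => ?_, fun n => ?_⟩
  · have f1 : |t / (2 * D.lamTwo) * ((D.Q *ᵥ γ) ⬝ᵥ n)| ≤ k * √ell * D.locNorm t γ n := by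
      have f2 := h.Q.abs_dotProduct_mulVec_le γ n
      rw [Matrix.dotProduct_mulVec_symm h.Q.transpose_eq] at f2
      rw [abs_mul, abs_of_pos (by positivity), ← hrr]
      calc r ^ 2 * |(D.Q *ᵥ γ) ⬝ᵥ n|
          ≤ r ^ 2 * (√(γ ⬝ᵥ (D.Q *ᵥ γ)) * √(n ⬝ᵥ (D.Q *ᵥ n))) := by gcongr
        _ = (r * √(γ ⬝ᵥ (D.Q *ᵥ γ))) * (r * √(n ⬝ᵥ (D.Q *ᵥ n))) := by ring
        _ ≤ k * √ell * D.locNorm t γ n :=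
          mul_le_mul hbk (hbn n) (by positivity) (by positivity)
    have f2 : |∑ i, n i * D.gram γ i i| ≤ √ell * D.locNorm t γ n :=
      (abs_sum_mul_gram_self_le hγ n).trans
        (mul_le_mul_of_nonneg_left (hfn n) (Real.sqrt_nonneg _))
    have f3 := hcommon n
    rw [h.gradT_dotProduct]
    refine (abs_sub _ _).trans ((add_le_add_left (abs_add_le _ _) _).trans ?_)
    linarith
  · rw [h.gradT_zero_dotProduct]
    have f1 : |1 / D.lamOne * ((fun j => (D.Rᵀ * D.R) j j) ⬝ᵥ n)| ≤
        U₁ / (D.lamOne * r) * D.locNorm t γ n := by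
      rw [abs_mul, abs_of_pos (by positivity)]
      calc 1 / D.lamOne * |(fun j => (D.Rᵀ * D.R) j j) ⬝ᵥ n|
          ≤ 1 / D.lamOne * (U₁ * √(n ⬝ᵥ (D.Q *ᵥ n))) :=
            mul_le_mul_of_nonneg_left (h.K_le n) (by positivity)
        _ = U₁ / (D.lamOne * r) * (r * √(n ⬝ᵥ (D.Q *ᵥ n))) := by field_simp
        _ ≤ U₁ / (D.lamOne * r) * D.locNorm t γ n :=
            mul_le_mul_of_nonneg_left (hbn n) (by positivity)
    refine (abs_sub _ _).trans ((add_le_add (hcommon n) f1).trans (le_of_eq ?_))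
    ring

end Bounds

end DualData

/-! ### The iteration -/

/-- The variables of the iteration: the dual point, the weight `t = ℓ / δ` and the tilt. -/
structure Iter (ell : ℕ) where
  γ : Fin ell → ℝ
  t : ℝ
  s : ℝ

namespace Iter

variable {ell : ℕ}

/-- The weight of the next step: unchanged in the preliminary phase, larger by the factor
`1 + 1 / (16 √ℓ)` afterwards. -/
def nextT (x : Iter ell) : ℝ :=
  open Classical in if 0 < x.s then x.t else x.t * (1 + 1 / (16 * √ell))

/-- The tilt of the next step, for a direction `e` of dual local norm `nrm`: it decreases by
`1 / (8 * nrm)`, but not below zero. -/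
def nextS (x : Iter ell) (nrm : ℝ) : ℝ :=
  open Classical in if 1 / 8 < x.s * nrm then x.s - 1 / 8 / nrm else 0

/-- A solution of the Newton system with matrix `H` and right-hand side `-g`. -/
def newtonDir (H : Matrix (Fin ell) (Fin ell) ℝ) (g : Fin ell → ℝ) : Fin ell → ℝ :=
  -(ginv H *ᵥ g)

/-- One round: choose the next weight and tilt, and take a damped Newton step. `H` and `g` are the
Hessian and the gradient of the barrier function at `x.γ` as functions of the weight, `e` is the
direction of the tilt. -/
def next (H : ℝ → Matrix (Fin ell) (Fin ell) ℝ) (g : ℝ → Fin ell → ℝ) (e : Fin ell → ℝ)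
    (x : Iter ell) : Iter ell :=
  let t := x.nextT
  let s := x.nextS √(e ⬝ᵥ (ginv (H t) *ᵥ e))
  let r := g t - s • e
  let p := newtonDir (H t) r
  ⟨x.γ + (1 / (1 + √(-(r ⬝ᵥ p)))) • p, t, s⟩

end Iter

namespace DualData

variable {ell : ℕ} {D : DualData ell}

/-- The invariant of the iteration: `x.γ` is close to the minimizer of the tilted barrier
function. -/
structure Near (D : DualData ell) (t₀ : ℝ) (x : Iter ell) : Prop where
  posDef : (D.slack x.γ).PosDef
  t_pos : 0 < x.t
  s_nonneg : 0 ≤ x.s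
  s_le : x.s ≤ 1
  t_eq : 0 < x.s → x.t = t₀
  bound : D.DualBound x.t x.γ (D.gradT x.t x.γ - x.s • D.gradT t₀ 0) (1 / 8)

theorem near_start (hD : D.Valid) {t₀ : ℝ} (ht : 0 < t₀) : D.Near t₀ ⟨0, t₀, 1⟩ where
  posDef := posDef_slack_zero hD.lamOne
  t_pos := ht
  s_nonneg := zero_le_one
  s_le := le_rfl
  t_eq := fun _ => rfl
  bound := fun n => by
    simp only [one_smul, sub_self, zero_dotProduct, abs_zero]
    exact mul_nonneg (by norm_num) (D.locNorm_nonneg _ _ _)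

theorem Near.newtonDir (hD : D.Valid) {t c : ℝ} {γ g : Fin ell → ℝ} (ht : 0 ≤ t)
    (hγ : (D.slack γ).PosDef) (hc : 0 ≤ c) (h : D.DualBound t γ g c) :
    D.hessT t γ *ᵥ Iter.newtonDir (D.hessT t γ) g = -g ∧
      D.locNorm t γ (Iter.newtonDir (D.hessT t γ) g) ≤ c := by
  obtain ⟨h1, -, -⟩ := hD.dualBound_ginv ht hγ (isGinv_ginv (hD.posSemidef_hessT ht hγ)) h hc
  have h2 : D.hessT t γ *ᵥ Iter.newtonDir (D.hessT t γ) g = -g := by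
    rw [Iter.newtonDir, Matrix.mulVec_neg, h1]
  refine ⟨h2, DualBound.locNorm_le ?_ hc⟩
  rw [h2]
  intro n
  rw [neg_dotProduct, abs_neg]
  exact h n

/-- The properties of a round of the iteration, apart from the invariant: it is a damped Newton
step, and the weight and the tilt make progress; `k * √ℓ` and `P` bound the dual local norms of the
gradient and of the direction of the tilt. -/
structure Progress (D : DualData ell) (t₀ k P : ℝ) (x y : Iter ell) : Prop where
  newton : ∃ p, D.hessT y.t x.γ *ᵥ p = -(D.gradT y.t x.γ - y.s • D.gradT t₀ 0) ∧
    y.γ = x.γ + (1 / (1 + √(-((D.gradT y.t x.γ - y.s • D.gradT t₀ 0) ⬝ᵥ p)))) • p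
  s_le : y.s ≤ x.s
  t_le : x.t ≤ y.t
  of_pos : 0 < x.s → y.t = x.t ∧
    (y.s = 0 ∨ (y.s ≤ (1 - 1 / (8 * (k * √ell))) * x.s ∧ 1 / (8 * P) < x.s))
  of_zero : x.s = 0 → y.s = 0 ∧ y.t = x.t * (1 + 1 / (16 * √ell))

/-- A round of the iteration, for the data of the dual problem. -/
def next (D : DualData ell) (t₀ : ℝ) (x : Iter ell) : Iter ell :=
  x.next (fun t => D.hessT t x.γ) (fun t => D.gradT t x.γ) (D.gradT t₀ 0)

theorem Near.next (hell : 1 ≤ ell) (hD : D.Valid) {t₀ k P : ℝ} (hk : 0 < k) (hP : 0 < P)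
    {x : Iter ell} (h : D.Near t₀ x)
    (h1 : 0 < x.s → D.DualBound x.t x.γ (D.gradT x.t x.γ) (k * √ell - 1 / 8))
    (h2 : 0 < x.s → D.DualBound x.t x.γ (D.gradT t₀ 0) P) :
    D.Near t₀ (D.next t₀ x) ∧ D.Progress t₀ k P x (D.next t₀ x) := by
  have hrt : (1 : ℝ) ≤ √ell := Real.one_le_sqrt.2 (by exact_mod_cast hell)
  set e := D.gradT t₀ 0 with he
  set t := x.nextT with ht
  set nrm := √(e ⬝ᵥ (ginv (D.hessT t x.γ) *ᵥ e)) with hnrm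
  set s := x.nextS nrm with hs
  have hxt := h.t_pos
  -- the new weight and tilt
  have main : 0 < t ∧ 0 ≤ s ∧ s ≤ x.s ∧ x.t ≤ t ∧ (0 < s → t = t₀) ∧
      D.DualBound t x.γ (D.gradT t x.γ - s • e) (1 / 4) ∧
      (0 < x.s → t = x.t ∧ (s = 0 ∨ (s ≤ (1 - 1 / (8 * (k * √ell))) * x.s ∧ 1 / (8 * P) < x.s))) ∧
      (x.s = 0 → s = 0 ∧ t = x.t * (1 + 1 / (16 * √ell))) := by
    rcases h.s_nonneg.eq_or_lt with h0 | h0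
    · have hs0 : s = 0 := by
        rw [hs, Iter.nextS, ← h0, zero_mul, if_neg (by norm_num)]
      have ht0 : t = x.t * (1 + 1 / (16 * √ell)) := by
        rw [ht, Iter.nextT, if_neg (by rw [← h0]; exact lt_irrefl 0)]
      have hε : (0 : ℝ) ≤ 1 / (16 * √ell) := by positivity
      refine ⟨by rw [ht0]; positivity, hs0.ge, by rw [hs0, h0], ?_, fun h => ?_, ?_, fun h => ?_,
        fun _ => ⟨hs0, ht0⟩⟩
      · rw [ht0]; exact le_mul_of_one_le_right hxt.le (by linarith)
      · rw [hs0] at h; exact absurd h (lt_irrefl 0)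
      · have hb := h.bound
        rw [← h0, zero_smul, sub_zero] at hb
        have := hD.dualBound_increase hxt.le h.posDef (by norm_num) hε hb
        rw [hs0, zero_smul, sub_zero, ht0]
        refine this.mono ?_
        have e1 : 1 / (16 * √(ell : ℝ)) * √ell = 1 / 16 := by field_simp
        have e2 : 1 / (16 * √(ell : ℝ)) ≤ 1 / 16 := by
          rw [← e1]; exact le_mul_of_one_le_right hε hrt
        rw [e1]
        linarith
      · rw [← h0] at h; exact absurd h (lt_irrefl 0)
    · have ht0 : t = x.t := by rw [ht, Iter.nextT, if_pos h0]
      have hb := h.bound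
      have hG := isGinv_ginv (hD.posSemidef_hessT hxt.le h.posDef)
      obtain ⟨-, g1, g2⟩ := hD.dualBound_ginv hxt.le h.posDef hG (h2 h0) hP.le
      rw [← ht0, ← hnrm] at g1 g2
      -- the dual norm of `s • e` is that of a difference of gradients
      have g3 : x.s * nrm ≤ k * √ell := by
        have e1 : D.DualBound x.t x.γ (x.s • e) (k * √ell) := by
          have e2 : x.s • e = D.gradT x.t x.γ + (-1 : ℝ) • (D.gradT x.t x.γ - x.s • e) := by
            rw [neg_one_smul]; abel
          rw [e2]
          refine ((h1 h0).add (hb.smul (-1))).mono ?_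
          norm_num
        obtain ⟨-, -, e3⟩ := hD.dualBound_ginv hxt.le h.posDef hG e1 (by positivity)
        have e4 : √((x.s • e) ⬝ᵥ (ginv (D.hessT x.t x.γ) *ᵥ (x.s • e))) = x.s * nrm := by
          rw [Matrix.mulVec_smul, smul_dotProduct, dotProduct_smul, smul_eq_mul, smul_eq_mul,
            ← mul_assoc, ← sq, Real.sqrt_mul (sq_nonneg _), Real.sqrt_sq h0.le, hnrm, ht0]
        rwa [e4] at e3
      have hnn : 0 ≤ nrm := Real.sqrt_nonneg _
      have hst : 0 ≤ s ∧ x.s - s ≥ 0 ∧ (x.s - s) * nrm ≤ 1 / 8 ∧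
          (s = 0 ∨ (s ≤ (1 - 1 / (8 * (k * √ell))) * x.s ∧ 1 / (8 * P) < x.s)) := by
        by_cases hc : 1 / 8 < x.s * nrm
        · have hs0 : s = x.s - 1 / 8 / nrm := by rw [hs, Iter.nextS, if_pos hc]
          have hn : 0 < nrm := by
            rcases hnn.eq_or_lt with h | h
            · rw [← h] at hc; norm_num at hc
            · exact h
          have hdiv : 0 < 1 / 8 / nrm := by positivity
          refine ⟨?_, ?_, ?_, .inr ⟨?_, ?_⟩⟩
          · rw [hs0, sub_nonneg, div_le_iff₀ hn]; exact hc.le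
          · rw [hs0]; linarith
          · rw [hs0, sub_sub_cancel, div_mul_cancel₀ _ hn.ne']
          · have : 1 / (8 * (k * √ell)) * x.s ≤ 1 / 8 / nrm := by
              rw [div_mul_eq_mul_div, one_mul, div_div, div_le_div_iff₀ (by positivity)
                (by positivity)]
              linarith
            rw [hs0]
            linarith
          · rw [div_lt_iff₀ (by positivity)]
            have := mul_le_mul_of_nonneg_left g2 h0.le
            linarith
        · have hs0 : s = 0 := by rw [hs, Iter.nextS, if_neg hc]
          refine ⟨hs0.ge, by rw [hs0]; linarith, ?_, .inl hs0⟩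
          rw [hs0, sub_zero]; exact not_lt.1 hc
      refine ⟨ht0 ▸ hxt, hst.1, by linarith [hst.2.1], ht0.ge, fun _ => ht0.trans (h.t_eq h0), ?_,
        fun _ => ⟨ht0, hst.2.2.2⟩, fun h => absurd h h0.ne'⟩
      have e1 : D.gradT t x.γ - s • e = (D.gradT t x.γ - x.s • e) + (x.s - s) • e := by
        rw [sub_smul]; abel
      rw [e1]
      refine DualBound.mono (DualBound.add (by rw [ht0]; exact hb) (g1.smul (x.s - s))) ?_
      rw [abs_of_nonneg hst.2.1]
      linarith [hst.2.2.1]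
  obtain ⟨m1, m2, m3, m4, m5, m6, m7, m8⟩ := main
  obtain ⟨n1, n2⟩ := Near.newtonDir hD m1.le h.posDef (by norm_num) m6
  set p := Iter.newtonDir (D.hessT t x.γ) (D.gradT t x.γ - s • e) with hp
  have hy : D.next t₀ x = ⟨x.γ + (1 / (1 + √(-((D.gradT t x.γ - s • e) ⬝ᵥ p)))) • p, t, s⟩ := rfl
  rw [hy]
  have n3 := neg_dotProduct_newton n1
  obtain ⟨k1, k2⟩ := hD.newton m1.le h.posDef n1
  refine ⟨⟨?_, m1, m2, m3.trans h.s_le, m5, ?_⟩, ⟨p, n1, rfl⟩, m3, m4, m7, m8⟩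
  · simp only [n3]; exact k1
  · simp only [n3]
    refine k2.mono ?_
    have := D.locNorm_nonneg t x.γ p
    nlinarith

end DualData

/-! ### The number of iterations -/

/-- A sequence of tilts that decreases geometrically and then stops, followed by geometrically
increasing weights. -/
theorem exists_stop {s t : ℕ → ℝ} {ρ P ε t₀ Tf : ℝ} (hs : s 0 = 1) (hs0 : ∀ k, 0 ≤ s k)
    (hρ : 0 < ρ) (hρ1 : ρ ≤ 1) (hP : 0 < P) (hε : 0 < ε) (hε1 : ε ≤ 1) (ht₀ : 0 < t₀) (hTf : 0 < Tf)
    (h1 : ∀ k, 0 < s k → s (k + 1) = 0 ∨ (s (k + 1) ≤ (1 - ρ) * s k ∧ 1 / P < s k))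
    (h2 : ∀ k, s k = 0 → s (k + 1) = 0 ∧ t (k + 1) = t k * (1 + ε)) (h3 : ∀ k, t₀ ≤ t k) :
    ∃ N : ℕ, (N : ℝ) ≤ |Real.log P| / ρ + 2 * |Real.log (Tf / t₀)| / ε + 3 ∧
      s N = 0 ∧ Tf ≤ t N := by
  obtain ⟨N₁, hN₁, hz⟩ : ∃ N : ℕ, (N : ℝ) ≤ |Real.log P| / ρ + 2 ∧ s N = 0 := by
    set n := ⌈|Real.log P| / ρ⌉₊ with hn
    have hn1 : |Real.log P| / ρ ≤ n := Nat.le_ceil _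
    have hn2 : (n : ℝ) < |Real.log P| / ρ + 1 := Nat.ceil_lt_add_one (by positivity)
    by_contra! hcon
    have hne : ∀ k ≤ n + 1, 0 < s k := fun k hk => by
      refine (hs0 k).lt_of_ne' (hcon k ?_)
      have : (k : ℝ) ≤ n + 1 := by exact_mod_cast hk
      linarith
    have hgeo : ∀ k ≤ n, s k ≤ (1 - ρ) ^ k := by
      intro k
      induction k with
      | zero => intro _; simp [hs]
      | succ k ih =>
        intro hk
        rcases h1 k (hne k (by lia)) with h | h
        · exact absurd h (hne (k + 1) (by lia)).ne'
        · rw [pow_succ']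
          exact h.1.trans (mul_le_mul_of_nonneg_left (ih (by lia)) (by linarith))
    rcases h1 n (hne n (by lia)) with h | h
    · exact (hne (n + 1) le_rfl).ne' h
    · have h4 : (1 - ρ) ^ n ≤ Real.exp (-(ρ * n)) := by
        have : 1 - ρ ≤ Real.exp (-ρ) := by linarith [Real.add_one_le_exp (-ρ)]
        calc (1 - ρ) ^ n ≤ Real.exp (-ρ) ^ n := pow_le_pow_left₀ (by linarith) this n
          _ = Real.exp (-(ρ * n)) := by rw [← Real.exp_nat_mul]; ring_nf
      have h5 : Real.exp (-(ρ * n)) ≤ 1 / P := by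
        rw [one_div, ← Real.exp_log hP, ← Real.exp_neg]
        refine Real.exp_le_exp.2 (neg_le_neg ((le_abs_self _).trans ?_))
        rw [div_le_iff₀ hρ] at hn1
        linarith
      linarith [hgeo n le_rfl, h.2]
  set n := ⌈2 * |Real.log (Tf / t₀)| / ε⌉₊ with hn
  have hn1 : 2 * |Real.log (Tf / t₀)| / ε ≤ n := Nat.le_ceil _
  have hn2 : (n : ℝ) < 2 * |Real.log (Tf / t₀)| / ε + 1 := Nat.ceil_lt_add_one (by positivity)
  have hiter : ∀ j, s (N₁ + j) = 0 ∧ t (N₁ + j) = t N₁ * (1 + ε) ^ j := by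
    intro j
    induction j with
    | zero => simp [hz]
    | succ j ih =>
      obtain ⟨k1, k2⟩ := h2 _ ih.1
      exact ⟨k1, by rw [← add_assoc, k2, ih.2, pow_succ]; ring⟩
  refine ⟨N₁ + n, by push_cast; linarith, (hiter n).1, ?_⟩
  rw [(hiter n).2]
  have h4 : ε / 2 ≤ Real.log (1 + ε) := by
    refine le_trans ?_ (Real.one_sub_inv_le_log_of_pos (by linarith))
    have : 1 - (1 + ε)⁻¹ = ε / (1 + ε) := by field_simp; ring
    rw [this]
    exact div_le_div_of_nonneg_left hε.le (by linarith) (by linarith)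
  have h5 : Tf / t₀ ≤ (1 + ε) ^ n := by
    rw [← Real.exp_log (show 0 < Tf / t₀ by positivity),
      ← Real.exp_log (show 0 < (1 + ε) ^ n by positivity), Real.log_pow]
    refine Real.exp_le_exp.2 ((le_abs_self _).trans ?_)
    rw [div_le_iff₀ hε] at hn1
    have := mul_le_mul_of_nonneg_left h4 (Nat.cast_nonneg (α := ℝ) n)
    linarith
  rw [div_le_iff₀ ht₀] at h5
  calc Tf ≤ (1 + ε) ^ n * t₀ := h5
    _ ≤ (1 + ε) ^ n * t N₁ := by gcongr; exact h3 N₁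
    _ = t N₁ * (1 + ε) ^ n := mul_comm _ _

/-! ### Formulas in terms of the kernel matrix alone -/

section KernelMatrix

variable {ell : ℕ}

/-- The slack matrix, compressed to the span of the features: `Rᵀ * slack γ * R` for `Rᵀ * R = K`,
written in terms of the kernel matrix `K`. -/
def kerSlack (K : Matrix (Fin ell) (Fin ell) ℝ) (lam : ℝ) (γ : Fin ell → ℝ) :
    Matrix (Fin ell) (Fin ell) ℝ :=
  lam • K + K * Matrix.diagonal γ * K

/-- The matrix `DualData.gram`, written in terms of the kernel matrix. -/
def kerGram (K : Matrix (Fin ell) (Fin ell) ℝ) (lam : ℝ) (γ : Fin ell → ℝ) :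
    Matrix (Fin ell) (Fin ell) ℝ :=
  K * ginv (kerSlack K lam γ) * K

/-- The coefficients of the primal operator that belongs to the dual point `γ` and to the Newton
direction `p` for the weight `t`. -/
def primalCoeff (K : Matrix (Fin ell) (Fin ell) ℝ) (lam : ℝ) (γ p : Fin ell → ℝ) (t : ℝ) :
    Matrix (Fin ell) (Fin ell) ℝ :=
  (1 / t) • (ginv (kerSlack K lam γ) -
    ginv (kerSlack K lam γ) * K * Matrix.diagonal p * K * ginv (kerSlack K lam γ))

theorem Matrix.eq_zero_of_transpose_mul_self_mul {l m n : Type*} [Fintype l] [Fintype m]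
    [Fintype n] {A : Matrix l m ℝ} {B : Matrix m n ℝ} (h : Aᵀ * (A * B) = 0) : A * B = 0 := by
  rw [← Matrix.mul_assoc, ← Matrix.conjTranspose_eq_transpose_of_trivial] at h
  exact (Matrix.conjTranspose_mul_self_mul_eq_zero A B).1 h

namespace DualData

variable {D : DualData ell} {K : Matrix (Fin ell) (Fin ell) ℝ} {γ p : Fin ell → ℝ} {t : ℝ}

theorem kerSlack_eq (hK : D.Rᵀ * D.R = K) (γ : Fin ell → ℝ) :
    kerSlack K D.lamOne γ = D.Rᵀ * D.slack γ * D.R := by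
  rw [slack_eq, lin_eq, ← hK, kerSlack]
  simp only [Matrix.mul_add, Matrix.add_mul, Matrix.mul_smul, Matrix.smul_mul, Matrix.mul_one,
    Matrix.mul_assoc]
  rw [add_comm]

theorem posSemidef_kerSlack (hK : D.Rᵀ * D.R = K) (hγ : (D.slack γ).PosDef) :
    (kerSlack K D.lamOne γ).PosSemidef := by
  rw [kerSlack_eq hK, ← Matrix.conjTranspose_eq_transpose_of_trivial]
  exact hγ.posSemidef.conjTranspose_mul_mul_same D.R

theorem mul_ginv_kerSlack (hK : D.Rᵀ * D.R = K) (hγ : (D.slack γ).PosDef) :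
    D.R * ginv (kerSlack K D.lamOne γ) * D.Rᵀ * D.slack γ * D.R = D.R := by
  obtain ⟨Y, hY, hYS⟩ := hγ.posSemidef.exists_sqrt
  have hG := isGinv_ginv (posSemidef_kerSlack hK hγ)
  set G := ginv (kerSlack K D.lamOne γ)
  set S := D.slack γ
  have h1 := hG.right
  rw [kerSlack_eq hK] at h1
  set Z := G * (D.Rᵀ * S * D.R) - 1 with hZ
  have h2 : D.Rᵀ * S * D.R * Z = 0 := by
    rw [hZ, Matrix.mul_sub, Matrix.mul_one, ← Matrix.mul_assoc, h1, sub_self]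
  have h3 : (Y * D.R)ᵀ * ((Y * D.R) * Z) = 0 := by
    rw [Matrix.transpose_mul, hY, ← h2, ← hYS]
    simp only [Matrix.mul_assoc]
  have h4 : S * (D.R * Z) = 0 := by
    rw [← hYS, Matrix.mul_assoc, ← Matrix.mul_assoc Y D.R,
      Matrix.eq_zero_of_transpose_mul_self_mul h3, Matrix.mul_zero]
  have h5 : D.R * Z = 0 := by
    have := congrArg (S⁻¹ * ·) h4
    simpa [← Matrix.mul_assoc, Matrix.nonsing_inv_mul _ hγ.det_pos.ne'.isUnit] using this
  rw [hZ, Matrix.mul_sub, Matrix.mul_one, sub_eq_zero] at h5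
  simpa [Matrix.mul_assoc] using h5

theorem kerGram_eq (hK : D.Rᵀ * D.R = K) (hγ : (D.slack γ).PosDef) :
    kerGram K D.lamOne γ = D.Rᵀ * (D.slack γ)⁻¹ * D.R := by
  have hG := isGinv_ginv (posSemidef_kerSlack hK hγ)
  have h1 := mul_ginv_kerSlack hK hγ
  rw [kerGram]
  set G := ginv (kerSlack K D.lamOne γ)
  have hST := D.slack_transpose γ
  have h2 : D.Rᵀ * (D.slack γ * (D.R * G * D.Rᵀ)) = D.Rᵀ := by
    have := congrArg Matrix.transpose h1
    simpa [Matrix.transpose_mul, hST, hG.symm, Matrix.mul_assoc] using this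
  set W := D.R * G * D.Rᵀ with hW
  have hS : D.slack γ = D.R * Matrix.diagonal γ * D.Rᵀ + D.lamOne • 1 := by
    rw [slack_eq, lin_eq]
  set S := D.slack γ
  have h3 : S * W * D.R - D.R =
      D.R * (Matrix.diagonal γ * D.Rᵀ * W * D.R + D.lamOne • (G * D.Rᵀ * D.R) - 1) := by
    rw [hS]
    simp only [Matrix.mul_add, Matrix.add_mul, Matrix.mul_sub, Matrix.smul_mul, Matrix.mul_smul,
      Matrix.one_mul, Matrix.mul_one, Matrix.mul_assoc, hW]
  have h4 : S * W * D.R = D.R := by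
    rw [← sub_eq_zero, h3]
    refine Matrix.eq_zero_of_transpose_mul_self_mul ?_
    rw [← h3, Matrix.mul_sub, sub_eq_zero, ← Matrix.mul_assoc, h2]
  have h5 : W * D.R = S⁻¹ * D.R := by
    have := congrArg (S⁻¹ * ·) h4
    simpa [← Matrix.mul_assoc, Matrix.nonsing_inv_mul _ hγ.det_pos.ne'.isUnit] using this
  rw [Matrix.mul_assoc D.Rᵀ, ← h5, hW, ← hK]
  simp only [Matrix.mul_assoc]

theorem kerGram_apply (hK : D.Rᵀ * D.R = K) (hγ : (D.slack γ).PosDef) (i j : Fin ell) :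
    kerGram K D.lamOne γ i j = D.gram γ i j := by
  rw [kerGram_eq hK hγ, gram_eq]

/-- The trace of a generalized inverse against its matrix is a rank. -/
theorem trace_ginv_mul_le (hK : D.Rᵀ * D.R = K) (hγ : (D.slack γ).PosDef) :
    (ginv (kerSlack K D.lamOne γ) * kerSlack K D.lamOne γ).trace ≤ ell := by
  obtain ⟨Y, hY, hYS⟩ := hγ.posSemidef.exists_sqrt
  have hG := isGinv_ginv (posSemidef_kerSlack hK hγ)
  have hT := kerSlack_eq hK γ
  set G := ginv (kerSlack K D.lamOne γ)
  have h1 := hG.left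
  rw [hT, ← hYS] at h1
  rw [hT, ← hYS]
  -- a symmetric idempotent with the same trace
  set P := Y * D.R * G * D.Rᵀ * Y with hP
  have h2 : P * P = P := by
    have := congrArg (fun A => Y * D.R * A * D.Rᵀ * Y) h1
    simpa only [hP, Matrix.mul_assoc] using this
  have h3 : Pᵀ = P := by
    simp only [hP, Matrix.transpose_mul, hY, hG.symm, Matrix.transpose_transpose, Matrix.mul_assoc]
  have h4 : (G * (D.Rᵀ * (Y * Y) * D.R)).trace = P.trace := by
    calc (G * (D.Rᵀ * (Y * Y) * D.R)).trace = ((G * D.Rᵀ * Y) * (Y * D.R)).trace := by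
          simp only [Matrix.mul_assoc]
      _ = ((Y * D.R) * (G * D.Rᵀ * Y)).trace := Matrix.trace_mul_comm _ _
      _ = P.trace := by simp only [hP, Matrix.mul_assoc]
  rw [h4, Matrix.trace]
  have h5 : ∀ i, P i i ≤ 1 := by
    intro i
    have e1 : P i i = ∑ j, P i j ^ 2 := by
      conv_lhs => rw [← h2, Matrix.mul_apply]
      refine Finset.sum_congr rfl fun j _ => ?_
      rw [sq, ← Matrix.transpose_apply P i j, h3]
    have e2 : P i i ^ 2 ≤ ∑ j, P i j ^ 2 :=
      Finset.single_le_sum (f := fun j => P i j ^ 2) (fun j _ => sq_nonneg _) (Finset.mem_univ i)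
    nlinarith
  calc ∑ i, P.diag i ≤ ∑ i : Fin ell, (1 : ℝ) := Finset.sum_le_sum fun i _ => h5 i
    _ = ell := by simp

theorem primalCoeff_transpose (hK : D.Rᵀ * D.R = K) (hγ : (D.slack γ).PosDef) :
    (primalCoeff K D.lamOne γ p t)ᵀ = primalCoeff K D.lamOne γ p t := by
  have hG := isGinv_ginv (posSemidef_kerSlack hK hγ)
  have hKt : Kᵀ = K := by rw [← hK, Matrix.transpose_mul, Matrix.transpose_transpose]
  simp [primalCoeff, Matrix.transpose_mul, hG.symm, hKt, Matrix.mul_assoc]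

theorem posSemidef_primalCoeff (hK : D.Rᵀ * D.R = K) (hγ : (D.slack γ).PosDef) (ht : 0 < t)
    (hp : D.barNorm γ p ≤ 1) : (primalCoeff K D.lamOne γ p t).PosSemidef := by
  have hG := isGinv_ginv (posSemidef_kerSlack hK hγ)
  have hKt : Kᵀ = K := by rw [← hK, Matrix.transpose_mul, Matrix.transpose_transpose]
  refine Matrix.posSemidef_of_quad (primalCoeff_transpose hK hγ) fun x => ?_
  rw [primalCoeff]
  set T := kerSlack K D.lamOne γ with hTdef
  set G := ginv T with hGdef
  have h1 : G - G * K * Matrix.diagonal p * K * G =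
      (D.R * G)ᵀ * (D.slack γ - D.lin p) * (D.R * G) := by
    have e1 : G * T * G = G := hG.left
    have e2 : T = D.Rᵀ * D.slack γ * D.R := kerSlack_eq hK γ
    rw [Matrix.transpose_mul, hG.symm, Matrix.mul_sub, Matrix.sub_mul]
    congr 1
    · refine e1.symm.trans ?_
      rw [e2]
      simp only [Matrix.mul_assoc]
    · rw [lin_eq, ← hK]
      simp only [Matrix.mul_assoc]
  have h2 : x ⬝ᵥ ((D.R * G)ᵀ * (D.slack γ - D.lin p) * (D.R * G)) *ᵥ x =
      ((D.R * G) *ᵥ x) ⬝ᵥ ((D.slack γ - D.lin p) *ᵥ ((D.R * G) *ᵥ x)) := by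
    rw [← Matrix.mulVec_mulVec, ← Matrix.mulVec_mulVec, Matrix.dotProduct_mulVec,
      Matrix.vecMul_transpose]
  rw [Matrix.smul_mulVec, dotProduct_smul, h1, h2, smul_eq_mul]
  set y := (D.R * G) *ᵥ x
  have h3 := (abs_le.1 (abs_lin_quad_le hγ p y)).2
  have h4 := hγ.posSemidef.quad_nonneg y
  rw [Matrix.sub_mulVec, dotProduct_sub]
  have : 0 ≤ 1 / t := by positivity
  refine mul_nonneg this ?_
  nlinarith

theorem mul_primalCoeff_mul_diag (hK : D.Rᵀ * D.R = K) (hγ : (D.slack γ).PosDef) (j : Fin ell) :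
    (K * primalCoeff K D.lamOne γ p t * K) j j =
      (1 / t) * (D.gram γ j j - ∑ i, D.gram γ j i ^ 2 * p i) := by
  have h1 : K * primalCoeff K D.lamOne γ p t * K =
      (1 / t) • (kerGram K D.lamOne γ - kerGram K D.lamOne γ * Matrix.diagonal p *
        kerGram K D.lamOne γ) := by
    simp only [primalCoeff, kerGram, Matrix.mul_smul, Matrix.smul_mul, Matrix.mul_sub,
      Matrix.sub_mul, Matrix.mul_assoc]
  rw [h1, Matrix.smul_apply, Matrix.sub_apply, Matrix.mul_apply, smul_eq_mul,
    kerGram_apply hK hγ]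
  congr 2
  refine Finset.sum_congr rfl fun i _ => ?_
  rw [Matrix.mul_diagonal, kerGram_apply hK hγ, kerGram_apply hK hγ, D.gram_symm γ i j]
  ring

theorem trace_primalCoeff_mul_le (hell : 1 ≤ ell) (hK : D.Rᵀ * D.R = K)
    (hγ : (D.slack γ).PosDef) (ht : 0 < t) (hp : D.barNorm γ p ≤ 1 / 8) :
    (primalCoeff K D.lamOne γ p t * kerSlack K D.lamOne γ).trace ≤ (9 / 8) * ell / t := by
  have hG := isGinv_ginv (posSemidef_kerSlack hK hγ)
  have h1 := trace_ginv_mul_le hK hγ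
  have h2 : (primalCoeff K D.lamOne γ p t * kerSlack K D.lamOne γ).trace = (1 / t) *
      ((ginv (kerSlack K D.lamOne γ) * kerSlack K D.lamOne γ).trace
        - ∑ j, p j * D.gram γ j j) := by
    rw [primalCoeff]
    have hM : ∑ j, p j * D.gram γ j j = (kerGram K D.lamOne γ * Matrix.diagonal p).trace := by
      rw [Matrix.trace]
      refine Finset.sum_congr rfl fun j _ => ?_
      rw [Matrix.diag_apply, Matrix.mul_diagonal, kerGram_apply hK hγ, mul_comm]
    rw [hM, kerGram]
    set T := kerSlack K D.lamOne γ
    set G := ginv T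
    rw [Matrix.smul_mul, Matrix.trace_smul, smul_eq_mul, Matrix.sub_mul, Matrix.trace_sub]
    congr 2
    calc (G * K * Matrix.diagonal p * K * G * T).trace
        = (G * T * (G * K * Matrix.diagonal p * K)).trace := by
          rw [Matrix.mul_assoc _ G T, Matrix.trace_mul_comm]
      _ = (G * T * G * (K * Matrix.diagonal p * K)).trace := by simp only [Matrix.mul_assoc]
      _ = (G * (K * Matrix.diagonal p * K)).trace := by rw [hG.left]
      _ = (G * K * Matrix.diagonal p * K).trace := by simp only [Matrix.mul_assoc]
      _ = (K * (G * K * Matrix.diagonal p)).trace := Matrix.trace_mul_comm _ _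
      _ = _ := by simp only [Matrix.mul_assoc]
  have h3 := (abs_le.1 (abs_sum_mul_gram_self_le hγ p)).1
  have h4 : √(ell : ℝ) ≤ ell := by
    have : (1 : ℝ) ≤ ell := by exact_mod_cast hell
    exact Real.sqrt_le_self_iff.2 (.inr this)
  have h5 : √(ell : ℝ) * D.barNorm γ p ≤ ell * (1 / 8) :=
    mul_le_mul h4 hp (D.barNorm_nonneg γ p) (by positivity)
  rw [h2, one_div, ← div_eq_inv_mul]
  gcongr
  linarith

end DualData

end KernelMatrix

/-! ### Positive operators of finite trace -/

section Operators

variable {ι H : Type*} [Fintype ι] [NormedAddCommGroup H] [InnerProductSpace ℝ H]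

theorem dotProduct_gram_mulVec (f : ι → H) (n : ι → ℝ) :
    n ⬝ᵥ (Matrix.of (fun i j => ⟪f i, f j⟫_ℝ) *ᵥ n) = ‖∑ i, n i • f i‖ ^ 2 := by
  rw [← real_inner_self_eq_norm_sq, sum_inner]
  refine Finset.sum_congr rfl fun i _ => ?_
  rw [inner_sum, Matrix.mulVec, dotProduct, Finset.mul_sum]
  refine Finset.sum_congr rfl fun j _ => ?_
  rw [real_inner_smul_left, real_inner_smul_right, Matrix.of_apply]
  ring

theorem gram_mulVec_apply (f : ι → H) (n : ι → ℝ) (i : ι) :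
    (Matrix.of (fun i j => ⟪f i, f j⟫_ℝ) *ᵥ n) i = ⟪f i, ∑ j, n j • f j⟫_ℝ := by
  rw [inner_sum, Matrix.mulVec, dotProduct]
  refine Finset.sum_congr rfl fun j _ => ?_
  rw [real_inner_smul_right, Matrix.of_apply, mul_comm]

theorem posSemidef_gram_inner (f : ι → H) :
    (Matrix.of (fun i j => ⟪f i, f j⟫_ℝ)).PosSemidef := by
  refine Matrix.posSemidef_of_quad ?_ fun x => ?_
  · ext i j; simp [real_inner_comm]
  · rw [dotProduct_gram_mulVec]; positivity

theorem isPositive_sum_rankOne {A : H →L[ℝ] H} (f : ι → H) {B : Matrix ι ι ℝ} (hB : B.PosSemidef)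
    (hA : A = ∑ i, ∑ j, B i j • InnerProductSpace.rankOne ℝ (f i) (f j)) : A.IsPositive := by
  have hap : ∀ x y, ⟪A x, y⟫_ℝ = ∑ i, ∑ j, B i j * (⟪f j, x⟫_ℝ * ⟪f i, y⟫_ℝ) := by
    intro x y
    rw [hA]
    simp only [_root_.sum_apply, sum_inner, _root_.smul_apply,
      InnerProductSpace.rankOne_apply, real_inner_smul_left]
  rw [ContinuousLinearMap.isPositive_iff]
  constructor
  · intro x y
    change ⟪A x, y⟫_ℝ = ⟪x, A y⟫_ℝ
    rw [hap, real_inner_comm, hap, Finset.sum_comm]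
    refine Finset.sum_congr rfl fun i _ => Finset.sum_congr rfl fun j _ => ?_
    rw [← Matrix.transpose_apply B, hB.transpose_eq]
    ring
  · intro x
    have := hB.quad_nonneg fun i => ⟪f i, x⟫_ℝ
    rw [hap]
    refine this.trans_eq (Finset.sum_congr rfl fun i _ => ?_)
    rw [Matrix.mulVec, dotProduct, Finset.mul_sum]
    exact Finset.sum_congr rfl fun j _ => by ring

variable [CompleteSpace H] {A : H →L[ℝ] H}

theorem hasSum_opTrace (hA : A.IsPositive) (h : opTrace A ≠ ⊤) :
    HasSum (fun i => ⟪stdHilbertBasis H i, A (stdHilbertBasis H i)⟫_ℝ) (opTrace A).toReal := by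
  have h1 := ENNReal.hasSum_toReal h
  rw [← ENNReal.tsum_toReal_eq fun i => ENNReal.ofReal_ne_top] at h1
  rw [← opTrace] at h1
  convert h1 using 2 with i
  rw [ENNReal.toReal_ofReal]
  rw [real_inner_comm]
  exact hA.inner_nonneg_left _

/-- If a combination of the squares `⟨f j, h⟩ ^ 2` and of `‖h‖ ^ 2` is a nonnegative quadratic
form, then so is its pairing with a positive operator of finite trace. -/
theorem sum_mul_inner_add_trace_nonneg (hA : A.IsPositive) (hfin : opTrace A ≠ ⊤) (f : ι → H)
    (c : ι → ℝ) (μ : ℝ) (hq : ∀ h, 0 ≤ ∑ j, c j * ⟪f j, h⟫_ℝ ^ 2 + μ * ‖h‖ ^ 2) :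
    0 ≤ ∑ j, c j * ⟪f j, A (f j)⟫_ℝ + μ * (opTrace A).toReal := by
  classical
  set b := stdHilbertBasis H with hb
  have hsum := hasSum_opTrace hA hfin
  -- the vectors, truncated to finitely many coordinates
  set g : Finset _ → ι → H := fun s j => ∑ i ∈ s, ⟪b i, f j⟫_ℝ • b i with hg
  have hlim : ∀ j, Filter.Tendsto (fun s => g s j) Filter.atTop (nhds (f j)) := by
    intro j
    have := b.hasSum_repr (f j)
    simpa only [HasSum, HilbertBasis.repr_apply_apply, SummationFilter.unconditional_filter]
      using this
  have htend : Filter.Tendsto (fun s => ∑ j, c j * ⟪g s j, A (g s j)⟫_ℝ +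
      μ * ∑ i ∈ s, ⟪b i, A (b i)⟫_ℝ) Filter.atTop
      (nhds (∑ j, c j * ⟪f j, A (f j)⟫_ℝ + μ * (opTrace A).toReal)) := by
    refine Filter.Tendsto.add (tendsto_finsetSum _ fun j _ => ?_) ?_
    swap
    · have := hsum.mul_left μ
      simpa only [HasSum, ← Finset.mul_sum, SummationFilter.unconditional_filter] using this
    exact ((hlim j).inner ((A.continuous.tendsto _).comp (hlim j))).const_mul _
  refine ge_of_tendsto' htend fun s => ?_
  -- the compression of `A`, as a sum of squares
  have hAs : (Matrix.of fun i k : s => ⟪b i, A (b k)⟫_ℝ).PosSemidef := by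
    refine Matrix.posSemidef_of_quad ?_ fun x => ?_
    · ext i k
      simp only [Matrix.transpose_apply, Matrix.of_apply]
      rw [← real_inner_comm]
      exact hA.isSymmetric (b i) (b k)
    · have : x ⬝ᵥ (Matrix.of (fun i k : s => ⟪b i, A (b k)⟫_ℝ) *ᵥ x) =
          ⟪A (∑ i, x i • b i), ∑ i, x i • b i⟫_ℝ := by
        rw [real_inner_comm, sum_inner]
        refine Finset.sum_congr rfl fun i _ => ?_
        rw [map_sum, inner_sum, Matrix.mulVec, dotProduct, Finset.mul_sum]
        refine Finset.sum_congr rfl fun k _ => ?_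
        rw [map_smul, real_inner_smul_left, real_inner_smul_right, Matrix.of_apply]
        ring
      rw [this]
      exact hA.inner_nonneg_left _
  obtain ⟨Y, hY, hYA⟩ := hAs.exists_sqrt
  have hA' : ∀ i k : s, ⟪b i, A (b k)⟫_ℝ = ∑ l, Y l i * Y l k := by
    intro i k
    have := congrFun (congrFun hYA i) k
    rw [Matrix.of_apply, Matrix.mul_apply] at this
    rw [← this]
    refine Finset.sum_congr rfl fun l _ => ?_
    rw [← Matrix.transpose_apply Y l i, hY]
  have key : ∑ j, c j * ⟪g s j, A (g s j)⟫_ℝ + μ * ∑ i ∈ s, ⟪b i, A (b i)⟫_ℝ =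
      ∑ l : s, (∑ j, c j * ⟪f j, ∑ i : s, Y l i • b i⟫_ℝ ^ 2 + μ * ‖∑ i : s, Y l i • b i‖ ^ 2) := by
    have e1 : ∀ j, ⟪g s j, A (g s j)⟫_ℝ = ∑ l : s, ⟪f j, ∑ i : s, Y l i • b i⟫_ℝ ^ 2 := by
      intro j
      have e2 : g s j = ∑ i : s, ⟪b i, f j⟫_ℝ • b i :=
        (Finset.sum_coe_sort s fun i => ⟪b i, f j⟫_ℝ • b i).symm
      have e3 : ∀ l : s, ⟪f j, ∑ i : s, Y l i • b i⟫_ℝ ^ 2 =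
          ∑ i : s, ∑ k : s, ⟪b i, f j⟫_ℝ * ⟪b k, f j⟫_ℝ * (Y l i * Y l k) := by
        intro l
        rw [inner_sum, sq, Finset.sum_mul_sum]
        refine Finset.sum_congr rfl fun i _ => Finset.sum_congr rfl fun k _ => ?_
        rw [real_inner_smul_right, real_inner_smul_right, real_inner_comm, real_inner_comm (b k)]
        ring
      rw [e2, sum_inner]
      simp only [e3]
      rw [Finset.sum_comm]
      refine Finset.sum_congr rfl fun i _ => ?_
      rw [map_sum, inner_sum, Finset.sum_comm]
      refine Finset.sum_congr rfl fun k _ => ?_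
      rw [map_smul, real_inner_smul_left, real_inner_smul_right, hA', ← Finset.mul_sum]
      ring
    have e4 : ∑ i ∈ s, ⟪b i, A (b i)⟫_ℝ = ∑ l : s, ‖∑ i : s, Y l i • b i‖ ^ 2 := by
      have e5 : ∀ l : s, ‖∑ i : s, Y l i • b i‖ ^ 2 = ∑ i : s, Y l i * Y l i := by
        intro l
        have o : Orthonormal ℝ (fun i : s => b i) := b.orthonormal.comp _ Subtype.val_injective
        rw [← real_inner_self_eq_norm_sq, o.inner_sum]
        simp
      simp only [e5]
      rw [← Finset.sum_coe_sort s fun i => ⟪b i, A (b i)⟫_ℝ, Finset.sum_comm]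
      exact Finset.sum_congr rfl fun i _ => hA' i i
    rw [Finset.sum_add_distrib, e4, Finset.mul_sum, Finset.sum_comm]
    congr 1
    refine Finset.sum_congr rfl fun j _ => ?_
    rw [e1, Finset.mul_sum]
  rw [key]
  exact Finset.sum_nonneg fun l _ => hq _

/-- The trace of an operator of finite rank. -/
theorem opTrace_sum_rankOne (f : ι → H) (B : ι → ι → ℝ)
    (hA : A = ∑ i, ∑ j, B i j • InnerProductSpace.rankOne ℝ (f i) (f j)) (hpos : A.IsPositive) :
    opTrace A = ENNReal.ofReal (∑ i, ∑ j, B i j * ⟪f j, f i⟫_ℝ) := by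
  set b := stdHilbertBasis H with hb
  have h1 : HasSum (fun k => ⟪b k, A (b k)⟫_ℝ) (∑ i, ∑ j, B i j * ⟪f j, f i⟫_ℝ) := by
    have h2 : HasSum (fun k => ∑ i, ∑ j, B i j * (⟪f j, b k⟫_ℝ * ⟪b k, f i⟫_ℝ))
        (∑ i, ∑ j, B i j * ⟪f j, f i⟫_ℝ) :=
      hasSum_sum fun i _ => hasSum_sum fun j _ => (b.hasSum_inner_mul_inner (f j) (f i)).mul_left _
    convert h2 using 2 with k
    rw [hA]
    simp only [_root_.sum_apply, inner_sum, _root_.smul_apply,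
      InnerProductSpace.rankOne_apply, real_inner_smul_right]
  rw [opTrace, ← h1.tsum_eq, ENNReal.ofReal_tsum_of_nonneg _ h1.summable]
  intro k
  rw [real_inner_comm]
  exact hpos.inner_nonneg_left _

end Operators

/-! ### Duality and primal recovery -/

@[simp]
theorem inner_feature {Z H : Type*} [NormedAddCommGroup H] [InnerProductSpace ℝ H]
    [CompleteSpace H] [RKHS ℝ H Z ℝ] (z : Z) (u : H) : ⟪feature H z, u⟫_ℝ = u z := by
  rw [feature, RKHS.kerFun_inner]
  simp

namespace Problem

variable {d : ℕ} {X Y : Set (EuclideanSpace ℝ (Fin d))} {HX : Type uX} {HY : Type uY}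
  {HXY : Type uH} {ell : ℕ} [NormedAddCommGroup HXY] [InnerProductSpace ℝ HXY]
  {P : Problem X Y HX HY ell} {φ : X × Y → HXY}

/-- The values of the operator with coefficients `B` on the features. -/
theorem inner_opOf (B : Matrix (Fin ell) (Fin ell) ℝ) (j : Fin ell) :
    ⟪φ (P.x j, P.y j), P.opOf φ B (φ (P.x j, P.y j))⟫_ℝ =
      (P.kerMatrix φ * B * P.kerMatrix φ) j j := by
  have h : P.opOf φ B = ∑ a, ∑ b, B a b •
    InnerProductSpace.rankOne ℝ (φ (P.x a, P.y a)) (φ (P.x b, P.y b)) := rfl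
  rw [Matrix.mul_assoc, Matrix.mul_apply, h]
  simp only [_root_.sum_apply, inner_sum, _root_.smul_apply, InnerProductSpace.rankOne_apply,
    real_inner_smul_right, Matrix.mul_apply, Finset.mul_sum, kerMatrix, Matrix.of_apply]
  refine Finset.sum_congr rfl fun a _ => Finset.sum_congr rfl fun b _ => ?_
  ring

theorem opTrace_opOf [CompleteSpace HXY] {B : Matrix (Fin ell) (Fin ell) ℝ} (hB : B.PosSemidef) :
    opTrace (P.opOf φ B) ≠ ⊤ ∧ (opTrace (P.opOf φ B)).toReal = (B * P.kerMatrix φ).trace := by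
  have hpos := isPositive_sum_rankOne (fun j => φ (P.x j, P.y j)) hB (A := P.opOf φ B) rfl
  have h1 := opTrace_sum_rankOne (fun j => φ (P.x j, P.y j)) B (A := P.opOf φ B) rfl hpos
  have h2 : (∑ i, ∑ j, B i j * ⟪φ (P.x j, P.y j), φ (P.x i, P.y i)⟫_ℝ) =
      (B * P.kerMatrix φ).trace := rfl
  rw [h1, h2]
  refine ⟨ENNReal.ofReal_ne_top, ENNReal.toReal_ofReal ?_⟩
  have : (P.kerMatrix φ).PosSemidef := posSemidef_gram_inner _
  obtain ⟨Z, hZ, hZB⟩ := hB.exists_sqrt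
  rw [← hZB, Matrix.mul_assoc, Matrix.trace_mul_comm]
  have h3 := (this.conjTranspose_mul_mul_same Z).trace_nonneg
  rwa [Matrix.conjTranspose_eq_transpose_of_trivial, hZ] at h3

variable [CompleteSpace HXY]
  [NormedAddCommGroup HX] [InnerProductSpace ℝ HX] [CompleteSpace HX]
  [NormedAddCommGroup HY] [InnerProductSpace ℝ HY] [CompleteSpace HY]
  [RKHS ℝ HX X ℝ] [RKHS ℝ HY Y ℝ] {R : Matrix (Fin ell) (Fin ell) ℝ}

theorem dual_Q_quad (n : Fin ell → ℝ) : n ⬝ᵥ ((P.dual R).Q *ᵥ n) =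
    ‖∑ i, n i • feature HX (P.x i)‖ ^ 2 + ‖∑ i, n i • feature HY (P.y i)‖ ^ 2 := by
  rw [← dotProduct_gram_mulVec, ← dotProduct_gram_mulVec, ← dotProduct_add, ← Matrix.add_mulVec]
  rfl

theorem dual_Q_mulVec (n : Fin ell → ℝ) (j : Fin ell) : ((P.dual R).Q *ᵥ n) j =
    (∑ i, n i • feature HX (P.x i)) (P.x j) + (∑ i, n i • feature HY (P.y i)) (P.y j) := by
  rw [← inner_feature, ← inner_feature, ← gram_mulVec_apply fun i => feature HX (P.x i),
    ← gram_mulVec_apply fun i => feature HY (P.y i), ← Pi.add_apply, ← Matrix.add_mulVec]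
  rfl

theorem valid_dual (h1 : 0 < P.lamOne) (h2 : 0 < P.lamTwo) : (P.dual R).Valid where
  Q := (posSemidef_gram_inner _).add (posSemidef_gram_inner _)
  lamOne := h1
  lamTwo := h2

/-- On the dual feasible set, and more generally wherever `∑ c_j Φ_j Φ_jᵀ + μ I` is positive
semidefinite, the pairing with the values of a positive operator is nonnegative. -/
theorem sum_mul_inner_nonneg (hR : Rᵀ * R = P.kerMatrix φ) {A : HXY →L[ℝ] HXY}
    (hA : A.IsPositive) (hfin : opTrace A ≠ ⊤) {c : Fin ell → ℝ} {μ : ℝ} (hμ : 0 ≤ μ)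
    (h : ((P.dual R).lin c + μ • 1).PosSemidef) :
    0 ≤ (∑ j, c j * ⟪φ (P.x j, P.y j), A (φ (P.x j, P.y j))⟫_ℝ) + μ * (opTrace A).toReal := by
  set f : Fin ell → HXY := fun j => φ (P.x j, P.y j) with hf
  refine sum_mul_inner_add_trace_nonneg hA hfin f c μ fun v => ?_
  -- only the projection of `v` to the span of the features matters
  set V := Submodule.span ℝ (Set.range f)
  have : FiniteDimensional ℝ V := FiniteDimensional.span_of_finite ℝ (Set.finite_range f)
  set w := V.starProjection v with hw
  have h1 : ∀ j, ⟪f j, v⟫_ℝ = ⟪f j, w⟫_ℝ := by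
    intro j
    have := V.starProjection_inner_eq_zero v (f j) (Submodule.subset_span ⟨j, rfl⟩)
    rw [real_inner_comm, inner_sub_right] at this
    linarith
  have h2 : ‖w‖ ^ 2 ≤ ‖v‖ ^ 2 := pow_le_pow_left₀ (norm_nonneg _) (V.norm_starProjection_apply_le v) 2
  obtain ⟨a, ha⟩ := (Submodule.mem_span_range_iff_exists_fun ℝ).1 (V.starProjection_apply_mem v)
  have hK : (P.dual R).Rᵀ * (P.dual R).R = Matrix.of fun i j => ⟪f i, f j⟫_ℝ := hR
  have h3 := h.quad_nonneg ((P.dual R).R *ᵥ a)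
  rw [Matrix.add_mulVec, dotProduct_add, DualData.lin_eq, Matrix.smul_mulVec, Matrix.one_mulVec,
    dotProduct_smul] at h3
  have h4 : (P.dual R).Rᵀ *ᵥ ((P.dual R).R *ᵥ a) = fun j => ⟪f j, w⟫_ℝ := by
    ext j
    rw [Matrix.mulVec_mulVec, hK, gram_mulVec_apply, ha]
  have h5 : ((P.dual R).R *ᵥ a) ⬝ᵥ ((P.dual R).R *ᵥ a) = ‖w‖ ^ 2 := by
    rw [Matrix.dotProduct_mulVec, ← Matrix.mulVec_transpose, Matrix.mulVec_mulVec, hK,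
      dotProduct_comm, dotProduct_gram_mulVec, ha]
  have h6 : ((P.dual R).R *ᵥ a) ⬝ᵥ
      (((P.dual R).R * Matrix.diagonal c * (P.dual R).Rᵀ) *ᵥ ((P.dual R).R *ᵥ a)) =
      ∑ j, c j * ⟪f j, w⟫_ℝ ^ 2 := by
    rw [← Matrix.mulVec_mulVec, ← Matrix.mulVec_mulVec, h4, Matrix.dotProduct_mulVec,
      ← Matrix.mulVec_transpose, h4]
    refine Finset.sum_congr rfl fun j _ => ?_
    rw [Matrix.mulVec_diagonal]
    ring
  rw [h5, h6, smul_eq_mul] at h3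
  simp only [h1]
  have := mul_le_mul_of_nonneg_left h2 hμ
  linarith

/-- The duality gap is a sum of two squares and of the complementarity term. -/
theorem F_sub_value (h2 : 0 < P.lamTwo) (γ : Fin ell → ℝ) {u : HX} {v : HY} {A : HXY →L[ℝ] HXY}
    (h : P.Admissible φ u v A) : (P.dual R).F γ - P.value u v A =
      P.lamTwo * (‖u - P.uOf γ‖ ^ 2 + ‖v - P.vOf γ‖ ^ 2) +
        ((∑ j, γ j * ⟪φ (P.x j, P.y j), A (φ (P.x j, P.y j))⟫_ℝ) +
          P.lamOne * (opTrace A).toReal) := by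
  set gX := ∑ i, γ i • feature HX (P.x i) with hgX
  set gY := ∑ i, γ i • feature HY (P.y i) with hgY
  have e1 : ∀ w : HX, ⟪gX, w⟫_ℝ = ∑ j, γ j * w (P.x j) := fun w => by
    rw [hgX, sum_inner]; simp [real_inner_smul_left]
  have e2 : ∀ w : HY, ⟪gY, w⟫_ℝ = ∑ j, γ j * w (P.y j) := fun w => by
    rw [hgY, sum_inner]; simp [real_inner_smul_left]
  have e3 : ∑ j, γ j * ⟪φ (P.x j, P.y j), A (φ (P.x j, P.y j))⟫_ℝ =
      ∑ j, γ j * quadCost (P.x j : EuclideanSpace ℝ (Fin d)) (P.y j) - ⟪gX, u⟫_ℝ - ⟪gY, v⟫_ℝ := by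
    rw [e1, e2, ← Finset.sum_sub_distrib, ← Finset.sum_sub_distrib]
    refine Finset.sum_congr rfl fun j _ => ?_
    rw [← h.2.2 j]
    ring
  have e4 : ∑ j, γ j * (P.dual R).z j = ⟪gX, P.wMu⟫_ℝ + ⟪gY, P.wNu⟫_ℝ -
      2 * P.lamTwo * ∑ j, γ j * quadCost (P.x j : EuclideanSpace ℝ (Fin d)) (P.y j) := by
    rw [e1, e2, ← Finset.sum_add_distrib, Finset.mul_sum, ← Finset.sum_sub_distrib]
    refine Finset.sum_congr rfl fun j _ => ?_
    simp only [dual]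
    ring
  have e5 : P.uOf γ = (1 / (2 * P.lamTwo)) • (P.wMu - gX) := rfl
  have e6 : P.vOf γ = (1 / (2 * P.lamTwo)) • (P.wNu - gY) := rfl
  rw [DualData.F, dual_Q_quad, ← hgX, ← hgY, e4, e3, value, e5, e6]
  simp only [@norm_sub_sq_real, norm_smul, mul_pow, real_inner_smul_right, inner_sub_right,
    real_inner_comm _ gX, real_inner_comm _ gY, Real.norm_eq_abs, sq_abs, dual, qSq]
  field_simp
  ring

theorem value_le_F (h1 : 0 < P.lamOne) (h2 : 0 < P.lamTwo) (hR : Rᵀ * R = P.kerMatrix φ)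
    {γ : Fin ell → ℝ} (hγ : ((P.dual R).slack γ).PosSemidef) {u : HX} {v : HY}
    {A : HXY →L[ℝ] HXY} (h : P.Admissible φ u v A) : P.value u v A ≤ (P.dual R).F γ := by
  have e1 := P.F_sub_value (R := R) h2 γ h
  have e2 := sum_mul_inner_nonneg hR h.1 h.2.1 h1.le (DualData.slack_eq (P.dual R) γ ▸ hγ)
  have e3 : 0 ≤ P.lamTwo * (‖u - P.uOf γ‖ ^ 2 + ‖v - P.vOf γ‖ ^ 2) := by positivity
  linarith

/-- From a Newton direction `p` of the barrier function at `γ`, of local norm at most `1 / 8`, one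
obtains an admissible triple with a duality gap of order `ℓ / t`: the Newton system is the system
of the equality constraints. -/
theorem admissible_primal (hell : 1 ≤ ell) (h1 : 0 < P.lamOne) (h2 : 0 < P.lamTwo)
    (hR : Rᵀ * R = P.kerMatrix φ) {γ p : Fin ell → ℝ} {t : ℝ} (ht : 0 < t)
    (hγ : ((P.dual R).slack γ).PosDef)
    (hn : (P.dual R).hessT t γ *ᵥ p = -(P.dual R).gradT t γ)
    (hp : (P.dual R).locNorm t γ p ≤ 1 / 8) {B : Matrix (Fin ell) (Fin ell) ℝ}
    (hB : B = primalCoeff (P.kerMatrix φ) P.lamOne γ p t) :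
    P.Admissible φ (P.uOf (γ + p)) (P.vOf (γ + p)) (P.opOf φ B) ∧
      (P.dual R).F γ - P.value (P.uOf (γ + p)) (P.vOf (γ + p)) (P.opOf φ B) ≤ 2 * ell / t := by
  set D := P.dual R with hD
  have hV : D.Valid := valid_dual h1 h2
  have hK : D.Rᵀ * D.R = P.kerMatrix φ := hR
  have hl1 : P.lamOne = D.lamOne := rfl
  have hl2 : P.lamTwo = D.lamTwo := rfl
  rw [hl1] at hB
  have hbar := (hV.barNorm_le ht.le hγ p).trans hp
  have hBp : B.PosSemidef := by
    rw [hB]; exact DualData.posSemidef_primalCoeff hK hγ ht (hbar.trans (by norm_num))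
  have hval : ∀ j, ⟪φ (P.x j, P.y j), P.opOf φ B (φ (P.x j, P.y j))⟫_ℝ =
      (1 / t) * (D.gram γ j j - ∑ i, D.gram γ j i ^ 2 * p i) := fun j => by
    rw [inner_opOf, hB]; exact DualData.mul_primalCoeff_mul_diag hK hγ j
  have hadm : P.Admissible φ (P.uOf (γ + p)) (P.vOf (γ + p)) (P.opOf φ B) := by
    refine ⟨isPositive_sum_rankOne _ hBp rfl, (opTrace_opOf hBp).1, fun j => ?_⟩
    rw [hval]
    have e1 := congrFun hn j
    have e2 : (P.uOf (γ + p)) (P.x j) + (P.vOf (γ + p)) (P.y j) = 1 / (2 * P.lamTwo) *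
        (P.wMu (P.x j) + P.wNu (P.y j) - (D.Q *ᵥ (γ + p)) j) := by
      rw [dual_Q_mulVec, uOf, vOf]
      simp only [RKHS.coe_smul, RKHS.coe_sub, Pi.smul_apply, Pi.sub_apply, smul_eq_mul,
        Pi.add_apply]
      ring
    have e3 : D.z j = P.wMu (P.x j) + P.wNu (P.y j) -
      2 * P.lamTwo * quadCost (P.x j : EuclideanSpace ℝ (Fin d)) (P.y j) := rfl
    rw [DualData.hessT_mulVec, Pi.neg_apply, DualData.gradT, e3, ← hl2] at e1
    rw [Matrix.mulVec_add, Pi.add_apply] at e2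
    rw [sub_sub, e2]
    field_simp at e1 ⊢
    linarith
  refine ⟨hadm, ?_⟩
  rw [F_sub_value h2 γ hadm]
  have hu : P.uOf (γ + p) - P.uOf γ = (-(1 / (2 * P.lamTwo))) • ∑ i, p i • feature HX (P.x i) := by
    simp only [uOf, Pi.add_apply, add_smul, Finset.sum_add_distrib, ← smul_sub, neg_smul,
      ← smul_neg]
    congr 1
    abel
  have hv : P.vOf (γ + p) - P.vOf γ = (-(1 / (2 * P.lamTwo))) • ∑ i, p i • feature HY (P.y i) := by
    simp only [vOf, Pi.add_apply, add_smul, Finset.sum_add_distrib, ← smul_sub, neg_smul,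
      ← smul_neg]
    congr 1
    abel
  have e1 : P.lamTwo * (‖P.uOf (γ + p) - P.uOf γ‖ ^ 2 + ‖P.vOf (γ + p) - P.vOf γ‖ ^ 2) =
      1 / (4 * P.lamTwo) * (p ⬝ᵥ (D.Q *ᵥ p)) := by
    rw [hu, hv, dual_Q_quad, norm_smul, norm_smul, mul_pow, mul_pow, Real.norm_eq_abs, sq_abs]
    field_simp
    ring
  have e2 : (∑ j, γ j * ⟪φ (P.x j, P.y j), P.opOf φ B (φ (P.x j, P.y j))⟫_ℝ) +
      P.lamOne * (opTrace (P.opOf φ B)).toReal =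
      (B * kerSlack (P.kerMatrix φ) D.lamOne γ).trace := by
    rw [(opTrace_opOf hBp).2, kerSlack, Matrix.mul_add, Matrix.trace_add, Matrix.mul_smul,
      Matrix.trace_smul, smul_eq_mul, ← hl1, add_comm]
    congr 1
    set K := P.kerMatrix φ
    calc ∑ j, γ j * ⟪φ (P.x j, P.y j), P.opOf φ B (φ (P.x j, P.y j))⟫_ℝ
        = ((K * B * K) * Matrix.diagonal γ).trace := by
          refine Finset.sum_congr rfl fun j _ => ?_
          rw [inner_opOf, Matrix.diag_apply, Matrix.mul_diagonal, mul_comm]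
      _ = ((B * K * Matrix.diagonal γ) * K).trace := by
          rw [Matrix.trace_mul_comm _ K]; simp only [Matrix.mul_assoc]
      _ = _ := by simp only [Matrix.mul_assoc]
  have e3 := DualData.trace_primalCoeff_mul_le hell hK hγ ht hbar
  rw [← hB] at e3
  have e4 : t / (2 * P.lamTwo) * (p ⬝ᵥ (D.Q *ᵥ p)) ≤ 1 / 64 := by
    have f1 := hV.sq_locNorm ht.le hγ p
    have f2 := D.locNorm_nonneg t γ p
    have f3 := sq_nonneg (D.barNorm γ p)
    rw [← hl2] at f1
    nlinarith
  have e5 : 1 / (4 * P.lamTwo) * (p ⬝ᵥ (D.Q *ᵥ p)) ≤ (1 / 128) / t := by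
    rw [le_div_iff₀ ht]
    calc _ = (t / (2 * P.lamTwo) * (p ⬝ᵥ (D.Q *ᵥ p))) / 2 := by field_simp; ring
      _ ≤ _ := by linarith
  have e6 : (1 / 128) / t + 9 / 8 * ell / t ≤ 2 * ell / t := by
    rw [← add_div]
    have : (1 : ℝ) ≤ ell := by exact_mod_cast hell
    gcongr
    linarith
  rw [e1, e2]
  linarith

end Problem

/-! ### The run of the barrier method -/

namespace Problem

variable {d : ℕ} {X Y : Set (EuclideanSpace ℝ (Fin d))} {HX : Type uX} {HY : Type uY}
  {HXY : Type uH} {ell : ℕ}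
  [NormedAddCommGroup HXY] [InnerProductSpace ℝ HXY] [CompleteSpace HXY]
  [NormedAddCommGroup HX] [InnerProductSpace ℝ HX] [CompleteSpace HX]
  [NormedAddCommGroup HY] [InnerProductSpace ℝ HY] [CompleteSpace HY]
  [RKHS ℝ HX X ℝ] [RKHS ℝ HY Y ℝ]
  {P : Problem X Y HX HY ell} {φ : X × Y → HXY} {R : Matrix (Fin ell) (Fin ell) ℝ}

theorem abs_eval_dotProduct_le (u : HX) (v : HY) (n : Fin ell → ℝ) :
    |(fun j => u (P.x j) + v (P.y j)) ⬝ᵥ n| ≤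
      √(‖u‖ ^ 2 + ‖v‖ ^ 2) * √(n ⬝ᵥ ((P.dual R).Q *ᵥ n)) := by
  set gX := ∑ i, n i • feature HX (P.x i) with hgX
  set gY := ∑ i, n i • feature HY (P.y i) with hgY
  have e1 : (fun j => u (P.x j) + v (P.y j)) ⬝ᵥ n = ⟪gX, u⟫_ℝ + ⟪gY, v⟫_ℝ := by
    rw [hgX, hgY, sum_inner, sum_inner, ← Finset.sum_add_distrib]
    refine Finset.sum_congr rfl fun j _ => ?_
    rw [real_inner_smul_left, real_inner_smul_left, inner_feature, inner_feature]
    ring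
  rw [e1, dual_Q_quad, ← hgX, ← hgY, ← Real.sqrt_mul (by positivity)]
  have e2 : |⟪gX, u⟫_ℝ + ⟪gY, v⟫_ℝ| ≤ ‖gX‖ * ‖u‖ + ‖gY‖ * ‖v‖ :=
    (abs_add_le _ _).trans (add_le_add (abs_real_inner_le_norm _ _) (abs_real_inner_le_norm _ _))
  refine e2.trans (Real.le_sqrt_of_sq_le ?_)
  linarith [sq_nonneg (‖gX‖ * ‖v‖ - ‖gY‖ * ‖u‖)]

/-- The two solvability assumptions, in terms of the data of the dual problem. -/
theorem slater_dual (h1 : 0 < P.lamOne) (h2 : 0 < P.lamTwo) (hR : Rᵀ * R = P.kerMatrix φ)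
    {u : HX} {v : HY} {A : HXY →L[ℝ] HXY} (hA : A.IsPositive) (hfin : opTrace A ≠ ⊤)
    (hc : ∀ (x : X) (y : Y), quadCost (x : EuclideanSpace ℝ (Fin d)) y - u x - v y
      = ⟪φ (x, y), A (φ (x, y))⟫_ℝ)
    {u₁ : HX} {v₁ : HY} (hd : ∀ (x : X) (y : Y), u₁ x + v₁ y = ⟪φ (x, y), φ (x, y)⟫_ℝ) :
    (P.dual R).Slater (fun j => P.wMu (P.x j) + P.wNu (P.y j)) (fun j => u (P.x j) + v (P.y j))
      (fun j => ⟪φ (P.x j, P.y j), A (φ (P.x j, P.y j))⟫_ℝ) √P.qSq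
      √(‖u‖ ^ 2 + ‖v‖ ^ 2) √(‖u₁‖ ^ 2 + ‖v₁‖ ^ 2) (opTrace A).toReal where
  toValid := valid_dual h1 h2
  z j := by
    rw [← hc]
    simp only [dual]
    ring
  q_nonneg := Real.sqrt_nonneg _
  U_nonneg := Real.sqrt_nonneg _
  U₁_nonneg := Real.sqrt_nonneg _
  tr_nonneg := ENNReal.toReal_nonneg
  om_le := abs_eval_dotProduct_le _ _
  a_le := abs_eval_dotProduct_le _ _
  K_le n := by
    have : (fun j => ((P.dual R).Rᵀ * (P.dual R).R) j j) =
        fun j => u₁ (P.x j) + v₁ (P.y j) := by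
      ext j
      rw [hd]
      exact congrFun (congrFun hR j) j
    rw [this]
    exact abs_eval_dotProduct_le _ _ _
  trace_le c μ hμ h := by
    have := sum_mul_inner_nonneg hR hA hfin hμ h
    rwa [dotProduct_comm]

end Problem

namespace DualData

variable {ell : ℕ} {D : DualData ell} {om a α : Fin ell → ℝ} {q U U₁ tr t₀ k P : ℝ}

theorem SmallWeight.initial (hell : 1 ≤ ell) (h : D.Slater om a α q U U₁ tr)
    (ht : t₀ = 1 / (D.lamOne * ell + D.lamTwo + q ^ 2 / D.lamTwo)) : D.SmallWeight q t₀ := by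
  have h1 := h.lamOne
  have h2 := h.lamTwo
  have hl : (1 : ℝ) ≤ ell := by exact_mod_cast hell
  have hq : 0 ≤ q ^ 2 / D.lamTwo := by positivity
  have h3 : 0 < D.lamOne * ell := by positivity
  have hpos : 0 < D.lamOne * ell + D.lamTwo + q ^ 2 / D.lamTwo := by positivity
  refine ⟨by rw [ht]; positivity, ?_, ?_, ?_⟩
  · rw [ht, one_div, ← div_eq_inv_mul, div_le_one hpos]; linarith
  · rw [ht, one_div, ← div_eq_inv_mul, div_le_one hpos]; linarith
  · rw [ht, one_div, ← div_eq_inv_mul, div_le_iff₀ hpos]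
    have : D.lamTwo * (q ^ 2 / D.lamTwo) = q ^ 2 := by field_simp
    nlinarith

/-- The sequence of iterates. -/
def iterate (D : DualData ell) (t₀ : ℝ) (n : ℕ) : Iter ell := (D.next t₀)^[n] ⟨0, t₀, 1⟩

theorem iterate_succ (t₀ : ℝ) (n : ℕ) : D.iterate t₀ (n + 1) = D.next t₀ (D.iterate t₀ n) :=
  Function.iterate_succ_apply' _ _ _

theorem Slater.near_iterate (hell : 1 ≤ ell) (h : D.Slater om a α q U U₁ tr)
    (hs : D.SmallWeight q t₀) {m : ℝ} (hm : m = tr * (2 + 2 * U₁ * (6 + 2 * U + tr)))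
    (hk : k = 9 + 4 * U + tr + m)
    (hP : P = (1 + 2 * U + m) * √ell + U₁ / (D.lamOne * √(t₀ / (2 * D.lamTwo))) + 1) (n : ℕ) :
    D.Near t₀ (D.iterate t₀ n) ∧ D.Progress t₀ k P (D.iterate t₀ n) (D.iterate t₀ (n + 1)) := by
  have hU := h.U_nonneg
  have hU₁ := h.U₁_nonneg
  have htr := h.tr_nonneg
  have hl1 := h.lamOne
  have hm0 : 0 ≤ m := by rw [hm]; positivity
  have hk0 : 0 < k := by rw [hk]; positivity
  have hP0 : 0 < P := by rw [hP]; positivity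
  have hrt : (1 : ℝ) ≤ √ell := Real.one_le_sqrt.2 (by exact_mod_cast hell)
  have step : ∀ x, D.Near t₀ x → D.Near t₀ (D.next t₀ x) ∧ D.Progress t₀ k P x (D.next t₀ x) := by
    intro x hx
    have h1 : 0 < x.s → D.DualBound x.t x.γ (D.gradT x.t x.γ) (k * √ell - 1 / 8) ∧
        D.DualBound x.t x.γ (D.gradT t₀ 0) P := by
      intro h0
      have hb := hx.bound
      rw [hx.t_eq h0] at hb ⊢
      obtain ⟨b1, b2⟩ := h.phase_one hell hs hx.posDef h0.le hx.s_le hb rfl hm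
      refine ⟨b1.mono ?_, b2.mono (by rw [hP]; linarith)⟩
      rw [hk]
      linarith
    exact hx.next hell h.toValid hk0 hP0 (fun h => (h1 h).1) (fun h => (h1 h).2)
  have near : ∀ n, D.Near t₀ (D.iterate t₀ n) := by
    intro n
    induction n with
    | zero => exact near_start h.toValid hs.pos
    | succ n ih => rw [iterate_succ]; exact (step _ ih).1
  refine ⟨near n, ?_⟩
  rw [iterate_succ]
  exact (step _ (near n)).2

/-- The rounds of the iteration up to the first one at which the tilt vanishes and the weight is
large form a run of the barrier method. -/
theorem barrierRun_iterate (hell : 1 ≤ ell) (ht₀ : 0 < t₀)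
    (hn : ∀ n, D.Near t₀ (D.iterate t₀ n))
    (hp : ∀ n, D.Progress t₀ k P (D.iterate t₀ n) (D.iterate t₀ (n + 1)))
    {τ : ℝ} (hτ : 0 < τ) {N : ℕ} (hs : (D.iterate t₀ N).s = 0)
    (ht : 2 * ell / τ ≤ (D.iterate t₀ N).t) : D.BarrierRun τ N (D.iterate t₀ N).γ := by
  have hl : (1 : ℝ) ≤ ell := by exact_mod_cast hell
  set x := D.iterate t₀ with hx
  have hx0 : x 0 = ⟨0, t₀, 1⟩ := rfl
  have hmono : Monotone fun n => (x n).t := monotone_nat_of_le_succ fun n => (hp n).t_le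
  have hanti : Antitone fun n => (x n).s := antitone_nat_of_succ_le fun n => (hp n).s_le
  have hmin : Monotone fun n : ℕ => min (n + 1) N := fun i j h => by
    dsimp only; lia
  have hN : N ≠ 0 := by
    rintro rfl
    rw [hx0] at hs
    exact one_ne_zero hs
  have hx1 : (x (min (0 + 1) N)).t = t₀ := by
    rw [min_eq_left (by lia), ((hp 0).of_pos (by rw [hx0]; exact one_pos)).1, hx0]
  refine ⟨fun n => ell / (x (min (n + 1) N)).t, fun n => (x (min (n + 1) N)).s, fun n => (x n).γ,
    fun i j h => ?_, fun n => ?_, ?_, fun i j h => hanti (hmin h), (hn _).s_le,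
    fun n => (hn _).s_nonneg, ?_, rfl, rfl, fun n _ => (hn n).posDef, fun n hnN => ?_⟩
  · exact div_le_div_of_nonneg_left (by positivity) (hn _).t_pos (hmono (hmin h))
  · have := (hn (min (n + 1) N)).t_pos
    positivity
  · have h1 : min (N + 1) N = N := by lia
    simp only [h1]
    rw [div_le_iff₀ (hn N).t_pos]
    rw [div_le_iff₀ hτ] at ht
    linarith
  · simp only [show min (N + 1) N = N by lia, hs]
  · simp only [show min (n + 1) N = n + 1 by lia, hx1]
    obtain ⟨p, p1, p2⟩ := (hp n).newton
    set y := x (n + 1)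
    have hy : 0 < y.t := (hn (n + 1)).t_pos
    have e1 : D.grad (ell / y.t) (x n).γ - y.s • D.grad (ell / t₀) 0 =
        (1 / y.t) • (D.gradT y.t (x n).γ - y.s • D.gradT t₀ 0) := by
      rw [D.grad_eq hell hy, D.grad_eq hell ht₀]
      rcases (hn (n + 1)).s_nonneg.eq_or_lt with h | h
      · have h' : y.s = 0 := h.symm
        rw [h', zero_smul, zero_smul, sub_zero, sub_zero]
      · rw [show y.t = t₀ from (hn (n + 1)).t_eq h, smul_sub, smul_comm]
    refine ⟨p, ?_, ?_⟩
    · rw [e1, D.hess_eq hell hy, Matrix.smul_mulVec, p1, smul_neg]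
    · have e2 : √((ell : ℝ) / (ell / y.t)) * √(-((D.grad (ell / y.t) (x n).γ -
          y.s • D.grad (ell / t₀) 0) ⬝ᵥ p)) =
          √(-((D.gradT y.t (x n).γ - y.s • D.gradT t₀ 0) ⬝ᵥ p)) := by
        have e3 : (ell : ℝ) / (ell / y.t) = y.t := by field_simp
        rw [e1, e3, ← Real.sqrt_mul hy.le, smul_dotProduct, smul_eq_mul]
        rw [mul_neg, ← mul_assoc, mul_one_div_cancel hy.ne', one_mul]
      rw [e2]
      exact p2

end DualData

theorem log_le_of_le_pow {y b : ℝ} {n : ℕ} (hb : 0 < b) (h : b ≤ y ^ n) :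
    Real.log b ≤ n * Real.log y := by
  rw [← Real.log_pow]
  exact Real.log_le_log hb h

namespace DualData

/-- The number of rounds is of order `√ℓ log (ℓ / τ)`. -/
theorem exists_stop_iterate {U U₁ tr : ℝ} (hU : 0 ≤ U) (hU₁ : 0 ≤ U₁) (htr : 0 ≤ tr) (r : ℕ) :
    ∃ κ : ℝ, 0 < κ ∧ ∀ (ell : ℕ) (τ : ℝ), 1 ≤ ell → 0 < τ → τ ≤ 1 / 2 →
      ∀ (D : DualData ell) (om a α : Fin ell → ℝ) (q t₀ : ℝ), D.Slater om a α q U U₁ tr →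
      (τ / ell) ^ r ≤ D.lamOne → D.lamOne ≤ (ell / τ) ^ r →
      (τ / ell) ^ r ≤ D.lamTwo → D.lamTwo ≤ (ell / τ) ^ r →
      q ^ 2 ≤ 2 * ((ell / τ) ^ r) ^ 2 →
      t₀ = 1 / (D.lamOne * ell + D.lamTwo + q ^ 2 / D.lamTwo) →
      (∀ n, D.Near t₀ (D.iterate t₀ n)) ∧
      ∃ N : ℕ, (N : ℝ) ≤ κ * (√ell * Real.log (ell / τ)) ∧
        ((D.iterate t₀ N).s = 0 ∧ 2 * ell / τ ≤ (D.iterate t₀ N).t) ∧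
        (∀ n < N, ¬ ((D.iterate t₀ n).s = 0 ∧ 2 * ell / τ ≤ (D.iterate t₀ n).t)) ∧
        D.BarrierRun τ N (D.iterate t₀ N).γ := by
  set m := tr * (2 + 2 * U₁ * (6 + 2 * U + tr)) with hm
  have hm0 : 0 ≤ m := by rw [hm]; positivity
  set k := 9 + 4 * U + tr + m with hk
  have hk1 : 1 ≤ k := by rw [hk]; linarith
  set c := 2 + 2 * U + m + U₁ with hc
  have hc1 : 2 ≤ c := by rw [hc]; linarith
  have hlog2 : 0 < Real.log 2 := Real.log_pos one_lt_two
  have hlogc : 0 < Real.log (8 * c) := Real.log_pos (by linarith)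
  refine ⟨8 * k * (Real.log (8 * c) / Real.log 2 + (5 * r + 4)) + 32 * (3 * r + 5)
    + 3 / Real.log 2, by positivity, ?_⟩
  intro ell τ hell hτ hτ2 D om a α q t₀ h hl1 hl1' hl2 hl2' hq ht₀
  have hl : (1 : ℝ) ≤ ell := by exact_mod_cast hell
  have hs := SmallWeight.initial hell h ht₀
  have hn := h.near_iterate hell hs hm hk rfl
  set P := (1 + 2 * U + m) * √ell + U₁ / (D.lamOne * √(t₀ / (2 * D.lamTwo))) + 1 with hP
  have p1 := h.lamOne
  have p2 := h.lamTwo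
  have hrt : (1 : ℝ) ≤ √ell := Real.one_le_sqrt.2 hl
  set y : ℝ := ell / τ with hy
  have hyinv : τ / ell = y⁻¹ := by rw [hy, inv_div]
  rw [hyinv, inv_pow] at hl1 hl2
  have hely : ell ≤ y := by
    rw [hy, le_div_iff₀ hτ]
    nlinarith
  have hy2 : 2 ≤ y := by
    rw [hy, le_div_iff₀ hτ]
    linarith
  have hy0 : 0 < y := by linarith
  have hL : Real.log 2 ≤ Real.log y := Real.log_le_log two_pos hy2
  have hypow : ∀ {i j : ℕ}, i ≤ j → y ^ i ≤ y ^ j := fun h => pow_le_pow_right₀ (by linarith) h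
  have hy1 : ∀ i : ℕ, 1 ≤ y ^ i := fun i => one_le_pow₀ (by linarith)
  have h8 : (8 : ℝ) ≤ y ^ 3 := by
    calc (8 : ℝ) = 2 ^ 3 := by norm_num
      _ ≤ y ^ 3 := pow_le_pow_left₀ (by norm_num) hy2 3
  have hinv1 : 1 / D.lamOne ≤ y ^ r := by
    rw [one_div]; exact inv_le_of_inv_le₀ (by positivity) hl1
  have hinv2 : 1 / D.lamTwo ≤ y ^ r := by
    rw [one_div]; exact inv_le_of_inv_le₀ (by positivity) hl2
  -- the initial weight is polynomial in `ℓ / τ`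
  have ht1 : 1 / t₀ ≤ 4 * y ^ (3 * r + 1) := by
    rw [ht₀, one_div_one_div]
    have e1 : D.lamOne * ell ≤ y ^ (3 * r + 1) := by
      calc D.lamOne * ell ≤ y ^ r * y := by gcongr
        _ = y ^ (r + 1) := (pow_succ _ _).symm
        _ ≤ _ := hypow (by lia)
    have e2 : D.lamTwo ≤ y ^ (3 * r + 1) := hl2'.trans (hypow (by lia))
    have e3 : q ^ 2 / D.lamTwo ≤ 2 * y ^ (3 * r + 1) := by
      calc q ^ 2 / D.lamTwo = q ^ 2 * (1 / D.lamTwo) := by ring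
        _ ≤ 2 * (y ^ r) ^ 2 * y ^ r := by gcongr
        _ = 2 * y ^ (3 * r) := by ring
        _ ≤ 2 * y ^ (3 * r + 1) := mul_le_mul_of_nonneg_left (hypow (by lia)) zero_le_two
    linarith
  have ht2 : 1 / y ^ r ≤ 1 / t₀ := by
    rw [ht₀, one_div_one_div, one_div]
    have e1 : D.lamOne ≤ D.lamOne * ell := le_mul_of_one_le_right p1.le hl
    have e3 : 0 ≤ q ^ 2 / D.lamTwo := by positivity
    linarith
  have htpos := hs.pos
  have hTf : |Real.log (2 * ell / τ / t₀)| ≤ (3 * r + 5) * Real.log y := by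
    have e0 : 2 * ell / τ / t₀ = 2 * y * (1 / t₀) := by rw [hy]; ring
    have e1 : 2 * ell / τ / t₀ ≤ y ^ (3 * r + 5) := by
      rw [e0]
      calc 2 * y * (1 / t₀) ≤ 2 * y * (4 * y ^ (3 * r + 1)) := by gcongr
        _ = 8 * y ^ (3 * r + 2) := by ring
        _ ≤ y ^ 3 * y ^ (3 * r + 2) := by gcongr
        _ = y ^ (3 * r + 5) := by ring
    have e2 : (y ^ (3 * r + 5))⁻¹ ≤ 2 * ell / τ / t₀ := by
      rw [e0]
      calc (y ^ (3 * r + 5))⁻¹ ≤ (y ^ r)⁻¹ := inv_anti₀ (by positivity) (hypow (by lia))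
        _ = 1 / y ^ r := (one_div _).symm
        _ ≤ 1 / t₀ := ht2
        _ ≤ 2 * y * (1 / t₀) := le_mul_of_one_le_left (by positivity) (by linarith)
    have e3 := log_le_of_le_pow (by positivity) e1
    have e4 := Real.log_le_log (by positivity) e2
    rw [Real.log_inv, Real.log_pow] at e4
    push_cast at e3 e4
    exact abs_le.2 ⟨by linarith, e3⟩
  have hPpos : 1 ≤ P := by
    rw [hP]
    have : 0 ≤ (1 + 2 * U + m) * √ell + U₁ / (D.lamOne * √(t₀ / (2 * D.lamTwo))) := by positivity
    linarith
  have hlogP : |Real.log (8 * P)| ≤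
      (Real.log (8 * c) / Real.log 2 + (5 * r + 4)) * Real.log y := by
    rw [abs_of_nonneg (Real.log_nonneg (by linarith))]
    have e1 : 1 / √(t₀ / (2 * D.lamTwo)) ≤ y ^ (4 * r + 4) := by
      have f1 : 1 / √(t₀ / (2 * D.lamTwo)) = √(2 * D.lamTwo * (1 / t₀)) := by
        rw [one_div, ← Real.sqrt_inv]
        congr 1
        field_simp
      rw [f1]
      refine Real.sqrt_le_iff.2 ⟨by positivity, ?_⟩
      calc 2 * D.lamTwo * (1 / t₀) ≤ 2 * y ^ r * (4 * y ^ (3 * r + 1)) := by gcongr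
        _ = 8 * y ^ (4 * r + 1) := by ring
        _ ≤ y ^ 3 * y ^ (4 * r + 1) := by gcongr
        _ = y ^ (4 * r + 4) := by ring
        _ ≤ y ^ ((4 * r + 4) * 2) := hypow (by lia)
        _ = (y ^ (4 * r + 4)) ^ 2 := pow_mul _ _ _
    have e2 : P ≤ c * y ^ (5 * r + 4) := by
      have f1 : U₁ / (D.lamOne * √(t₀ / (2 * D.lamTwo))) ≤ U₁ * y ^ (5 * r + 4) := by
        calc U₁ / (D.lamOne * √(t₀ / (2 * D.lamTwo)))
            = U₁ * ((1 / D.lamOne) * (1 / √(t₀ / (2 * D.lamTwo)))) := by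
              rw [one_div_mul_one_div]; ring
          _ ≤ U₁ * (y ^ r * y ^ (4 * r + 4)) := by gcongr
          _ = U₁ * y ^ (5 * r + 4) := by ring
      have f2 : √(ell : ℝ) ≤ y ^ (5 * r + 4) := by
        refine (Real.sqrt_le_self_iff.2 (.inr hl)).trans (hely.trans ?_)
        calc y = y ^ 1 := (pow_one y).symm
          _ ≤ _ := hypow (by lia)
      have f3 := mul_le_mul_of_nonneg_left f2 (by positivity : 0 ≤ 1 + 2 * U + m)
      have f4 := hy1 (5 * r + 4)
      rw [hP, hc]
      linarith
    have e3 : Real.log (8 * P) ≤ Real.log (8 * c) + (5 * r + 4) * Real.log y := by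
      have := Real.log_le_log (by positivity) (mul_le_mul_of_nonneg_left e2 (by norm_num : (0:ℝ) ≤ 8))
      rw [← mul_assoc, Real.log_mul (x := 8 * c) (by positivity) (by positivity),
        Real.log_pow] at this
      push_cast at this
      exact this
    have e4 : Real.log (8 * c) ≤ Real.log (8 * c) / Real.log 2 * Real.log y := by
      rw [div_mul_eq_mul_div, le_div_iff₀ hlog2]
      gcongr
    linarith
  have hkrt : 1 ≤ k * √ell := by nlinarith
  obtain ⟨N₁, hN₁, hhalt⟩ := exists_stop (s := fun n => (D.iterate t₀ n).s)
    (t := fun n => (D.iterate t₀ n).t) (ρ := 1 / (8 * (k * √ell))) (P := 8 * P)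
    (ε := 1 / (16 * √ell)) (t₀ := t₀) (Tf := 2 * ell / τ) rfl (fun n => (hn n).1.s_nonneg)
    (by positivity) (by rw [div_le_one (by positivity)]; linarith) (by positivity) (by positivity)
    (by rw [div_le_one (by positivity)]; linarith) htpos (by positivity)
    (fun n => fun h => ((hn n).2.of_pos h).2) (fun n => (hn n).2.of_zero)
    (fun n => monotone_nat_of_le_succ (f := fun n => (D.iterate t₀ n).t)
      (fun n => (hn n).2.t_le) (Nat.zero_le n))
  refine ⟨fun n => (hn n).1, ?_⟩
  classical
  have hex : ∃ N, (D.iterate t₀ N).s = 0 ∧ 2 * ell / τ ≤ (D.iterate t₀ N).t := ⟨N₁, hhalt⟩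
  refine ⟨Nat.find hex, ?_, Nat.find_spec hex, fun n hn => Nat.find_min hex hn,
    barrierRun_iterate hell htpos (fun n => (hn n).1) (fun n => (hn n).2) hτ
      (Nat.find_spec hex).1 (Nat.find_spec hex).2⟩
  have e1 : (Nat.find hex : ℝ) ≤ N₁ := by exact_mod_cast Nat.find_min' hex hhalt
  refine e1.trans (hN₁.trans ?_)
  have e2 : |Real.log (8 * P)| / (1 / (8 * (k * √ell))) ≤
      8 * k * (Real.log (8 * c) / Real.log 2 + (5 * r + 4)) * (√ell * Real.log y) := by
    rw [div_div_eq_mul_div, div_one]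
    calc _ ≤ (Real.log (8 * c) / Real.log 2 + (5 * r + 4)) * Real.log y * (8 * (k * √ell)) := by
          gcongr
      _ = _ := by ring
  have e3 : 2 * |Real.log (2 * ell / τ / t₀)| / (1 / (16 * √ell)) ≤
      32 * (3 * r + 5) * (√ell * Real.log y) := by
    rw [div_div_eq_mul_div, div_one]
    calc _ ≤ 2 * ((3 * r + 5) * Real.log y) * (16 * √ell) := by gcongr
      _ = _ := by ring
  have e4 : 3 ≤ 3 / Real.log 2 * (√ell * Real.log y) := by
    have : Real.log 2 ≤ √ell * Real.log y :=
      hL.trans (le_mul_of_one_le_left (hlog2.le.trans hL) hrt)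
    rw [div_mul_eq_mul_div, le_div_iff₀ hlog2]
    linarith
  linarith

end DualData

/-! ### Linear algebra as array programs -/

namespace Ex

instance : Add Ex := ⟨.op .add⟩
instance : Sub Ex := ⟨.op .sub⟩
instance : Mul Ex := ⟨.op .mul⟩
instance : Div Ex := ⟨.op .div⟩
instance (k : ℕ) : OfNat Ex k := ⟨.nat k⟩

section Eval

variable (I : Input) (e f : Ex) (n : ℕ) (ρ : ℕ → ℕ) (S : Store)

@[simp]
theorem eval_add : (e + f).eval I n ρ S = e.eval I n ρ S + f.eval I n ρ S := rfl

@[simp]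
theorem eval_sub : (e - f).eval I n ρ S = e.eval I n ρ S - f.eval I n ρ S := rfl

@[simp]
theorem eval_mul : (e * f).eval I n ρ S = e.eval I n ρ S * f.eval I n ρ S := rfl

@[simp]
theorem eval_div : (e / f).eval I n ρ S = e.eval I n ρ S / f.eval I n ρ S := rfl

end Eval

/-- The entry `(0, 0)` of the array `a`. -/
def scal (a : ℕ) : Ex := .ref a 1 1

/-- The entry of the array `a` in column `0`, with the row index that is bound at depth `i`. -/
def vec (a i : ℕ) : Ex := .ref a (3 + i) 1

/-- The entry of the array `a` with the indices that are bound at depths `i` and `j`. -/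
def mat (a i j : ℕ) : Ex := .ref a (3 + i) (3 + j)

end Ex

/-- The matrix in an array. -/
def matOf (ell : ℕ) (A : ℕ → ℕ → ℝ) : Matrix (Fin ell) (Fin ell) ℝ := .of fun i j => A i j

/-- The vector in column `0` of an array. -/
def vecOf (ell : ℕ) (A : ℕ → ℕ → ℝ) : Fin ell → ℝ := fun i => A i 0

/-- The number in the entry `(0, 0)` of an array. -/
def scalOf (A : ℕ → ℕ → ℝ) : ℝ := A 0 0

section Program

variable {I : Input} {ell : ℕ} {ρ : ℕ → ℕ} {S : Store}

theorem Ex.eval_sum (hρ : ρ 0 = ell) (e : Ex) (n : ℕ) :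
    (Ex.sum e).eval I n ρ S =
      ∑ k : Fin ell, e.eval I (n + 1) (Function.update ρ (3 + n) k) S := by
  rw [Ex.eval, hρ, Finset.sum_range]

theorem Stmt.den_seq (s t : Stmt) (n : ℕ) :
    (Stmt.seq s t).den I n ρ S = t.den I n ρ (s.den I n ρ S) := rfl

theorem Stmt.den_fill0 (a : ℕ) (e : Ex) (n : ℕ) :
    scalOf ((Stmt.fill0 a e).den I n ρ S a) = e.eval I n ρ S := by
  simp [scalOf, Stmt.den]

theorem Stmt.den_fill1 (hρ : ρ 0 = ell) (a : ℕ) (e : Ex) (n : ℕ) (i : Fin ell) :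
    vecOf ell ((Stmt.fill1 a e).den I n ρ S a) i =
      e.eval I (n + 1) (Function.update ρ (3 + n) i) S := by
  simp [vecOf, Stmt.den, hρ]

theorem Stmt.den_fill2 (hρ : ρ 0 = ell) (a : ℕ) (e : Ex) (n : ℕ) (i j : Fin ell) :
    matOf ell ((Stmt.fill2 a e).den I n ρ S a) i j =
      e.eval I (n + 2) (Function.update (Function.update ρ (3 + n) i) (4 + n) j) S := by
  simp [matOf, Stmt.den, hρ]

/-- One round of the computation of a generalized inverse, for the index in the register `3`. -/
def ginvRound (h g : ℕ) : Stmt :=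
  .seq (.fill1 15 (.ifLt (.reg 4) (.reg 3) 0 (.ifLt (.reg 3) (.reg 4) 0 1)
    - .sum (.mat g 1 2 * .mat h 2 0))) <|
  .seq (.fill0 16 (.ifLt 0 (.sum (.mat h 0 1 * .vec 15 1))
    (1 / .sum (.mat h 0 1 * .vec 15 1)) 0)) <|
  .seq (.fill2 14 (.mat g 1 2 + .scal 16 * (.vec 15 1 * .vec 15 2)))
    (.fill2 g (.mat 14 1 2))

/-- Write a generalized inverse of the matrix in the array `h` into the array `g`. -/
def ginvStmt (h g : ℕ) : Stmt := .seq (.fill2 g 0) (.rep (ginvRound h g))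

theorem den_ginvRound (hρ0 : ρ 0 = ell) (hρ1 : ρ 1 = 0) {h g : ℕ} (hg : g ∉ [14, 15, 16, h])
    (hh : h ∉ [14, 15, 16]) (k : Fin ell) (hρ3 : ρ 3 = k) :
    matOf ell ((ginvRound h g).den I 1 ρ S g) =
      ginvStep (matOf ell (S h)) (matOf ell (S g)) k := by
  simp only [List.mem_cons, List.not_mem_nil, or_false, not_or] at hg hh
  set H := matOf ell (S h) with hH
  set G := matOf ell (S g) with hG
  simp only [ginvRound, Stmt.den_seq]
  set S₁ := (Stmt.fill1 15 (.ifLt (.reg 4) (.reg 3) 0 (.ifLt (.reg 3) (.reg 4) 0 1)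
    - .sum (.mat g 1 2 * .mat h 2 0))).den I 1 ρ S with hS₁
  have k₁ : ∀ x, x ≠ 15 → S₁ x = S x := fun x hx => Function.update_of_ne hx _ _
  have v₁ : vecOf ell (S₁ 15) = ginvDir H G k := by
    ext i
    rw [hS₁, Stmt.den_fill1 hρ0, ginvDir, Pi.sub_apply]
    change Ex.eval I (.ifLt _ _ _ _) 2 _ S - Ex.eval I (.sum _) 2 _ S = _
    rw [Ex.eval_sum (by simpa using hρ0)]
    congr 1
    · rcases lt_trichotomy i k with hik | rfl | hik
      · have : (i : ℕ) < k := hik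
        simp [Ex.eval, hρ3, hik.ne, this]
      · simp [Ex.eval, hρ3]
      · have : (k : ℕ) < i := hik
        simp [Ex.eval, hρ3, hik.ne', this, this.not_gt]
    · rw [Matrix.mulVec_single_one, Matrix.mulVec, dotProduct]
      refine Finset.sum_congr rfl fun m _ => ?_
      simp [Ex.mat, Ex.eval, ArithOp.eval, hρ3, hG, hH, matOf]
  clear_value S₁
  set S₂ := (Stmt.fill0 16 (.ifLt 0 (.sum (.mat h 0 1 * .vec 15 1))
    (1 / .sum (.mat h 0 1 * .vec 15 1)) 0)).den I 1 ρ S₁ with hS₂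
  have k₂ : ∀ x, x ≠ 16 → S₂ x = S₁ x := fun x hx => Function.update_of_ne hx _ _
  have v₂ : scalOf (S₂ 16) = if 0 < (H *ᵥ ginvDir H G k) k then
      1 / (H *ᵥ ginvDir H G k) k else 0 := by
    have hd : (Ex.sum (.mat h 0 1 * .vec 15 1)).eval I 1 ρ S₁ = (H *ᵥ ginvDir H G k) k := by
      rw [Ex.eval_sum hρ0, ← v₁, Matrix.mulVec, dotProduct]
      refine Finset.sum_congr rfl fun m _ => ?_
      simp [Ex.mat, Ex.vec, Ex.eval, ArithOp.eval, hρ3, hρ1, hH, matOf, vecOf, k₁ h hh.2.1]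
    rw [hS₂, Stmt.den_fill0, Ex.eval]
    change (if Ex.eval I (.nat 0) 1 ρ S₁ < _ then Ex.eval I (.nat 1) 1 ρ S₁ / _ else
      Ex.eval I (.nat 0) 1 ρ S₁) = _
    rw [hd]
    simp only [Ex.eval, Nat.cast_zero, Nat.cast_one]
  clear_value S₂
  set S₃ := (Stmt.fill2 14 (.mat g 1 2 + .scal 16 * (.vec 15 1 * .vec 15 2))).den I 1 ρ S₂ with hS₃
  have v₃ : matOf ell (S₃ 14) = ginvStep H G k := by
    ext i j
    rw [hS₃, Stmt.den_fill2 hρ0, ginvStep, Matrix.add_apply, Matrix.smul_apply, ← v₂, ← v₁,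
      Matrix.vecMulVec_apply]
    simp [Ex.mat, Ex.vec, Ex.scal, Ex.eval, ArithOp.eval, hρ1, hG, matOf, vecOf, scalOf,
      k₂ g hg.2.2.1, k₁ g hg.2.1, k₂ 15 (by decide)]
  clear_value S₃
  ext i j
  rw [← v₃]
  rw [Stmt.den_fill2 hρ0]
  simp [Ex.mat, Ex.eval, matOf]

theorem ginvRound_keeps {h g x : ℕ} (hx : x ∉ [14, 15, 16, g]) :
    (ginvRound h g).keeps x = true := by
  simp only [List.mem_cons, List.not_mem_nil, or_false, not_or] at hx
  simp [ginvRound, Stmt.keeps, Ne.symm hx.1, Ne.symm hx.2.1, Ne.symm hx.2.2.1, Ne.symm hx.2.2.2]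

theorem den_ginvStmt (hρ0 : ρ 0 = ell) (hρ1 : ρ 1 = 0) {h g : ℕ} (hg : g ∉ [14, 15, 16, h])
    (hh : h ∉ [14, 15, 16, g]) :
    matOf ell ((ginvStmt h g).den I 0 ρ S g) = ginv (matOf ell (S h)) := by
  have hh' : h ∉ [14, 15, 16] := fun hc => hh (by simp at hc ⊢; tauto)
  have hgh : h ≠ g := fun hc => hh (by simp [hc])
  simp only [ginvStmt, Stmt.den, hρ0]
  set S₁ : Store := Function.update S g fun i j =>
    if i < ell ∧ j < ell then
      Ex.eval I 0 2 (Function.update (Function.update ρ (3 + 0) i) (4 + 0) j) S else S g i j with hS₁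
  have key : ∀ k ≤ ell,
      matOf ell (Nat.rec (motive := fun _ => Store) S₁ (fun k S' =>
        (ginvRound h g).den I (0 + 1) (Function.update ρ (3 + 0) k) S') k g) =
        ginvAux (matOf ell (S h)) k ∧
      Nat.rec (motive := fun _ => Store) S₁ (fun k S' =>
        (ginvRound h g).den I (0 + 1) (Function.update ρ (3 + 0) k) S') k h = S h := by
    intro k
    induction k with
    | zero =>
      intro _
      refine ⟨?_, Function.update_of_ne hgh _ _⟩
      ext i j
      simp [hS₁, matOf, ginvAux, Ex.eval]
    | succ k ih =>
      intro hk
      obtain ⟨h1, h2⟩ := ih (by lia)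
      refine ⟨?_, (Stmt.den_of_keeps I _ (ginvRound_keeps hh)).trans h2⟩
      rw [ginvAux, dif_pos (by lia), ← h1, ← h2]
      exact den_ginvRound (by simpa using hρ0) (by simpa using hρ1) hg hh' ⟨k, by lia⟩ (by simp)
  exact (key ell le_rfl).1

/-- The product of the matrices in the arrays `a` and `b`. -/
def mulStmt (a b c : ℕ) : Stmt := .fill2 c (.sum (.mat a 0 2 * .mat b 2 1))

theorem den_mulStmt (hρ0 : ρ 0 = ell) (a b c : ℕ) :
    matOf ell ((mulStmt a b c).den I 0 ρ S c) = matOf ell (S a) * matOf ell (S b) := by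
  ext i j
  rw [mulStmt, Stmt.den_fill2 hρ0, Ex.eval_sum (by simpa using hρ0), Matrix.mul_apply]
  refine Finset.sum_congr rfl fun m _ => ?_
  simp [Ex.mat, Ex.eval, ArithOp.eval, matOf]

end Program

/-! ### The program -/

/-!
The arrays of the program: `0`, `1`, `2` hold the dual point and the coefficients of the primal
point; `3` to `6`, `10`, `11` hold the constants of a run, see `Consts.Stored`; `7` and `8` hold
the weight and the tilt, and `9` the flag that keeps the loop going. The arrays `12` to `29` hold
intermediate results, and the array `30` is never written, so that its entry `(0, 0)` is zero.
-/

/-- The constants of a run of the program: the kernel matrix, the quadratic and the linear part of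
the dual objective, the direction of the tilt, `λ₁`, and the weight at which to stop. -/
structure Consts (ell : ℕ) where
  K : Matrix (Fin ell) (Fin ell) ℝ
  Q : Matrix (Fin ell) (Fin ell) ℝ
  b : Fin ell → ℝ
  e : Fin ell → ℝ
  lam : ℝ
  tEnd : ℝ

namespace Consts

variable {ell : ℕ} (c : Consts ell)

/-- The Hessian of the barrier function, in terms of the kernel matrix. -/
def hess (γ : Fin ell → ℝ) (t : ℝ) : Matrix (Fin ell) (Fin ell) ℝ :=
  .of fun i j => t * c.Q i j + kerGram c.K c.lam γ i j * kerGram c.K c.lam γ i j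

/-- The gradient of the barrier function, in terms of the kernel matrix. -/
def grad (γ : Fin ell → ℝ) (t : ℝ) : Fin ell → ℝ :=
  fun i => t * ((c.Q *ᵥ γ) i + c.b i) - kerGram c.K c.lam γ i i

/-- A round of the iteration, in terms of the kernel matrix. -/
def next (x : Iter ell) : Iter ell := x.next (c.hess x.γ) (c.grad x.γ) c.e

/-- The array contents when the iteration is at `x`. -/
structure Stored (x : Iter ell) (S : Store) : Prop where
  γ : vecOf ell (S 0) = x.γ
  K : matOf ell (S 3) = c.K
  Q : matOf ell (S 4) = c.Q
  b : vecOf ell (S 5) = c.b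
  lam : scalOf (S 6) = c.lam
  t : scalOf (S 7) = x.t
  s : scalOf (S 8) = x.s
  tEnd : scalOf (S 10) = c.tEnd
  e : vecOf ell (S 11) = c.e
  zero : scalOf (S 30) = 0

variable {c} {x : Iter ell} {S S' : Store}

theorem Stored.congr (h : c.Stored x S)
    (h' : ∀ a ∈ [0, 3, 4, 5, 6, 7, 8, 10, 11, 30], S' a = S a) : c.Stored x S' where
  γ := by rw [h' 0 (by decide), h.γ]
  K := by rw [h' 3 (by decide), h.K]
  Q := by rw [h' 4 (by decide), h.Q]
  b := by rw [h' 5 (by decide), h.b]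
  lam := by rw [h' 6 (by decide), h.lam]
  t := by rw [h' 7 (by decide), h.t]
  s := by rw [h' 8 (by decide), h.s]
  tEnd := by rw [h' 10 (by decide), h.tEnd]
  e := by rw [h' 11 (by decide), h.e]
  zero := by rw [h' 30 (by decide), h.zero]

end Consts

/-- Compute `Consts.K * ginv (kerSlack _ _ _)` (array `20`) and `kerGram` (array `17`). -/
def gramStmt : Stmt :=
  .seq (.fill2 12 (.scal 6 * .mat 3 0 1 + .sum (.mat 3 0 2 * .vec 0 2 * .mat 3 2 1))) <|
  .seq (ginvStmt 12 13) (.seq (mulStmt 3 13 20) (mulStmt 20 3 17))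

/-- Compute the weight of the next step. -/
def weightStmt : Stmt :=
  .seq (.fill0 26 (.ifLt 0 (.scal 8) (.scal 7) (.scal 7 * (1 + 1 / (16 * .sqrt (.reg 0))))))
    (.fill0 7 (.scal 26))

/-- Compute the Hessian (array `18`) and a generalized inverse of it (array `19`). -/
def hessStmt : Stmt :=
  .seq (.fill2 18 (.scal 7 * .mat 4 0 1 + .mat 17 0 1 * .mat 17 0 1)) (ginvStmt 18 19)

/-- Compute the gradient (array `21`). -/
def gradStmt : Stmt :=
  .fill1 21 (.scal 7 * (.sum (.mat 4 0 1 * .vec 0 1) + .vec 5 0) - .mat 17 0 0)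

/-- Compute the tilt of the next step. -/
def tiltStmt : Stmt :=
  .seq (.fill0 22 (.sqrt (.sum (.vec 11 0 * .sum (.mat 19 0 1 * .vec 11 1))))) <|
  .seq (.fill0 26 (.ifLt (1 / 8) (.scal 8 * .scal 22) (.scal 8 - 1 / 8 / .scal 22) 0))
    (.fill0 8 (.scal 26))

/-- Compute the Newton direction for the vector in the array `a` (array `24`). -/
def dirStmt (a : ℕ) : Stmt := .fill1 24 (0 - .sum (.mat 19 0 1 * .vec a 1))

/-- Take a damped Newton step. -/
def stepStmt : Stmt :=
  .seq (.fill1 23 (.vec 21 0 - .scal 8 * .vec 11 0)) <|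
  .seq (dirStmt 23) <|
  .seq (.fill0 25 (1 / (1 + .sqrt (0 - .sum (.vec 23 0 * .vec 24 0))))) <|
  .seq (.fill1 27 (.vec 0 0 + .scal 25 * .vec 24 0)) (.fill1 0 (.vec 27 0))

/-- Set the flag (array `9`) to `1` if there is another round to come. -/
def flagStmt : Stmt := .fill0 9 (.ifLt 0 (.scal 8) 1 (.ifLt (.scal 7) (.scal 10) 1 0))

/-- A round of the iteration. -/
def roundStmt : Stmt :=
  .seq gramStmt <| .seq weightStmt <| .seq hessStmt <| .seq gradStmt <| .seq tiltStmt <|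
  .seq stepStmt flagStmt

/-- Compute the coefficients of the primal solution (arrays `1` and `2`). -/
def recoverStmt : Stmt :=
  .seq gramStmt <| .seq hessStmt <| .seq gradStmt <| .seq (dirStmt 21) <|
  .seq (.fill1 1 (.vec 0 0 + .vec 24 0)) <| .seq (mulStmt 13 3 14)
    (.fill2 2 (1 / .scal 7 * (.mat 13 0 1 - .sum (.mat 14 0 2 * .vec 24 2 * .mat 20 2 1))))

section Program

variable {I : Input} {ell : ℕ} {ρ : ℕ → ℕ} {S : Store} {c : Consts ell} {x : Iter ell}

theorem den_gramStmt (hρ0 : ρ 0 = ell) (hρ1 : ρ 1 = 0) (h : c.Stored x S) :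
    let S' := gramStmt.den I 0 ρ S
    c.Stored x S' ∧ matOf ell (S' 13) = ginv (kerSlack c.K c.lam x.γ) ∧
      matOf ell (S' 20) = c.K * ginv (kerSlack c.K c.lam x.γ) ∧
      matOf ell (S' 17) = kerGram c.K c.lam x.γ := by
  intro S'
  refine ⟨h.congr fun a ha => Stmt.den_of_keeps I _ ?_, ?_⟩
  · revert a; decide
  simp only [S', gramStmt, Stmt.den_seq]
  set S₁ := (Stmt.fill2 12 (.scal 6 * .mat 3 0 1 +
    .sum (.mat 3 0 2 * .vec 0 2 * .mat 3 2 1))).den I 0 ρ S with hS₁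
  have v₁ : matOf ell (S₁ 12) = kerSlack c.K c.lam x.γ := by
    ext i j
    rw [hS₁, Stmt.den_fill2 hρ0]
    change Ex.eval I _ 2 _ S + Ex.eval I (.sum _) 2 _ S = _
    rw [Ex.eval_sum (by simpa using hρ0), kerSlack, Matrix.add_apply, Matrix.mul_apply, ← h.K,
      ← h.lam, ← h.γ]
    congr 1
    · simp [Ex.mat, Ex.scal, Ex.eval, ArithOp.eval, matOf, scalOf, hρ1]
    · refine Finset.sum_congr rfl fun m _ => ?_
      simp [Ex.mat, Ex.vec, Ex.eval, ArithOp.eval, matOf, vecOf, hρ1]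
  have k₁ : S₁ 3 = S 3 := Stmt.den_of_keeps I _ rfl
  clear_value S₁
  have k₂ : (ginvStmt 12 13).den I 0 ρ S₁ 3 = S₁ 3 := Stmt.den_of_keeps I _ rfl
  have v₂ := den_ginvStmt (I := I) (S := S₁) hρ0 hρ1 (h := 12) (g := 13) (by decide) (by decide)
  rw [v₁] at v₂
  set S₂ := (ginvStmt 12 13).den I 0 ρ S₁
  clear_value S₂
  have v₃ := den_mulStmt (I := I) (S := S₂) hρ0 3 13 20
  rw [k₂, k₁, h.K, v₂] at v₃
  have k₃ : (mulStmt 3 13 20).den I 0 ρ S₂ 3 = S₂ 3 := Stmt.den_of_keeps I _ rfl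
  have k₃' : (mulStmt 3 13 20).den I 0 ρ S₂ 13 = S₂ 13 := Stmt.den_of_keeps I _ rfl
  set S₃ := (mulStmt 3 13 20).den I 0 ρ S₂
  clear_value S₃
  have k₄ : (mulStmt 20 3 17).den I 0 ρ S₃ 13 = S₃ 13 := Stmt.den_of_keeps I _ rfl
  have k₄' : (mulStmt 20 3 17).den I 0 ρ S₃ 20 = S₃ 20 := Stmt.den_of_keeps I _ rfl
  refine ⟨by rw [k₄, k₃', v₂], by rw [k₄', v₃], ?_⟩
  rw [den_mulStmt hρ0, v₃, k₃, k₂, k₁, h.K, kerGram]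

theorem den_weightStmt (hρ0 : ρ 0 = ell) (hρ1 : ρ 1 = 0) (h : c.Stored x S) :
    c.Stored ⟨x.γ, x.nextT, x.s⟩ (weightStmt.den I 0 ρ S) := by
  have k : ∀ a, weightStmt.keeps a = true → weightStmt.den I 0 ρ S a = S a :=
    fun a => Stmt.den_of_keeps I _
  refine ⟨(k 0 rfl).symm ▸ h.γ, (k 3 rfl).symm ▸ h.K, (k 4 rfl).symm ▸ h.Q, (k 5 rfl).symm ▸ h.b,
    (k 6 rfl).symm ▸ h.lam, ?_, (k 8 rfl).symm ▸ h.s, (k 10 rfl).symm ▸ h.tEnd,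
    (k 11 rfl).symm ▸ h.e, (k 30 rfl).symm ▸ h.zero⟩
  rw [weightStmt, Stmt.den_seq, Stmt.den_fill0, Iter.nextT, ← h.t, ← h.s]
  simp [Stmt.den, Ex.scal, Ex.eval, ArithOp.eval, scalOf, hρ0, hρ1]

theorem den_hessStmt (hρ0 : ρ 0 = ell) (hρ1 : ρ 1 = 0) (h : c.Stored x S) {γ : Fin ell → ℝ}
    (hM : matOf ell (S 17) = kerGram c.K c.lam γ) :
    let S' := hessStmt.den I 0 ρ S
    c.Stored x S' ∧ matOf ell (S' 19) = ginv (c.hess γ x.t) := by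
  intro S'
  refine ⟨h.congr fun a ha => Stmt.den_of_keeps I _ ?_, ?_⟩
  · revert a; decide
  simp only [S', hessStmt, Stmt.den_seq]
  rw [den_ginvStmt hρ0 hρ1 (by decide) (by decide)]
  congr 1
  ext i j
  rw [Stmt.den_fill2 hρ0, Consts.hess, Matrix.of_apply, ← hM, ← h.t, ← h.Q]
  simp [Ex.mat, Ex.scal, Ex.eval, ArithOp.eval, matOf, scalOf, hρ1]

theorem den_gradStmt (hρ0 : ρ 0 = ell) (hρ1 : ρ 1 = 0) (h : c.Stored x S)
    (hM : matOf ell (S 17) = kerGram c.K c.lam x.γ) :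
    let S' := gradStmt.den I 0 ρ S
    c.Stored x S' ∧ vecOf ell (S' 21) = c.grad x.γ x.t := by
  intro S'
  refine ⟨h.congr fun a ha => Stmt.den_of_keeps I _ ?_, ?_⟩
  · revert a; decide
  ext i
  simp only [S', gradStmt]
  rw [Stmt.den_fill1 hρ0]
  have h1 : Ex.eval I (.sum (.mat 4 0 1 * .vec 0 1)) 1 (Function.update ρ (3 + 0) i) S =
      (c.Q *ᵥ x.γ) i := by
    rw [Ex.eval_sum (by simpa using hρ0), ← h.Q, ← h.γ]
    refine Finset.sum_congr rfl fun m _ => ?_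
    simp [Ex.mat, Ex.vec, Ex.eval, ArithOp.eval, matOf, vecOf, hρ1]
  change Ex.eval I (.scal 7) 1 _ S * (Ex.eval I (.sum _) 1 _ S + Ex.eval I (.vec 5 0) 1 _ S) -
    Ex.eval I (.mat 17 0 0) 1 _ S = _
  rw [h1, Consts.grad, ← hM, ← h.t, ← h.b]
  simp [Ex.mat, Ex.vec, Ex.scal, Ex.eval, matOf, vecOf, scalOf, hρ1]

theorem den_tiltStmt (hρ0 : ρ 0 = ell) (hρ1 : ρ 1 = 0) (h : c.Stored x S)
    {G : Matrix (Fin ell) (Fin ell) ℝ} (hG : matOf ell (S 19) = G) :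
    c.Stored ⟨x.γ, x.t, x.nextS √(c.e ⬝ᵥ (G *ᵥ c.e))⟩ (tiltStmt.den I 0 ρ S) := by
  have k : ∀ a, tiltStmt.keeps a = true → tiltStmt.den I 0 ρ S a = S a :=
    fun a => Stmt.den_of_keeps I _
  refine ⟨(k 0 rfl).symm ▸ h.γ, (k 3 rfl).symm ▸ h.K, (k 4 rfl).symm ▸ h.Q, (k 5 rfl).symm ▸ h.b,
    (k 6 rfl).symm ▸ h.lam, (k 7 rfl).symm ▸ h.t, ?_, (k 10 rfl).symm ▸ h.tEnd,
    (k 11 rfl).symm ▸ h.e, (k 30 rfl).symm ▸ h.zero⟩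
  rw [tiltStmt, Stmt.den_seq, Stmt.den_seq]
  set S₁ := (Stmt.fill0 22 (.sqrt (.sum (.vec 11 0 * .sum (.mat 19 0 1 * .vec 11 1))))).den I 0 ρ S
    with hS₁
  have v₁ : scalOf (S₁ 22) = √(c.e ⬝ᵥ (G *ᵥ c.e)) := by
    rw [hS₁, Stmt.den_fill0, Ex.eval, Ex.eval_sum hρ0]
    congr 1
    refine Finset.sum_congr rfl fun i _ => ?_
    change Ex.eval I (.vec 11 0) 1 _ S * Ex.eval I (.sum _) 1 _ S = _
    rw [Ex.eval_sum (by simpa using hρ0), Matrix.mulVec, dotProduct, ← h.e, ← hG]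
    congr 1
    · simp [Ex.vec, Ex.eval, vecOf, hρ1]
    · refine Finset.sum_congr rfl fun m _ => ?_
      simp [Ex.mat, Ex.vec, Ex.eval, ArithOp.eval, matOf, vecOf, hρ1]
  have k₁ : S₁ 8 = S 8 := Stmt.den_of_keeps I _ rfl
  clear_value S₁
  rw [Stmt.den_fill0, Iter.nextS, ← v₁, ← h.s, ← k₁]
  simp [Stmt.den, Ex.scal, Ex.eval, ArithOp.eval, scalOf, hρ1]

theorem den_dirStmt (hρ0 : ρ 0 = ell) (hρ1 : ρ 1 = 0) {H : Matrix (Fin ell) (Fin ell) ℝ}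
    (hG : matOf ell (S 19) = ginv H) (a : ℕ) :
    vecOf ell ((dirStmt a).den I 0 ρ S 24) = Iter.newtonDir H (vecOf ell (S a)) := by
  ext i
  rw [dirStmt, Stmt.den_fill1 hρ0, Iter.newtonDir, ← hG]
  change Ex.eval I (.nat 0) 1 _ S - Ex.eval I (.sum _) 1 _ S = _
  rw [Ex.eval_sum (by simpa using hρ0), Pi.neg_apply, Matrix.mulVec, dotProduct, Ex.eval,
    Nat.cast_zero, zero_sub]
  congr 1
  refine Finset.sum_congr rfl fun m _ => ?_
  simp [Ex.mat, Ex.vec, Ex.eval, ArithOp.eval, matOf, vecOf, hρ1]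

theorem den_stepStmt (hρ0 : ρ 0 = ell) (hρ1 : ρ 1 = 0) (h : c.Stored x S)
    {H : Matrix (Fin ell) (Fin ell) ℝ} (hG : matOf ell (S 19) = ginv H) {g : Fin ell → ℝ}
    (hg : vecOf ell (S 21) = g) {r p : Fin ell → ℝ} (hr : r = g - x.s • c.e)
    (hp : p = Iter.newtonDir H r) :
    c.Stored ⟨x.γ + (1 / (1 + √(-(r ⬝ᵥ p)))) • p, x.t, x.s⟩ (stepStmt.den I 0 ρ S) := by
  have k : ∀ a, stepStmt.keeps a = true → stepStmt.den I 0 ρ S a = S a :=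
    fun a => Stmt.den_of_keeps I _
  refine ⟨?_, (k 3 rfl).symm ▸ h.K, (k 4 rfl).symm ▸ h.Q, (k 5 rfl).symm ▸ h.b,
    (k 6 rfl).symm ▸ h.lam, (k 7 rfl).symm ▸ h.t, (k 8 rfl).symm ▸ h.s, (k 10 rfl).symm ▸ h.tEnd,
    (k 11 rfl).symm ▸ h.e, (k 30 rfl).symm ▸ h.zero⟩
  rw [stepStmt, Stmt.den_seq, Stmt.den_seq, Stmt.den_seq, Stmt.den_seq]
  set S₁ := (Stmt.fill1 23 (.vec 21 0 - .scal 8 * .vec 11 0)).den I 0 ρ S with hS₁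
  have v₁ : vecOf ell (S₁ 23) = r := by
    ext i
    rw [hS₁, Stmt.den_fill1 hρ0, hr, ← hg, ← h.s, ← h.e]
    simp [Ex.vec, Ex.scal, Ex.eval, ArithOp.eval, vecOf, scalOf, hρ1]
  have k₁ : S₁ 0 = S 0 := Stmt.den_of_keeps I _ rfl
  have k₁' : S₁ 19 = S 19 := Stmt.den_of_keeps I _ rfl
  clear_value S₁
  have v₂ := den_dirStmt (I := I) hρ0 hρ1 (S := S₁) (k₁'.symm ▸ hG) 23
  rw [v₁, ← hp] at v₂
  have k₂ : (dirStmt 23).den I 0 ρ S₁ 0 = S₁ 0 := Stmt.den_of_keeps I _ rfl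
  have k₂' : (dirStmt 23).den I 0 ρ S₁ 23 = S₁ 23 := Stmt.den_of_keeps I _ rfl
  set S₂ := (dirStmt 23).den I 0 ρ S₁
  clear_value S₂
  set S₃ := (Stmt.fill0 25 (1 / (1 + .sqrt (0 - .sum (.vec 23 0 * .vec 24 0))))).den I 0 ρ S₂
    with hS₃
  have v₃ : scalOf (S₃ 25) = 1 / (1 + √(-(r ⬝ᵥ p))) := by
    have h1 : Ex.eval I (.sum (.vec 23 0 * .vec 24 0)) 0 ρ S₂ = r ⬝ᵥ p := by
      rw [Ex.eval_sum hρ0, ← v₁, ← k₂', ← v₂]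
      refine Finset.sum_congr rfl fun m _ => ?_
      simp [Ex.vec, Ex.eval, ArithOp.eval, vecOf, hρ1]
    rw [hS₃, Stmt.den_fill0]
    change Ex.eval I (.nat 1) 0 ρ S₂ / (Ex.eval I (.nat 1) 0 ρ S₂ + √(Ex.eval I (.nat 0) 0 ρ S₂ -
      Ex.eval I (.sum _) 0 ρ S₂)) = _
    rw [h1]
    simp [Ex.eval]
  have k₃ : S₃ 0 = S₂ 0 := Stmt.den_of_keeps I _ rfl
  have k₃' : S₃ 24 = S₂ 24 := Stmt.den_of_keeps I _ rfl
  clear_value S₃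
  ext i
  change vecOf ell (Stmt.den I _ 0 ρ _ 0) i = x.γ i + (1 / (1 + √(-(r ⬝ᵥ p)))) * p i
  rw [Stmt.den_fill1 hρ0, ← v₃, ← v₂, ← k₃', ← h.γ, ← k₁, ← k₂, ← k₃]
  simp [Stmt.den, Ex.vec, Ex.scal, Ex.eval, ArithOp.eval, vecOf, scalOf, hρ0, hρ1]

open Classical in
theorem den_flagStmt (hρ1 : ρ 1 = 0) (h : c.Stored x S) :
    c.Stored x (flagStmt.den I 0 ρ S) ∧ scalOf (flagStmt.den I 0 ρ S 9) =
      if 0 < x.s ∨ x.t < c.tEnd then 1 else 0 := by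
  refine ⟨h.congr fun a ha => Stmt.den_of_keeps I _ ?_, ?_⟩
  · revert a; decide
  rw [flagStmt, Stmt.den_fill0, ← h.s, ← h.t, ← h.tEnd]
  by_cases h1 : 0 < scalOf (S 8)
  · simp [Ex.scal, Ex.eval, hρ1, scalOf, show 0 < S 8 0 0 from h1]
  · simp [Ex.scal, Ex.eval, hρ1, scalOf, show ¬ 0 < S 8 0 0 from h1]

open Classical in
theorem den_roundStmt (hρ0 : ρ 0 = ell) (hρ1 : ρ 1 = 0) (h : c.Stored x S) :
    c.Stored (c.next x) (roundStmt.den I 0 ρ S) ∧ scalOf (roundStmt.den I 0 ρ S 9) =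
      if 0 < (c.next x).s ∨ (c.next x).t < c.tEnd then 1 else 0 := by
  simp only [roundStmt, Stmt.den_seq]
  obtain ⟨h₁, -, -, v₁⟩ := den_gramStmt (I := I) hρ0 hρ1 h
  set S₁ := gramStmt.den I 0 ρ S
  clear_value S₁
  have h₂ := den_weightStmt (I := I) hρ0 hρ1 h₁
  have k₂ : weightStmt.den I 0 ρ S₁ 17 = S₁ 17 := Stmt.den_of_keeps I _ rfl
  set S₂ := weightStmt.den I 0 ρ S₁
  clear_value S₂
  have v₂ : matOf ell (S₂ 17) = kerGram c.K c.lam x.γ := by rw [k₂, v₁]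
  obtain ⟨h₃, v₃⟩ := den_hessStmt (I := I) hρ0 hρ1 h₂ v₂
  have k₃ : hessStmt.den I 0 ρ S₂ 17 = S₂ 17 := Stmt.den_of_keeps I _ rfl
  set S₃ := hessStmt.den I 0 ρ S₂
  clear_value S₃
  obtain ⟨h₄, v₄⟩ := den_gradStmt (I := I) hρ0 hρ1 h₃ (by rw [k₃, v₂])
  have k₄ : gradStmt.den I 0 ρ S₃ 19 = S₃ 19 := Stmt.den_of_keeps I _ rfl
  set S₄ := gradStmt.den I 0 ρ S₃
  clear_value S₄
  have h₅ := den_tiltStmt (I := I) hρ0 hρ1 h₄ (by rw [k₄, v₃])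
  have k₅ : tiltStmt.den I 0 ρ S₄ 19 = S₄ 19 := Stmt.den_of_keeps I _ rfl
  have k₅' : tiltStmt.den I 0 ρ S₄ 21 = S₄ 21 := Stmt.den_of_keeps I _ rfl
  set S₅ := tiltStmt.den I 0 ρ S₄
  clear_value S₅
  have h₆ := den_stepStmt (I := I) hρ0 hρ1 h₅ (by rw [k₅, k₄, v₃]) (by rw [k₅', v₄]) rfl rfl
  exact den_flagStmt hρ1 h₆

theorem den_recoverStmt (hρ0 : ρ 0 = ell) (hρ1 : ρ 1 = 0) (h : c.Stored x S) {p : Fin ell → ℝ}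
    (hp : p = Iter.newtonDir (c.hess x.γ x.t) (c.grad x.γ x.t)) :
    let S' := recoverStmt.den I 0 ρ S
    vecOf ell (S' 0) = x.γ ∧ vecOf ell (S' 1) = x.γ + p ∧
      matOf ell (S' 2) = primalCoeff c.K c.lam x.γ p x.t := by
  intro S'
  refine ⟨?_, ?_⟩
  · have : S' 0 = S 0 := Stmt.den_of_keeps I _ rfl
    rw [this, h.γ]
  simp only [S', recoverStmt, Stmt.den_seq]
  obtain ⟨h₁, v₁, w₁, u₁⟩ := den_gramStmt (I := I) hρ0 hρ1 h
  set S₁ := gramStmt.den I 0 ρ S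
  clear_value S₁
  obtain ⟨h₂, v₂⟩ := den_hessStmt (I := I) hρ0 hρ1 h₁ u₁
  have k₂ : hessStmt.den I 0 ρ S₁ 17 = S₁ 17 := Stmt.den_of_keeps I _ rfl
  have k₂' : hessStmt.den I 0 ρ S₁ 13 = S₁ 13 := Stmt.den_of_keeps I _ rfl
  have k₂'' : hessStmt.den I 0 ρ S₁ 20 = S₁ 20 := Stmt.den_of_keeps I _ rfl
  set S₂ := hessStmt.den I 0 ρ S₁
  clear_value S₂
  obtain ⟨h₃, v₃⟩ := den_gradStmt (I := I) hρ0 hρ1 h₂ (by rw [k₂, u₁])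
  have k₃ : gradStmt.den I 0 ρ S₂ 19 = S₂ 19 := Stmt.den_of_keeps I _ rfl
  have k₃' : gradStmt.den I 0 ρ S₂ 13 = S₂ 13 := Stmt.den_of_keeps I _ rfl
  have k₃'' : gradStmt.den I 0 ρ S₂ 20 = S₂ 20 := Stmt.den_of_keeps I _ rfl
  set S₃ := gradStmt.den I 0 ρ S₂
  clear_value S₃
  have v₄ := den_dirStmt (I := I) (S := S₃) hρ0 hρ1 (by rw [k₃, v₂]) 21
  rw [v₃, ← hp] at v₄
  have k₄ : ∀ a, (dirStmt 21).keeps a = true → (dirStmt 21).den I 0 ρ S₃ a = S₃ a :=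
    fun a => Stmt.den_of_keeps I _
  set S₄ := (dirStmt 21).den I 0 ρ S₃
  clear_value S₄
  set S₅ := (Stmt.fill1 1 (.vec 0 0 + .vec 24 0)).den I 0 ρ S₄ with hS₅
  have v₅ : vecOf ell (S₅ 1) = x.γ + p := by
    ext i
    rw [hS₅, Stmt.den_fill1 hρ0, Pi.add_apply, ← v₄, ← h₃.γ, ← k₄ 0 rfl]
    simp [Ex.vec, Ex.eval, ArithOp.eval, vecOf, hρ1]
  have k₅ : ∀ a, a ≠ 1 → S₅ a = S₄ a := fun a ha => Function.update_of_ne ha _ _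
  clear_value S₅
  have v₆ := den_mulStmt (I := I) (S := S₅) hρ0 13 3 14
  have k₆ : ∀ a, a ≠ 14 → (mulStmt 13 3 14).den I 0 ρ S₅ a = S₅ a :=
    fun a ha => Function.update_of_ne ha _ _
  set S₆ := (mulStmt 13 3 14).den I 0 ρ S₅
  clear_value S₆
  have w₁₃ : matOf ell (S₅ 13) = ginv (kerSlack c.K c.lam x.γ) := by
    rw [k₅ 13 (by decide), k₄ 13 rfl, k₃', k₂', v₁]
  have w₃ : matOf ell (S₅ 3) = c.K := by rw [k₅ 3 (by decide), k₄ 3 rfl, h₃.K]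
  have w₂₀ : matOf ell (S₆ 20) = c.K * ginv (kerSlack c.K c.lam x.γ) := by
    rw [k₆ 20 (by decide), k₅ 20 (by decide), k₄ 20 rfl, k₃'', k₂'', w₁]
  have w₂₄ : vecOf ell (S₆ 24) = p := by
    rw [k₆ 24 (by decide), k₅ 24 (by decide), v₄]
  have w₇ : scalOf (S₆ 7) = x.t := by
    rw [k₆ 7 (by decide), k₅ 7 (by decide), k₄ 7 rfl, h₃.t]
  rw [w₁₃, w₃] at v₆
  refine ⟨?_, ?_⟩
  · have : ∀ (e : Ex) (T : Store), (Stmt.fill2 2 e).den I 0 ρ T 1 = T 1 :=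
      fun e T => Stmt.den_of_keeps I _ rfl
    rw [this, k₆ 1 (by decide), v₅]
  · ext i j
    have h1 : Ex.eval I (.sum (.mat 14 0 2 * .vec 24 2 * .mat 20 2 1)) 2
        (Function.update (Function.update ρ (3 + 0) i) (4 + 0) j) S₆ =
        (ginv (kerSlack c.K c.lam x.γ) * c.K * Matrix.diagonal p * c.K *
          ginv (kerSlack c.K c.lam x.γ)) i j := by
      rw [Matrix.mul_assoc (ginv (kerSlack c.K c.lam x.γ) * c.K * Matrix.diagonal p), ← w₂₀, ← v₆,
        ← w₂₄, Matrix.mul_apply, Ex.eval_sum (by simpa using hρ0)]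
      refine Finset.sum_congr rfl fun m _ => ?_
      simp [Ex.mat, Ex.vec, Ex.eval, ArithOp.eval, matOf, vecOf, hρ1]
    rw [Stmt.den_fill2 hρ0]
    change Ex.eval I (.nat 1) 2 _ S₆ / Ex.eval I (.scal 7) 2 _ S₆ * (Ex.eval I (.mat 13 0 1) 2 _ S₆ -
      Ex.eval I (.sum _) 2 _ S₆) = _
    rw [h1, primalCoeff, Matrix.smul_apply, Matrix.sub_apply, ← w₇, ← w₁₃, ← k₆ 13 (by decide)]
    simp [Ex.mat, Ex.scal, Ex.eval, matOf, scalOf, hρ1]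

end Program

/-- The queries with a price: `normSq` (array `29`), and the sums of the two mean embeddings at the
points (array `28`). -/
def queryStmt : Stmt :=
  .seq (.fill0 29 (.query .normSq)) (.fill1 28 (.query (.meanX 3) + .query (.meanY 3)))

/-- Compute the constants of the run and the start of the iteration. The dual point is zero at the
start, as is the array `30`. -/
def setupStmt : Stmt :=
  .seq (.fill2 3 (.query (.kerXY 3 4))) <|
  .seq (.fill2 4 (1 / (2 * .query .lamTwo) * (.query (.kerX 3 4) + .query (.kerY 3 4)))) <|
  .seq (.fill1 5 (.query (.cost 3) - 1 / (2 * .query .lamTwo) * .vec 28 0)) <|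
  .seq (.fill0 6 (.query .lamOne)) <|
  .seq (.fill0 7 (1 / (.query .lamOne * .reg 0 + .query .lamTwo +
    .scal 29 / .query .lamTwo))) <|
  .seq (.fill0 8 1) <| .seq (.fill0 9 1) <| .seq (.fill0 10 (2 * .reg 0 / .query .tau)) <|
    .fill1 11 (.scal 7 * .vec 5 0 - .query (.kerXY 3 3) / .query .lamOne)

/-- The program. -/
def barrierProgram : Cmd :=
  .seq (queryStmt.compile 0) <| .seq (setupStmt.compile 0) <|
  .seq (.loop (.realLt ⟨30, 1, 1⟩ ⟨9, 1, 1⟩) (roundStmt.compile 0)) (recoverStmt.compile 0)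

namespace Problem

variable {d : ℕ} {X Y : Set (EuclideanSpace ℝ (Fin d))} {HX : Type uX} {HY : Type uY}
  {HXY : Type uH} {ell : ℕ}
  [NormedAddCommGroup HXY] [InnerProductSpace ℝ HXY] {P : Problem X Y HX HY ell}
  {φ : X × Y → HXY} {τ : ℝ} {R : Matrix (Fin ell) (Fin ell) ℝ} {γ : Fin ell → ℝ}

theorem exists_factor : ∃ R : Matrix (Fin ell) (Fin ell) ℝ, Rᵀ * R = P.kerMatrix φ := by
  obtain ⟨Y, h1, h2⟩ := (posSemidef_gram_inner fun i => φ (P.x i, P.y i)).exists_sqrt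
  exact ⟨Y, by rw [h1, h2]; rfl⟩

variable [NormedAddCommGroup HX] [InnerProductSpace ℝ HX] [CompleteSpace HX]
  [NormedAddCommGroup HY] [InnerProductSpace ℝ HY] [CompleteSpace HY]
  [RKHS ℝ HX X ℝ] [RKHS ℝ HY Y ℝ]

variable (P) in
/-- The weight at the start of the iteration. -/
def startWeight : ℝ := 1 / (P.lamOne * ell + P.lamTwo + P.qSq / P.lamTwo)

variable (P φ τ) in
/-- The constants of the run. -/
def consts : Consts ell where
  K := P.kerMatrix φ
  Q := (1 / (2 * P.lamTwo)) • (P.dual 0).Q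
  b := -((1 / (2 * P.lamTwo)) • (P.dual 0).z)
  e := fun i => P.startWeight * -(1 / (2 * P.lamTwo) * (P.dual 0).z i) -
    P.kerMatrix φ i i / P.lamOne
  lam := P.lamOne
  tEnd := 2 * ell / τ

variable (P φ τ) in
/-- The sequence of iterates, computed without a factor of the kernel matrix. -/
def iterate (n : ℕ) : Iter ell := (P.consts φ τ).next^[n] ⟨0, P.startWeight, 1⟩

theorem consts_hess (hR : Rᵀ * R = P.kerMatrix φ) (hγ : ((P.dual R).slack γ).PosDef) (t : ℝ) :
    (P.consts φ τ).hess γ t = (P.dual R).hessT t γ := by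
  ext i j
  have := DualData.kerGram_apply (D := P.dual R) hR hγ i j
  simp only [Consts.hess, DualData.hessT, Matrix.of_apply, consts, Matrix.smul_apply, smul_eq_mul]
  rw [show P.lamOne = (P.dual R).lamOne from rfl, this, sq]
  rfl

theorem consts_grad (hR : Rᵀ * R = P.kerMatrix φ) (hγ : ((P.dual R).slack γ).PosDef) (t : ℝ) :
    (P.consts φ τ).grad γ t = (P.dual R).gradT t γ := by
  ext i
  have := DualData.kerGram_apply (D := P.dual R) hR hγ i i
  simp only [Consts.grad, DualData.gradT, consts, Matrix.smul_mulVec, Pi.smul_apply, Pi.neg_apply,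
    smul_eq_mul]
  rw [show P.lamOne = (P.dual R).lamOne from rfl, this, sub_eq_add_neg (1 / _ * _)]
  rfl

theorem consts_e (hR : Rᵀ * R = P.kerMatrix φ) (h1 : P.lamOne ≠ 0) :
    (P.consts φ τ).e = (P.dual R).gradT P.startWeight 0 := by
  ext i
  rw [DualData.gradT, DualData.gram_zero h1]
  simp only [Matrix.mulVec_zero, Pi.zero_apply, mul_zero, zero_sub]
  rw [show (P.dual R).Rᵀ * (P.dual R).R = P.kerMatrix φ from hR]
  rfl

theorem consts_next (hR : Rᵀ * R = P.kerMatrix φ) (h1 : P.lamOne ≠ 0) {x : Iter ell}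
    (hx : ((P.dual R).slack x.γ).PosDef) :
    (P.consts φ τ).next x = (P.dual R).next P.startWeight x := by
  rw [Consts.next, DualData.next, consts_e hR h1]
  congr 1
  · exact funext fun t => consts_hess hR hx t
  · exact funext fun t => consts_grad hR hx t

/-- The iterates do not depend on the factor of the kernel matrix. -/
theorem iterate_eq (hR : Rᵀ * R = P.kerMatrix φ) (h1 : P.lamOne ≠ 0)
    (h : ∀ n, (P.dual R).Near P.startWeight ((P.dual R).iterate P.startWeight n)) (n : ℕ) :
    P.iterate φ τ n = (P.dual R).iterate P.startWeight n := by
  induction n with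
  | zero => rw [iterate, DualData.iterate, Function.iterate_zero, Function.iterate_zero]
  | succ n ih =>
    rw [DualData.iterate_succ, iterate, Function.iterate_succ_apply', ← iterate, ih,
      consts_next hR h1 (h n).posDef]

end Problem

section Program

variable {d : ℕ} {X Y : Set (EuclideanSpace ℝ (Fin d))} {HX : Type uX} {HY : Type uY}
  {HXY : Type uH} {ell : ℕ}
  [NormedAddCommGroup HXY] [InnerProductSpace ℝ HXY]
  [NormedAddCommGroup HX] [InnerProductSpace ℝ HX] [CompleteSpace HX]
  [NormedAddCommGroup HY] [InnerProductSpace ℝ HY] [CompleteSpace HY]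
  [RKHS ℝ HX X ℝ] [RKHS ℝ HY Y ℝ]
  {P : Problem X Y HX HY ell} {φ : X × Y → HXY} {τ : ℝ} {ρ : ℕ → ℕ} {S : Store}

theorem den_queryStmt (hρ0 : ρ 0 = ell) :
    let S' := queryStmt.den (P.input φ τ) 0 ρ S
    scalOf (S' 29) = P.qSq ∧ vecOf ell (S' 28) = fun i => P.wMu (P.x i) + P.wNu (P.y i) := by
  intro S'
  simp only [S', queryStmt, Stmt.den_seq]
  set S₁ := (Stmt.fill0 29 (.query .normSq)).den (P.input φ τ) 0 ρ S with hS₁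
  have v₁ : scalOf (S₁ 29) = P.qSq := by rw [hS₁, Stmt.den_fill0]; rfl
  clear_value S₁
  refine ⟨?_, ?_⟩
  · rw [Stmt.den_of_keeps _ _ rfl, v₁]
  · ext i
    rw [Stmt.den_fill1 hρ0]
    simp [Ex.eval, ArithOp.eval, Query.answer, Problem.input]

theorem den_setupStmt (hlam : P.lamTwo ≠ 0) (hρ0 : ρ 0 = ell) (hρ1 : ρ 1 = 0)
    (h29 : scalOf (S 29) = P.qSq)
    (h28 : vecOf ell (S 28) = fun i => P.wMu (P.x i) + P.wNu (P.y i)) (h0 : S 0 = 0)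
    (h30 : S 30 = 0) :
    let S' := setupStmt.den (P.input φ τ) 0 ρ S
    (P.consts φ τ).Stored ⟨0, P.startWeight, 1⟩ S' ∧ scalOf (S' 9) = 1 := by
  intro S'
  simp only [S', setupStmt, Stmt.den_seq]
  set I := P.input φ τ with hI
  set S₁ := (Stmt.fill2 3 (.query (.kerXY 3 4))).den I 0 ρ S with hS₁
  have v₁ : matOf ell (S₁ 3) = P.kerMatrix φ := by
    ext i j
    rw [hS₁, Stmt.den_fill2 hρ0]
    simp [Ex.eval, Query.answer, hI, Problem.input]
  have k₁ : ∀ a, a ≠ 3 → S₁ a = S a := fun a ha => Function.update_of_ne ha _ _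
  clear_value S₁
  set S₂ := (Stmt.fill2 4 (1 / (2 * .query .lamTwo) *
    (.query (.kerX 3 4) + .query (.kerY 3 4)))).den I 0 ρ S₁ with hS₂
  have v₂ : matOf ell (S₂ 4) = (1 / (2 * P.lamTwo)) • (P.dual 0).Q := by
    ext i j
    rw [hS₂, Stmt.den_fill2 hρ0]
    simp [Ex.eval, ArithOp.eval, Query.answer, hI, Problem.input, Problem.dual]
  have k₂ : ∀ a, a ≠ 4 → S₂ a = S₁ a := fun a ha => Function.update_of_ne ha _ _
  clear_value S₂
  set S₃ := (Stmt.fill1 5 (.query (.cost 3) - 1 / (2 * .query .lamTwo) * .vec 28 0)).den I 0 ρ S₂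
    with hS₃
  have v₃ : vecOf ell (S₃ 5) = -((1 / (2 * P.lamTwo)) • (P.dual 0).z) := by
    ext i
    have h28' : S 28 i 0 = P.wMu (P.x i) + P.wNu (P.y i) := congrFun h28 i
    rw [hS₃, Stmt.den_fill1 hρ0]
    simp [Ex.vec, Ex.eval, ArithOp.eval, Query.answer, hI, Problem.input, Problem.dual,
      k₂ 28 (by decide), k₁ 28 (by decide), hρ1, h28']
    field_simp
    ring
  have k₃ : ∀ a, a ≠ 5 → S₃ a = S₂ a := fun a ha => Function.update_of_ne ha _ _
  clear_value S₃
  set S₄ := (Stmt.fill0 6 (.query .lamOne)).den I 0 ρ S₃ with hS₄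
  have v₄ : scalOf (S₄ 6) = P.lamOne := by rw [hS₄, Stmt.den_fill0]; rfl
  have k₄ : ∀ a, a ≠ 6 → S₄ a = S₃ a := fun a ha => Function.update_of_ne ha _ _
  clear_value S₄
  set S₅ := (Stmt.fill0 7 (1 / (.query .lamOne * .reg 0 + .query .lamTwo +
    .scal 29 / .query .lamTwo))).den I 0 ρ S₄ with hS₅
  have v₅ : scalOf (S₅ 7) = P.startWeight := by
    have h29' : S 29 0 0 = P.qSq := h29
    rw [hS₅, Stmt.den_fill0]
    simp [Ex.scal, Ex.eval, ArithOp.eval, Query.answer, hI, Problem.input, hρ0, hρ1,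
      k₄ 29 (by decide), k₃ 29 (by decide), k₂ 29 (by decide), k₁ 29 (by decide), h29',
      Problem.startWeight]
  have k₅ : ∀ a, a ≠ 7 → S₅ a = S₄ a := fun a ha => Function.update_of_ne ha _ _
  clear_value S₅
  set S₆ := (Stmt.fill0 8 1).den I 0 ρ S₅ with hS₆
  have v₆ : scalOf (S₆ 8) = 1 := by rw [hS₆, Stmt.den_fill0]; simp [Ex.eval]
  have k₆ : ∀ a, a ≠ 8 → S₆ a = S₅ a := fun a ha => Function.update_of_ne ha _ _
  clear_value S₆
  set S₇ := (Stmt.fill0 9 1).den I 0 ρ S₆ with hS₇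
  have v₇ : scalOf (S₇ 9) = 1 := by rw [hS₇, Stmt.den_fill0]; simp [Ex.eval]
  have k₇ : ∀ a, a ≠ 9 → S₇ a = S₆ a := fun a ha => Function.update_of_ne ha _ _
  clear_value S₇
  set S₈ := (Stmt.fill0 10 (2 * .reg 0 / .query .tau)).den I 0 ρ S₇ with hS₈
  have v₈ : scalOf (S₈ 10) = 2 * ell / τ := by
    rw [hS₈, Stmt.den_fill0]
    simp [Ex.eval, ArithOp.eval, Query.answer, hI, Problem.input, hρ0]
  have k₈ : ∀ a, a ≠ 10 → S₈ a = S₇ a := fun a ha => Function.update_of_ne ha _ _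
  clear_value S₈
  have w : ∀ a ∉ [3, 4, 5, 6, 7, 8, 9, 10], S₈ a = S a := by
    intro a ha
    simp only [List.mem_cons, List.not_mem_nil, or_false, not_or] at ha
    rw [k₈ a (by tauto), k₇ a (by tauto), k₆ a (by tauto), k₅ a (by tauto), k₄ a (by tauto),
      k₃ a (by tauto), k₂ a (by tauto), k₁ a (by tauto)]
  have e3 : S₈ 3 = S₁ 3 := by
    rw [k₈ 3 (by decide), k₇ 3 (by decide), k₆ 3 (by decide), k₅ 3 (by decide), k₄ 3 (by decide),
      k₃ 3 (by decide), k₂ 3 (by decide)]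
  have e4 : S₈ 4 = S₂ 4 := by
    rw [k₈ 4 (by decide), k₇ 4 (by decide), k₆ 4 (by decide), k₅ 4 (by decide), k₄ 4 (by decide),
      k₃ 4 (by decide)]
  have e5 : S₈ 5 = S₃ 5 := by
    rw [k₈ 5 (by decide), k₇ 5 (by decide), k₆ 5 (by decide), k₅ 5 (by decide), k₄ 5 (by decide)]
  have e6 : S₈ 6 = S₄ 6 := by
    rw [k₈ 6 (by decide), k₇ 6 (by decide), k₆ 6 (by decide), k₅ 6 (by decide)]
  have e7 : S₈ 7 = S₅ 7 := by rw [k₈ 7 (by decide), k₇ 7 (by decide), k₆ 7 (by decide)]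
  have e8 : S₈ 8 = S₆ 8 := by rw [k₈ 8 (by decide), k₇ 8 (by decide)]
  have e9 : S₈ 9 = S₇ 9 := k₈ 9 (by decide)
  have k₉ : ∀ a, a ≠ 11 → (Stmt.fill1 11 (.scal 7 * .vec 5 0 - .query (.kerXY 3 3) /
      .query .lamOne)).den I 0 ρ S₈ a = S₈ a := fun a ha => Function.update_of_ne ha _ _
  refine ⟨⟨?_, ?_, ?_, ?_, ?_, ?_, ?_, ?_, ?_, ?_⟩, ?_⟩
  · rw [k₉ 0 (by decide), w 0 (by decide), h0]; rfl
  · rw [k₉ 3 (by decide), e3, v₁]; rfl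
  · rw [k₉ 4 (by decide), e4, v₂]; rfl
  · rw [k₉ 5 (by decide), e5, v₃]; rfl
  · rw [k₉ 6 (by decide), e6, v₄]; rfl
  · rw [k₉ 7 (by decide), e7, v₅]
  · rw [k₉ 8 (by decide), e8, v₆]
  · rw [k₉ 10 (by decide), v₈]; rfl
  · ext i
    have h7 : S₈ 7 0 0 = P.startWeight := by rw [e7]; exact v₅
    have h5 : S₈ 5 i 0 = -(1 / (2 * P.lamTwo) * (P.dual 0).z i) := by
      rw [e5]; exact congrFun v₃ i
    rw [Stmt.den_fill1 hρ0]
    simp only [Problem.consts, ← h5, ← h7]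
    simp [Ex.scal, Ex.vec, Ex.eval, ArithOp.eval, Query.answer, hI, Problem.input, hρ1]
  · rw [k₉ 30 (by decide), w 30 (by decide), h30]; rfl
  · rw [k₉ 9 (by decide), e9, v₇]

end Program

/-! ### The execution of the program -/

/-- The constant in the bound `m + m * ℓ ^ 2` for the memory of the program. -/
def memConst : ℕ :=
  32 + (queryStmt.size + (setupStmt.size + (roundStmt.size + recoverStmt.size)))

/-- An upper bound for the cost of a run of the program with `N` rounds. -/
def runCost (ell C E N : ℕ) : ℕ :=
  queryStmt.cost ell C E + (setupStmt.cost ell C E +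
    (N * (roundStmt.cost ell C E + 1) + 1 + recoverStmt.cost ell C E))

/-- The price of the queries enters linearly, and a round takes cubic time. -/
theorem exists_runCost_le : ∃ w : ℕ, ∀ ell C E N : ℕ, 1 ≤ ell →
    runCost ell C E N ≤ C + 2 * E * ell + w * ((N + 1) * ell ^ 3) := by
  obtain ⟨w₁, h₁⟩ := setupStmt.exists_cost_le rfl
  obtain ⟨w₂, h₂⟩ := roundStmt.exists_cost_le rfl
  obtain ⟨w₃, h₃⟩ := recoverStmt.exists_cost_le rfl
  refine ⟨16 + w₁ + w₂ + w₃, fun ell C E N hell => ?_⟩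
  have hq : queryStmt.cost ell C E = C + 2 * E * ell + 9 * ell + 6 := by
    simp only [queryStmt, Stmt.cost]
    change 1 + C + 3 + (ell * (1 + E + (1 + E) + 1 + 3 + 3) + 2) = _
    ring
  have p1 : ell ≤ ell ^ 3 := Nat.le_self_pow (by lia) ell
  have p2 : ell ^ 2 ≤ ell ^ 3 := Nat.pow_le_pow_right hell (by lia)
  have d₁ : setupStmt.depth = 2 := rfl
  have d₂ : roundStmt.depth = 3 := rfl
  have d₃ : recoverStmt.depth = 3 := rfl
  have c₁ := h₁ ell C E hell
  have c₂ := h₂ ell C E hell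
  have c₃ := h₃ ell C E hell
  rw [d₁] at c₁
  rw [d₂] at c₂
  rw [d₃] at c₃
  have c₁' := c₁.trans (Nat.mul_le_mul_left w₁ p2)
  have c₂' := Nat.mul_le_mul_left N c₂
  rw [runCost, hq]
  have e1 : N ≤ N * ell ^ 3 := Nat.le_mul_of_pos_right _ (by positivity)
  have e2 : (16 + w₁ + w₂ + w₃) * ((N + 1) * ell ^ 3) = 16 * (N * ell ^ 3) + 16 * ell ^ 3 +
    (w₁ * ell ^ 3 + w₁ * (N * ell ^ 3)) + (N * (w₂ * ell ^ 3) + w₂ * ell ^ 3) +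
    (w₃ * ell ^ 3 + w₃ * (N * ell ^ 3)) := by ring
  rw [e2]
  have e3 : 0 ≤ w₁ * (N * ell ^ 3) := Nat.zero_le _
  have e4 : 0 ≤ w₂ * ell ^ 3 := Nat.zero_le _
  have e5 : 0 ≤ w₃ * (N * ell ^ 3) := Nat.zero_le _
  have e6 : N * (roundStmt.cost ell C E + 1) = N * roundStmt.cost ell C E + N := by ring
  linarith

/-- The program stops at the first iterate at which the tilt vanishes and the weight is large, and
then puts out the dual point, the coefficients of the primal functions, and those of the primal
operator. -/
theorem runs_barrierProgram {d : ℕ} {X Y : Set (EuclideanSpace ℝ (Fin d))} {HX : Type uX}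
    {HY : Type uY} {HXY : Type uH} {ell : ℕ}
    [NormedAddCommGroup HXY] [InnerProductSpace ℝ HXY]
    [NormedAddCommGroup HX] [InnerProductSpace ℝ HX] [CompleteSpace HX]
    [NormedAddCommGroup HY] [InnerProductSpace ℝ HY] [CompleteSpace HY]
    [RKHS ℝ HX X ℝ] [RKHS ℝ HY Y ℝ]
    {P : Problem X Y HX HY ell} {φ : X × Y → HXY} {τ : ℝ} (hell : 1 ≤ ell) (hlam : P.lamTwo ≠ 0)
    (C E : ℕ) {N : ℕ} (hs : ∀ n, 0 ≤ (P.iterate φ τ n).s)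
    (hN : (P.iterate φ τ N).s = 0 ∧ 2 * ell / τ ≤ (P.iterate φ τ N).t)
    (hlt : ∀ n < N, ¬ ((P.iterate φ τ n).s = 0 ∧ 2 * ell / τ ≤ (P.iterate φ τ n).t))
    {x : Iter ell} (hx : P.iterate φ τ N = x) {p : Fin ell → ℝ}
    (hp : p = Iter.newtonDir ((P.consts φ τ).hess x.γ x.t) ((P.consts φ τ).grad x.γ x.t)) :
    Runs (P.input φ τ) C E memConst barrierProgram (State.start ell) (runCost ell C E N) fun σ =>
      vecOf ell (σ.store 0) = x.γ ∧ vecOf ell (σ.store 1) = x.γ + p ∧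
        matOf ell (σ.store 2) = primalCoeff (P.kerMatrix φ) P.lamOne x.γ p x.t := by
  classical
  set I := P.input φ τ with hI
  set c := P.consts φ τ with hc
  have hell' : 1 ≤ I.ell := hell
  have hcont : ∀ n, (0 < (P.iterate φ τ n).s ∨ (P.iterate φ τ n).t < c.tEnd) ↔
      ¬ ((P.iterate φ τ n).s = 0 ∧ 2 * ell / τ ≤ (P.iterate φ τ n).t) := fun n => by
    rw [not_and_or, not_le, (hs n).lt_iff_ne']
    rfl
  have r₀ : (State.start ell).Ready I.ell := ⟨by simp [State.start, hI, Problem.input],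
    by simp [State.start]⟩
  refine Runs.seq (Stmt.runs_compile hell' _ rfl r₀ (by rw [memConst]; lia)) fun σ₁ h₁ => ?_
  have r₁ := h₁.ready r₀
  obtain ⟨q₁, q₂⟩ := den_queryStmt (P := P) (φ := φ) (τ := τ) (ρ := (State.start ell).int)
    (S := (State.start ell).store) r₀.1
  have a₀ : σ₁.store 0 = 0 := by rw [h₁.store 0 (by lia), Stmt.den_of_keeps _ _ rfl]; rfl
  have a₃₀ : σ₁.store 30 = 0 := by rw [h₁.store 30 (by lia), Stmt.den_of_keeps _ _ rfl]; rfl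
  rw [← hI, ← h₁.store 29 (by lia)] at q₁
  rw [← hI, ← h₁.store 28 (by lia)] at q₂
  refine Runs.seq (Stmt.runs_compile hell' _ rfl r₁ (by rw [memConst]; lia)) fun σ₂ h₂ => ?_
  have r₂ := h₂.ready r₁
  obtain ⟨s₁, s₂⟩ := den_setupStmt (P := P) (φ := φ) (τ := τ) hlam r₁.1 r₁.2 q₁ q₂ a₀ a₃₀
  have s₁' : c.Stored (P.iterate φ τ 0) σ₂.store := s₁.congr fun a ha => h₂.store a (by
    revert a; decide)
  rw [← hI, ← h₂.store 9 (by lia)] at s₂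
  -- the invariant of the loop
  let Inv : ℕ → State → Prop := fun n σ => σ.Ready I.ell ∧ c.Stored (P.iterate φ τ n) σ.store ∧
    scalOf (σ.store 9) =
      if 0 < (P.iterate φ τ n).s ∨ (P.iterate φ τ n).t < c.tEnd then 1 else 0
  have htest : ∀ n σ, Inv n σ → ((Test.realLt ⟨30, 1, 1⟩ ⟨9, 1, 1⟩).Holds σ ↔
      0 < (P.iterate φ τ n).s ∨ (P.iterate φ τ n).t < c.tEnd) := by
    intro n σ hσ
    have e1 : σ.get ⟨30, 1, 1⟩ = scalOf (σ.store 30) := by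
      simp [State.get, Ref.addr, hσ.1.2, scalOf, State.store]
    have e2 : σ.get ⟨9, 1, 1⟩ = scalOf (σ.store 9) := by
      simp [State.get, Ref.addr, hσ.1.2, scalOf, State.store]
    rw [Test.Holds, e1, e2, hσ.2.1.zero, hσ.2.2]
    split_ifs with h <;> simp [h]
  refine Runs.seq (Runs.loop Inv N (T := roundStmt.cost I.ell C E) (fun n hn σ hσ => ⟨?_, ?_⟩)
    (fun σ hσ => ?_) ⟨r₂, s₁', ?_⟩) fun σ₃ h₃ => ?_
  · rw [htest n σ hσ, hcont]
    exact hlt n hn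
  · refine (Stmt.runs_compile hell' roundStmt rfl hσ.1 (by rw [memConst]; lia)).mono le_rfl
      fun σ' h => ?_
    obtain ⟨u₁, u₂⟩ := den_roundStmt (I := I) (ell := ell) hσ.1.1 hσ.1.2 hσ.2.1
    have e : c.next (P.iterate φ τ n) = P.iterate φ τ (n + 1) :=
      (Function.iterate_succ_apply' _ _ _).symm
    rw [e] at u₁ u₂
    rw [← h.store 9 (by lia)] at u₂
    exact ⟨h.ready hσ.1, u₁.congr fun a ha => h.store a (by revert a; decide), u₂⟩
  · rw [htest N σ hσ, hcont, not_not]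
    exact hN
  · exact s₂.trans (if_pos (.inl one_pos)).symm
  · refine (Stmt.runs_compile hell' _ rfl h₃.1 (by rw [memConst]; lia)).mono le_rfl fun σ₄ h₄ => ?_
    have u := h₃.2.1
    rw [hx] at u
    obtain ⟨v₀, v₁, v₂⟩ := den_recoverStmt (I := I) (ell := ell) h₃.1.1 h₃.1.2 u hp
    rw [← h₄.store 0 (by lia)] at v₀
    rw [← h₄.store 1 (by lia)] at v₁
    rw [← h₄.store 2 (by lia)] at v₂
    exact ⟨v₀, v₁, v₂⟩

end

theorem mainTheorem10 :
    -- one program for all dimensions, spaces, problems and precisions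
    ∃ prog : Cmd,
    ∀ (d : ℕ) (X Y : Set (EuclideanSpace ℝ (Fin d)))
      (HX : Type uX) [NormedAddCommGroup HX] [InnerProductSpace ℝ HX] [CompleteSpace HX]
      [RKHS ℝ HX X ℝ]
      (HY : Type uY) [NormedAddCommGroup HY] [InnerProductSpace ℝ HY] [CompleteSpace HY]
      [RKHS ℝ HY Y ℝ]
      (HXY : Type uH) [NormedAddCommGroup HXY] [InnerProductSpace ℝ HXY] [CompleteSpace HXY]
      (φ : X × Y → HXY),
    -- the equality-constrained problem on all of `X × Y` is feasible
    (∃ (u : HX) (v : HY) (A : HXY →L[ℝ] HXY), A.IsPositive ∧ opTrace A ≠ ⊤ ∧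
      ∀ (x : X) (y : Y), quadCost (x : EuclideanSpace ℝ (Fin d)) y - u x - v y
        = ⟪φ (x, y), A (φ (x, y))⟫_ℝ) →
    -- the diagonal of the kernel `k_XY` is in `HX + HY`
    (∃ (u : HX) (v : HY), ∀ (x : X) (y : Y), u x + v y = ⟪φ (x, y), φ (x, y)⟫_ℝ) →
    ∀ r : ℕ, ∃ κ : ℝ, 0 < κ ∧
    ∀ (ell : ℕ) (τ : ℝ), 1 ≤ ell → 0 < τ → τ ≤ 1 / 2 →
    ∀ P : Problem X Y HX HY ell,
      (τ / ell) ^ r ≤ P.lamOne → P.lamOne ≤ (ell / τ) ^ r →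
      (τ / ell) ^ r ≤ P.lamTwo → P.lamTwo ≤ (ell / τ) ^ r →
      ‖P.wMu‖ ≤ (ell / τ) ^ r → ‖P.wNu‖ ≤ (ell / τ) ^ r →
    ∀ C E : ℕ,
    ∃ (σ : State) (T : ℕ) (W : Finset Loc) (γ β : Fin ell → ℝ) (B : Fin ell → Fin ell → ℝ),
      -- the program halts, within the claimed time and memory
      Exec (P.input φ τ) C E prog (State.start ell) σ T W ∧
      (T : ℝ) ≤ κ * (C + E * ell + (ell : ℝ) ^ (3.5 : ℝ) * Real.log (ell / τ)) ∧
      (W.card : ℝ) ≤ κ * (ell : ℝ) ^ 2 ∧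
      -- its output: the arrays `0`, `1` and `2`
      (∀ i : Fin ell, γ i = σ.real (0, i, 0)) ∧
      (∀ i : Fin ell, β i = σ.real (1, i, 0)) ∧
      (∀ i j : Fin ell, B i j = σ.real (2, i, j)) ∧
      -- `β` and `B` are the coefficients of an admissible triple that is optimal up to `τ`
      P.Admissible φ (P.uOf β) (P.vOf β) (P.opOf φ B) ∧
      (∀ (u : HX) (v : HY) (A : HXY →L[ℝ] HXY), P.Admissible φ u v A →
        P.value u v A - P.value (P.uOf β) (P.vOf β) (P.opOf φ B) ≤ τ) ∧
      -- `γ` is the result of a run of the barrier method, and a dual point optimal up to `τ`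
      ∀ R : Matrix (Fin ell) (Fin ell) ℝ, Rᵀ * R = P.kerMatrix φ →
        (∃ N : ℕ, (N : ℝ) ≤ κ * (√ell * Real.log (ell / τ)) ∧ (P.dual R).BarrierRun τ N γ) ∧
        ∀ γ' : Fin ell → ℝ, ((P.dual R).slack γ').PosSemidef →
          (P.dual R).F γ - (P.dual R).F γ' ≤ τ := by
  refine ⟨barrierProgram, ?_⟩
  intro d X Y HX _ _ _ _ HY _ _ _ _ HXY _ _ _ φ ⟨u, v, A, hA, hfin, hc⟩ ⟨u₁, v₁, hd⟩ r
  obtain ⟨κ, hκ, hrun⟩ := DualData.exists_stop_iterate (Real.sqrt_nonneg (‖u‖ ^ 2 + ‖v‖ ^ 2))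
    (Real.sqrt_nonneg (‖u₁‖ ^ 2 + ‖v₁‖ ^ 2)) (ENNReal.toReal_nonneg (a := opTrace A)) r
  obtain ⟨w, hw⟩ := exists_runCost_le
  have hlog2 : 0 < Real.log 2 := Real.log_pos one_lt_two
  refine ⟨2 + w * (κ + 1 / Real.log 2) + 2 * memConst + κ, by positivity, ?_⟩
  intro ell τ hell hτ hτ2 P hl1 hl1' hl2 hl2' hwMu hwNu C E
  have hl : (1 : ℝ) ≤ ell := by exact_mod_cast hell
  have p1 : 0 < P.lamOne := lt_of_lt_of_le (by positivity) hl1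
  have p2 : 0 < P.lamTwo := lt_of_lt_of_le (by positivity) hl2
  have hq : √P.qSq ^ 2 = P.qSq := Real.sq_sqrt (by rw [Problem.qSq]; positivity)
  have hq' : √P.qSq ^ 2 ≤ 2 * ((ell / τ) ^ r) ^ 2 := by
    rw [hq, Problem.qSq, two_mul]
    gcongr
  -- for each factor of the kernel matrix the iteration stops in time
  have key := fun R (hR : Rᵀ * R = P.kerMatrix φ) =>
    hrun ell τ hell hτ hτ2 (P.dual R) _ _ _ _ P.startWeight
      (Problem.slater_dual p1 p2 hR hA hfin hc hd) hl1 hl1' hl2 hl2' hq'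
      (by rw [hq]; rfl)
  obtain ⟨R, hR⟩ := Problem.exists_factor (P := P) (φ := φ)
  obtain ⟨hnear, N, hNle, hN, hlt, -⟩ := key R hR
  have hit := Problem.iterate_eq (τ := τ) hR p1.ne' hnear
  set x := P.iterate φ τ N with hx
  simp only [← hit] at hnear hN hlt
  rw [← hx] at hN
  have hxt : 0 < x.t := (hnear N).t_pos
  -- the Newton direction of the last iterate
  set p := Iter.newtonDir ((P.consts φ τ).hess x.γ x.t) ((P.consts φ τ).grad x.γ x.t) with hp
  obtain ⟨σ, T, W, hexec, hT, hW, vγ, vβ, vB⟩ := runs_barrierProgram hell p2.ne' C E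
    (fun n => (hnear n).s_nonneg) hN hlt hx.symm hp
  have hbound := (hnear N).bound
  rw [← hx, hN.1, zero_smul, sub_zero] at hbound
  have hpos := (hnear N).posDef
  obtain ⟨n1, n2⟩ := DualData.Near.newtonDir (Problem.valid_dual p1 p2) hxt.le hpos
    (by norm_num) hbound
  rw [← Problem.consts_hess (τ := τ) hR hpos, ← Problem.consts_grad (τ := τ) hR hpos] at n1 n2
  rw [← hx, ← hp] at n1 n2
  rw [Problem.consts_hess (τ := τ) hR hpos, Problem.consts_grad (τ := τ) hR hpos] at n1
  obtain ⟨hadm, hgap⟩ := Problem.admissible_primal hell p1 p2 hR hxt hpos n1 n2 vB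
  replace hgap := hgap.trans (show 2 * ell / x.t ≤ τ by
    have := hN.2
    rw [div_le_iff₀ hτ] at this
    rw [div_le_iff₀ hxt]
    linarith)
  refine ⟨σ, T, W, x.γ, x.γ + p, matOf ell (σ.store 2), hexec, ?_, ?_,
    fun i => (congrFun vγ i).symm, fun i => (congrFun vβ i).symm, fun i j => rfl, hadm,
    fun u' v' A' h' => ?_, fun R' hR' => ⟨?_, fun γ' hγ' => ?_⟩⟩
  · -- the time
    have e1 : (T : ℝ) ≤ C + 2 * E * ell + w * ((N + 1) * (ell : ℝ) ^ 3) := by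
      exact_mod_cast hT.trans (hw ell C E N hell)
    have e2 : (ell : ℝ) ^ (3.5 : ℝ) = √ell * (ell : ℝ) ^ 3 := by
      rw [Real.sqrt_eq_rpow, ← Real.rpow_natCast, ← Real.rpow_add (by positivity)]
      norm_num
    have e3 : Real.log 2 ≤ Real.log (ell / τ) := by
      refine Real.log_le_log two_pos ?_
      rw [le_div_iff₀ hτ]
      linarith
    have e4 : (1 : ℝ) ≤ 1 / Real.log 2 * (√ell * Real.log (ell / τ)) := by
      have : Real.log 2 ≤ √ell * Real.log (ell / τ) :=
        e3.trans (le_mul_of_one_le_left (hlog2.le.trans e3) (Real.one_le_sqrt.2 hl))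
      rw [div_mul_eq_mul_div, one_mul, le_div_iff₀ hlog2]
      linarith
    have e5 : (w : ℝ) * ((N + 1) * (ell : ℝ) ^ 3) ≤
        w * (κ + 1 / Real.log 2) * ((ell : ℝ) ^ (3.5 : ℝ) * Real.log (ell / τ)) := by
      rw [e2]
      calc (w : ℝ) * ((N + 1) * (ell : ℝ) ^ 3)
          ≤ w * ((κ * (√ell * Real.log (ell / τ)) + 1 / Real.log 2 *
            (√ell * Real.log (ell / τ))) * (ell : ℝ) ^ 3) := by gcongr
        _ = _ := by ring
    have e6 : 0 ≤ (ell : ℝ) ^ (3.5 : ℝ) * Real.log (ell / τ) :=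
      mul_nonneg (by positivity) (hlog2.le.trans e3)
    have e7 : (0 : ℝ) ≤ C := by positivity
    have e8 : (0 : ℝ) ≤ E * ell := by positivity
    have e9 : 0 ≤ (w * (κ + 1 / Real.log 2) + 2 * memConst + κ) * (C + E * ell : ℝ) := by positivity
    have e10 : 0 ≤ (2 + 2 * memConst + κ) *
      ((ell : ℝ) ^ (3.5 : ℝ) * Real.log (ell / τ)) := mul_nonneg (by positivity) e6
    linarith
  · -- the memory
    have e1 : (W.card : ℝ) ≤ memConst + memConst * (ell * ell) := by
      exact_mod_cast (Finset.card_le_card hW).trans (card_memBox memConst ell).le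
    have e2 : (memConst : ℝ) ≤ memConst * (ell : ℝ) ^ 2 :=
      le_mul_of_one_le_right (by positivity) (one_le_pow₀ hl)
    have e3 : 0 ≤ (2 + w * (κ + 1 / Real.log 2) + κ) * (ell : ℝ) ^ 2 := by positivity
    linarith
  · have := Problem.value_le_F p1 p2 hR hpos.posSemidef h'
    linarith
  · obtain ⟨hnear', N', hN'le, hN', hlt', hbar⟩ := key R' hR'
    have hit' := Problem.iterate_eq (τ := τ) hR' p1.ne' hnear'
    simp only [← hit'] at hN' hlt' hbar
    obtain rfl : N' = N := le_antisymm (not_lt.1 fun h => hlt' N h hN)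
      (not_lt.1 fun h => hlt N' h hN')
    refine ⟨N', hN'le.trans ?_, hbar⟩
    have : 0 ≤ √(ell : ℝ) * Real.log (ell / τ) := by
      refine mul_nonneg (Real.sqrt_nonneg _) (Real.log_nonneg ?_)
      rw [le_div_iff₀ hτ]
      linarith
    gcongr
    exact le_add_of_nonneg_left (by positivity)
  · -- the dual objective does not depend on the factor
    change (P.dual R).F x.γ - _ ≤ τ
    have := Problem.value_le_F p1 p2 hR' hγ' hadm
    linarith
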